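/- **Setting.** Let $\Omega=(0,1)^2$. For $N\in\mathbb N$ put $h=1/(N+1)$, identify the grid point $(ih,jh)$ with $(i,j)\in\{0,\dots,N+1\}^2$, and for a real discrete function $f_h=(f_{i,j})$ set $$\int_{\Omega_h}f_h=h^2\sum_{i,j=1}^N f_{i,j},\qquad \int_{\Omega_{h,1}^-}f_h=h^2\sum_{i=0}^N\sum_{j=1}^N f_{i,j},\qquad \int_{\Omega_{h,2}^-}f_h=h^2\sum_{i=1}^N\sum_{j=0}^N f_{i,j},$$ $$\int_{\Gamma_{h,1}^+}f_h=h\sum_{j=1}^N f_{N+1,j},\qquad \int_{\Gamma_{h,2}^+}f_h=h\sum_{i=1}^N f_{i,N+1}.$$ Let $(\partial_{h,1}^+v)_{i,j}=(\partial_{h,1}^-v)_{i+1,j}=\frac{v_{i+1,j}-v_{i,j}}h$, $(\partial_{h,2}^+v)_{i,j}=(\partial_{h,2}^-v)_{i,j+1}=\frac{v_{i,j+1}-v_{i,j}}h$, and $\Box_h=\partial_{tt}-\Delta_{h,1}-\Delta_{h,2}$ with $(\Delta_{h,1}v)_{i,j}=\frac{v_{i+1,j}-2v_{i,j}+v_{i-1,j}}{h^2}$,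 $(\Delta_{h,2}v)_{i,j}=\frac{v_{i,j+1}-2v_{i,j}+v_{i,j-1}}{h^2}$. **Theorem.** Let $a>0$, $x_a=(-a,-a)$, $\beta\in(0,1)$, $T>0$, and let $c_0>0$ be such that $$\psi(t,x)=|x-x_a|^2-\beta t^2+c_0\ge 1\quad\text{on }[-T,T]\times[0,1]^2 .$$ For $\mu\ge1$ let $\varphi=e^{\mu\psi}$ and let $\varphi_h(t)$ be the restriction of $\varphi(t,\cdot)$ to the grid points. There exist $\tau_0\ge1$, $\mu\ge1$, $\varepsilon>0$, $h_0>0$ and $C>0$, all independent of $h$, such that for all $h=1/(N+1)\in(0,h_0)$, all $\tau\in(\tau_0,\varepsilon/h)$ and all $w_h$ with $$\Box_hw_h\in L^2(-T,T;L^2_h(\Omega_h)),$$ $$w_{0,j}(t)=w_{N+1,j}(t)=w_{i,0}(t)=w_{i,N+1}(t)=0\quad(t\in(-T,T),\ 0\le i,j\le N+1),$$ $$w_{i,j}(\pm T)=\partial_tw_{i,j}(\pm T)=0\quad(0\le i,j\le N+1),$$ one has $$\tau\int_{-T}^T\!\!\int_{\Omega_h}e^{2\tau\varphi_h}|\partial_tw_h|^2dt+\tau\sum_{k=1,2}\int_{-T}^T\!\!\int_{\Omega_{h,k}^-}e^{2\tau\varphi_h}|\partial_{h,k}^+w_h|^2dt+\tau^3\int_{-T}^T\!\!\int_{\Omega_h}e^{2\tau\varphi_h}|w_h|^2dt\le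 R,$$ where $$R=C\int_{-T}^T\!\!\int_{\Omega_h}e^{2\tau\varphi_h}|\Box_hw_h|^2dt+C\tau\sum_{k=1,2}\int_{-T}^T\!\!\int_{\Gamma_{h,k}^+}e^{2\tau\varphi_h}|\partial_{h,k}^-w_h|^2dt+C\tau h^2\sum_{k=1,2}\int_{-T}^T\!\!\int_{\Omega_{h,k}^-}e^{2\tau\varphi_h}|\partial_{h,k}^+\partial_tw_h|^2dt .$$ Moreover, if $w_h(0)=0$ on $\Omega_h$, i.e. $w_{i,j}(0)=0$ for $1\le i,j\le N$, then also $$\tau^{1/2}\int_{\Omega_h}e^{2\tau\varphi_h(0)}|\partial_tw_h(0)|^2\le R .$$ -/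

import Mathlib

open Set MeasureTheory

noncomputable section

namespace SemiDiscreteWave

/-- A discrete function on the grid: `u i j` is the value at the node `(i h, j h)`. Only the nodes
with `0 ≤ i, j ≤ N + 1`, where `h = 1 / (N + 1)`, are ever used. -/
abbrev GridFn : Type := ℕ → ℕ → ℝ

/-- The mesh size `h = 1 / (N + 1)` of the grid with `N` interior points in each direction. -/
def mesh (N : ℕ) : ℝ := 1 / ((N : ℝ) + 1)

/-! ### Carleman weights -/

/-- `ψ(t, x) = |x - x_a|² - β t² + c₀` with `x_a = (-a, -a)`. -/
def psi (a β c₀ t x₁ x₂ : ℝ) : ℝ :=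
  ((x₁ - (-a)) ^ 2 + (x₂ - (-a)) ^ 2) - β * t ^ 2 + c₀

/-- `φ(t, x) = exp (μ ψ(t, x))`. -/
def phi (a β c₀ μ t x₁ x₂ : ℝ) : ℝ := Real.exp (μ * psi a β c₀ t x₁ x₂)

/-- `φ_h(t)`, the restriction of `φ(t, ·)` to the grid nodes. -/
def phiH (a β c₀ μ : ℝ) (N : ℕ) (t : ℝ) : GridFn :=
  fun i j => phi a β c₀ μ t ((i : ℝ) * mesh N) ((j : ℝ) * mesh N)

/-- The weight `exp (2 τ φ_h(t))` on the grid nodes. -/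
def weight (a β c₀ μ τ : ℝ) (N : ℕ) (t : ℝ) : GridFn :=
  fun i j => Real.exp (2 * τ * phiH a β c₀ μ N t i j)

/-! ### Discrete integrals; the directions `k = 1, 2` are indexed by `0, 1 : Fin 2` -/

/-- `∫_{Ω_h} f = h² ∑_{i,j=1}^N f_{i,j}`. -/
def intOmega (N : ℕ) (f : GridFn) : ℝ :=
  mesh N ^ 2 * ∑ i ∈ Finset.Icc 1 N, ∑ j ∈ Finset.Icc 1 N, f i j

/-- `∫_{Ω_{h,k}^-} f`: the index in direction `k` runs from `0` to `N`, the other one from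
`1` to `N`. -/
def intOmegaMinus (N : ℕ) (k : Fin 2) (f : GridFn) : ℝ :=
  match k with
  | 0 => mesh N ^ 2 * ∑ i ∈ Finset.Icc 0 N, ∑ j ∈ Finset.Icc 1 N, f i j
  | 1 => mesh N ^ 2 * ∑ i ∈ Finset.Icc 1 N, ∑ j ∈ Finset.Icc 0 N, f i j

/-- `∫_{Γ_{h,k}^+} f`: the (one-dimensional) discrete integral over the nodes of the open side
`x_k = 1` of the square. -/
def intGammaPlus (N : ℕ) (k : Fin 2) (f : GridFn) : ℝ :=
  match k with
  | 0 => mesh N * ∑ j ∈ Finset.Icc 1 N, f (N + 1) j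
  | 1 => mesh N * ∑ i ∈ Finset.Icc 1 N, f i (N + 1)

/-! ### Discrete operators -/

/-- The forward difference `∂_{h,k}^+`. -/
def dPlus (N : ℕ) (k : Fin 2) (u : GridFn) : GridFn :=
  match k with
  | 0 => fun i j => (u (i + 1) j - u i j) / mesh N
  | 1 => fun i j => (u i (j + 1) - u i j) / mesh N

/-- The backward difference `∂_{h,k}^-` (used only where the index in direction `k` is
positive). -/
def dMinus (N : ℕ) (k : Fin 2) (u : GridFn) : GridFn :=
  match k with
  | 0 => fun i j => (u i j - u (i - 1) j) / mesh N
  | 1 => fun i j => (u i j - u i (j - 1)) / mesh N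

/-- The second difference `Δ_{h,k}` (used only where the index in direction `k` is positive). -/
def secondDiff (N : ℕ) (k : Fin 2) (u : GridFn) : GridFn :=
  match k with
  | 0 => fun i j => (u (i + 1) j - 2 * u i j + u (i - 1) j) / mesh N ^ 2
  | 1 => fun i j => (u i (j + 1) - 2 * u i j + u i (j - 1)) / mesh N ^ 2

/-- The time derivative `∂_t w` on `[-T, T]`, node by node (one-sided at `t = ± T`). -/
def dt (T : ℝ) (w : ℝ → GridFn) : ℝ → GridFn :=
  fun t i j => derivWithin (fun s => w s i j) (Icc (-T) T) t

/-- The semi-discrete wave operator `□_h = ∂_{tt} - Δ_{h,1} - Δ_{h,2}`. -/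
def box (N : ℕ) (T : ℝ) (w : ℝ → GridFn) : ℝ → GridFn :=
  fun t i j => dt T (dt T w) t i j - ∑ k : Fin 2, secondDiff N k (w t) i j

/-- The functions `w_h` to which the Carleman estimate applies. The first three fields say that
`□_h w_h ∈ L²(-T, T; L²_h(Ω_h))`, where `∂_{tt}` is taken in the sense of distributions: since
there are finitely many nodes, this means that at each interior node `w` is differentiable on
`[-T, T]` with absolutely continuous derivative and that (the a.e. defined function) `□_h w` is
square integrable. -/
structure Admissible (N : ℕ) (T : ℝ) (w : ℝ → GridFn) : Prop where
  differentiable : ∀ i ∈ Finset.Icc 1 N, ∀ j ∈ Finset.Icc 1 N,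
    DifferentiableOn ℝ (fun t => w t i j) (Icc (-T) T)
  absolutelyContinuous : ∀ i ∈ Finset.Icc 1 N, ∀ j ∈ Finset.Icc 1 N,
    AbsolutelyContinuousOnInterval (fun t => dt T w t i j) (-T) T
  box_memLp : ∀ i ∈ Finset.Icc 1 N, ∀ j ∈ Finset.Icc 1 N,
    MemLp (fun t => box N T w t i j) 2 (volume.restrict (Ioo (-T) T))
  boundary_zero : ∀ t ∈ Ioo (-T) T, ∀ l ∈ Finset.Icc 0 (N + 1),
    w t 0 l = 0 ∧ w t (N + 1) l = 0 ∧ w t l 0 = 0 ∧ w t l (N + 1) = 0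
  final_zero : ∀ i ∈ Finset.Icc 0 (N + 1), ∀ j ∈ Finset.Icc 0 (N + 1),
    w (-T) i j = 0 ∧ w T i j = 0 ∧ dt T w (-T) i j = 0 ∧ dt T w T i j = 0

/-! ### The terms of the Carleman estimate, for a given weight `ρ = exp (2 τ φ_h)` -/

/-- `τ ∫∫_{Ω_h} ρ |∂_t w|² + τ ∑_k ∫∫_{Ω_{h,k}^-} ρ |∂_{h,k}^+ w|² + τ³ ∫∫_{Ω_h} ρ |w|²`. -/
def carlemanLHS (N : ℕ) (T τ : ℝ) (ρ w : ℝ → GridFn) : ℝ :=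
  τ * (∫ t in (-T)..T, intOmega N (fun i j => ρ t i j * |dt T w t i j| ^ 2))
  + τ * ∑ k : Fin 2,
      (∫ t in (-T)..T, intOmegaMinus N k (fun i j => ρ t i j * |dPlus N k (w t) i j| ^ 2))
  + τ ^ 3 * (∫ t in (-T)..T, intOmega N (fun i j => ρ t i j * |w t i j| ^ 2))

/-- `C ∫∫_{Ω_h} ρ |□_h w|² + C τ ∑_k ∫∫_{Γ_{h,k}^+} ρ |∂_{h,k}^- w|²
+ C τ h² ∑_k ∫∫_{Ω_{h,k}^-} ρ |∂_{h,k}^+ ∂_t w|²`. -/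
def carlemanRHS (N : ℕ) (T τ C : ℝ) (ρ w : ℝ → GridFn) : ℝ :=
  C * (∫ t in (-T)..T, intOmega N (fun i j => ρ t i j * |box N T w t i j| ^ 2))
  + C * τ * ∑ k : Fin 2,
      (∫ t in (-T)..T, intGammaPlus N k (fun i j => ρ t i j * |dMinus N k (w t) i j| ^ 2))
  + C * τ * mesh N ^ 2 * ∑ k : Fin 2,
      (∫ t in (-T)..T,
        intOmegaMinus N k (fun i j => ρ t i j * |dPlus N k (dt T w t) i j| ^ 2))

end SemiDiscreteWave

end

/-!
The proof conjugates the equation with the weight and computes with the conjugated operator. Put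
`v = exp (τ φ) w` and `ρ = τ h`. Then `exp (τ φ) □ w = L₁ v + L₂ v + R`, where `L₁` is symmetric,
`L₁ v = ∂ₜₜ v - div (c ∇v) + q v` with `c = cosh (τ (φ(x + h) - φ(x)))`, and `L₂` is the first-order
multiplier, consisting of the antisymmetric part, a zero-order term `gee` that moves positivity
from the gradient to the time derivative, and a viscosity `- Z τ h ∑ₖ (∂ₖ⁺ - ∂ₖ⁻) v`
(`Params.expW_mul_box`). Summation by parts turns `2 ⟨L₁ v, L₂ v⟩` into the time derivative of an
energy plus a commutator form (`Coeffs.boxSum_symPart_mul_multiplier`); the viscosity contributes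
the square of the difference between forward and backward difference quotients, a nonnegative mixed
term, and a term in `∇ ∂ₜ v` which accounts for the last term of the right-hand side of the
estimate.

The commutator form is `τ` times a quadratic form whose coefficients extend continuously to `h = 0`,
`ρ = 0`, `1 / τ = 0`: they are built from `sinh z / z` and from difference quotients of the weight.
In the limit, and if forward and backward differences agree, it is the classical form, a sum of
nonnegative terms that is positive definite for a suitable `μ` because `β < 1` and `|∇ψ|` is bounded
away from zero (`Params.form_zero`, `Params.form_zero_pos`). If they do not agree, a large viscosity
`Z` compensates (`Params.exists_viscosity`). Positivity is an open condition and the remaining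
variables range over a compact set, so it persists for small `h`, `τ h` and `1 / τ`
(`Params.exists_netForm_nonneg`); this is where the smallness of `τ h` comes from.

At a fixed time this yields a differential inequality (`Params.boxSum_energyDeriv_add_le`, and
`Params.energyDeriv_add_lhsDensity_le` in terms of `w`). At the sides of the square through the
origin the boundary terms have a favourable sign since `∂ₖ φ > 0`; at the opposite sides they are
bounded by the boundary term of the estimate. Integrating over `[-T, T]`, where the energy vanishes
at both ends, gives the first claim. For the second one, the energy also vanishes at `t = 0`, because
`∂ₜ φ = 0` and `v = 0` there. Hence the same inequality can be integrated over `[-T, 0]`, and the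
terms it controls absorb the derivative of `√τ` times the natural energy of `L₁`, whose value at
`t = 0` is the left-hand side of the claim (`carleman_of_coercive`).
-/

noncomputable section

namespace SemiDiscreteWave

/-! ### Summation by parts on the grid -/

/-- The sum over the closed grid `{0, …, N + 1}²` of an array indexed by `ℤ²`. -/
def boxSum (N : ℕ) (f : ℤ → ℤ → ℝ) : ℝ :=
  ∑ i ∈ Finset.range (N + 2), ∑ j ∈ Finset.range (N + 2), f i j

/-- The array vanishes off the interior nodes `{1, …, N}²`. -/
def InteriorSupported (N : ℕ) (v : ℤ → ℤ → ℝ) : Prop :=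
  ∀ i j : ℤ, (i ≤ 0 ∨ (N : ℤ) + 1 ≤ i ∨ j ≤ 0 ∨ (N : ℤ) + 1 ≤ j) → v i j = 0

/-- Forward difference quotient in the first index. -/
def dX (h : ℝ) (v : ℤ → ℤ → ℝ) : ℤ → ℤ → ℝ := fun i j => (v (i + 1) j - v i j) / h

/-- Forward difference quotient in the second index. -/
def dY (h : ℝ) (v : ℤ → ℤ → ℝ) : ℤ → ℤ → ℝ := fun i j => (v i (j + 1) - v i j) / h

/-- The array with its two indices exchanged. -/
def swap (v : ℤ → ℤ → ℝ) : ℤ → ℤ → ℝ := fun i j => v j i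

lemma InteriorSupported.swap {N : ℕ} {v : ℤ → ℤ → ℝ} (hv : InteriorSupported N v) :
    InteriorSupported N (swap v) := fun i j h => hv j i (by tauto)

lemma boxSum_swap (N : ℕ) (f : ℤ → ℤ → ℝ) : boxSum N (swap f) = boxSum N f :=
  Finset.sum_comm

lemma boxSum_add (N : ℕ) (f g : ℤ → ℤ → ℝ) :
    boxSum N (fun i j => f i j + g i j) = boxSum N f + boxSum N g := by
  simp [boxSum, Finset.sum_add_distrib]

lemma boxSum_sub (N : ℕ) (f g : ℤ → ℤ → ℝ) :
    boxSum N (fun i j => f i j - g i j) = boxSum N f - boxSum N g := by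
  simp [boxSum, Finset.sum_sub_distrib]

lemma boxSum_mul (N : ℕ) (a : ℝ) (f : ℤ → ℤ → ℝ) :
    boxSum N (fun i j => a * f i j) = a * boxSum N f := by
  simp [boxSum, Finset.mul_sum]

lemma boxSum_nonneg (N : ℕ) {f : ℤ → ℤ → ℝ} (hf : ∀ i j, 0 ≤ f i j) : 0 ≤ boxSum N f :=
  Finset.sum_nonneg fun _ _ => Finset.sum_nonneg fun _ _ => hf _ _

/-- Sums of discrete divergences vanish when the fluxes vanish at the outer faces. -/
lemma boxSum_flux (N : ℕ) (F G : ℤ → ℤ → ℝ) (hF0 : ∀ j, F 0 j = 0)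
    (hF1 : ∀ j, F ((N : ℤ) + 2) j = 0) (hG0 : ∀ i, G i 0 = 0)
    (hG1 : ∀ i, G i ((N : ℤ) + 2) = 0) :
    boxSum N (fun i j => (F (i + 1) j - F i j) + (G i (j + 1) - G i j)) = 0 := by
  rw [boxSum_add]
  have h1 : boxSum N (fun i j => F (i + 1) j - F i j) = 0 := by
    rw [← boxSum_swap]
    refine Finset.sum_eq_zero fun j _ => ?_
    have := Finset.sum_range_sub (fun i : ℕ => F (i : ℤ) (j : ℤ)) (N + 2)
    simp only [SemiDiscreteWave.swap]
    push_cast at this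
    rw [this, hF0, hF1, sub_zero]
  have h2 : boxSum N (fun i j => G i (j + 1) - G i j) = 0 := by
    refine Finset.sum_eq_zero fun i _ => ?_
    have := Finset.sum_range_sub (fun j : ℕ => G (i : ℤ) (j : ℤ)) (N + 2)
    push_cast at this
    rw [this, hG0, hG1, sub_zero]
  rw [h1, h2, add_zero]

lemma boxSum_flux_left (N : ℕ) (F : ℤ → ℤ → ℝ) (hF0 : ∀ j, F 0 j = 0)
    (hF1 : ∀ j, F ((N : ℤ) + 2) j = 0) :
    boxSum N (fun i j => F (i + 1) j - F i j) = 0 := by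
  simpa using boxSum_flux N F (fun _ _ => 0) hF0 hF1 (fun _ => rfl) (fun _ => rfl)

lemma InteriorSupported.eq_zero_left {N : ℕ} {v : ℤ → ℤ → ℝ} (hv : InteriorSupported N v)
    {i : ℤ} (hi : i ≤ 0) (j : ℤ) : v i j = 0 :=
  hv i j (Or.inl hi)

lemma InteriorSupported.eq_zero_right {N : ℕ} {v : ℤ → ℤ → ℝ} (hv : InteriorSupported N v)
    {i : ℤ} (hi : (N : ℤ) + 1 ≤ i) (j : ℤ) : v i j = 0 :=
  hv i j (Or.inr (Or.inl hi))

lemma InteriorSupported.eq_zero_bot {N : ℕ} {v : ℤ → ℤ → ℝ} (hv : InteriorSupported N v)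
    (i : ℤ) {j : ℤ} (hj : j ≤ 0) : v i j = 0 :=
  hv i j (Or.inr (Or.inr (Or.inl hj)))

lemma InteriorSupported.eq_zero_top {N : ℕ} {v : ℤ → ℤ → ℝ} (hv : InteriorSupported N v)
    (i : ℤ) {j : ℤ} (hj : (N : ℤ) + 1 ≤ j) : v i j = 0 :=
  hv i j (Or.inr (Or.inr (Or.inr hj)))

/-- The terms of `2 ⟨L₁ v, L₂ v⟩` that involve differences in the first direction only, minus the
density into which summation by parts transforms them. -/
def lineResidual (h Y : ℝ) (b g q c s v v₁ : ℤ → ℤ → ℝ) : ℤ → ℤ → ℝ := fun i j =>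
  -2 * v₁ i j * (s i j * dX h v₁ i j + s (i - 1) j * dX h v₁ (i - 1) j)
    - 2 * ((s i j - s (i - 1) j) / h) * v₁ i j ^ 2
  + 2 * Y * v₁ i j * (dX h v₁ i j - dX h v₁ (i - 1) j)
    + 2 * Y * (v₁ (i + 1) j - v₁ i j) * dX h v₁ i j
  + 4 * b i j * v₁ i j * ((c i j * dX h v i j - c (i - 1) j * dX h v (i - 1) j) / h)
    + 4 * c i j * dX h v i j * ((b i j + b (i + 1) j) / 2) * dX h v₁ i j
    + 2 * v₁ i j * (c i j * dX h v i j * ((b (i + 1) j - b i j) / h)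
        + c (i - 1) j * dX h v (i - 1) j * ((b i j - b (i - 1) j) / h))
  - 2 * ((c i j * dX h v i j - c (i - 1) j * dX h v (i - 1) j) / h)
      * (s i j * dX h v i j + s (i - 1) j * dX h v (i - 1) j)
    - 2 * ((s i j * c (i - 1) j - c i j * s (i - 1) j) / h) * dX h v i j * dX h v (i - 1) j
  - 2 * ((c i j * dX h v i j - c (i - 1) j * dX h v (i - 1) j) / h) * (g i j * v i j)
    - 2 * c i j * g (i + 1) j * dX h v i j ^ 2
    - 2 * c i j * ((g (i + 1) j - g i j) / h) * dX h v i j * v i j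
  + 2 * q i j * v i j * (s i j * dX h v i j + s (i - 1) j * dX h v (i - 1) j)
    + 2 * q i j * ((s i j - s (i - 1) j) / h) * v i j ^ 2
    + 2 * s i j * ((q (i + 1) j - q i j) / h) * v i j * v (i + 1) j

/-- The residual is a discrete divergence whose flux vanishes at the outer faces. -/
lemma boxSum_lineResidual {N : ℕ} (h Y : ℝ) (b g q c s : ℤ → ℤ → ℝ) {v v₁ : ℤ → ℤ → ℝ}
    (hv : InteriorSupported N v) (hv₁ : InteriorSupported N v₁) :
    boxSum N (lineResidual h Y b g q c s v v₁) = 0 := by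
  let F : ℤ → ℤ → ℝ := fun i j =>
    -2 / h * s (i - 1) j * v₁ (i - 1) j * v₁ i j + 2 * Y * v₁ i j * dX h v₁ (i - 1) j
    + 4 / h * (b i j * v₁ i j) * c (i - 1) j * dX h v (i - 1) j
    - 2 * c (i - 1) j * dX h v (i - 1) j * ((b i j - b (i - 1) j) / h) * v₁ i j
    - 2 / h * c (i - 1) j * s (i - 1) j * dX h v (i - 1) j ^ 2
    - 2 / h * c (i - 1) j * dX h v (i - 1) j * (g i j * v i j)
    + 2 / h * s (i - 1) j * q i j * v (i - 1) j * v i j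
  have hF : lineResidual h Y b g q c s v v₁ = fun i j => F (i + 1) j - F i j := by
    funext i j
    simp only [F, lineResidual, dX, add_sub_cancel_right, sub_add_cancel]
    ring
  rw [hF]
  refine boxSum_flux_left N F (fun j => ?_) (fun j => ?_)
  · simp [F, dX, hv.eq_zero_left, hv₁.eq_zero_left]
  · have e : (N : ℤ) + 2 - 1 = N + 1 := by ring
    simp [F, dX, e, hv.eq_zero_right, hv₁.eq_zero_right]

/-- The terms of `2 ⟨L₁ v, L₂ v⟩` that pair the second difference in the first direction with the
first-order term in the second direction, minus the density into which summation by parts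
transforms them; `c` belongs to the first direction, `s` to the second one. -/
def mixedResidual (h : ℝ) (c s v : ℤ → ℤ → ℝ) : ℤ → ℤ → ℝ := fun i j =>
  -2 * ((c i j * dX h v i j - c (i - 1) j * dX h v (i - 1) j) / h)
      * (s i j * dY h v i j + s i (j - 1) * dY h v i (j - 1))
  + c i j * dX h v i j ^ 2
      * ((s i j - s i (j - 1)) / h + (s (i + 1) j - s (i + 1) (j - 1)) / h)
  + (s i j + s (i + 1) j) * ((c i (j + 1) - c i j) / h) * dX h v i j * dX h v i (j + 1)
  - c i j * dX h v i j * ((s (i + 1) j - s i j) / h * dY h v i j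
      + (s (i + 1) (j - 1) - s i (j - 1)) / h * dY h v i (j - 1))
  - c (i - 1) j * dX h v (i - 1) j * ((s i j - s (i - 1) j) / h * dY h v i j
      + (s i (j - 1) - s (i - 1) (j - 1)) / h * dY h v i (j - 1))

/-- The residual is a discrete divergence in both directions whose fluxes vanish at the outer faces. -/
lemma boxSum_mixedResidual {N : ℕ} (h : ℝ) (c s : ℤ → ℤ → ℝ) {v : ℤ → ℤ → ℝ}
    (hv : InteriorSupported N v) : boxSum N (mixedResidual h c s v) = 0 := by
  let F : ℤ → ℤ → ℝ := fun i j =>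
    -2 / h * c (i - 1) j * dX h v (i - 1) j
        * (s i j * dY h v i j + s i (j - 1) * dY h v i (j - 1))
    + c (i - 1) j * dX h v (i - 1) j * ((s i j - s (i - 1) j) / h * dY h v i j
      + (s i (j - 1) - s (i - 1) (j - 1)) / h * dY h v i (j - 1))
  let G : ℤ → ℤ → ℝ := fun i j =>
    - c i j * dX h v i j * (s i (j - 1) + s (i + 1) (j - 1))
        * ((dX h v i j - dX h v i (j - 1)) / h)
    + 1 / h * (s i (j - 1) + s (i + 1) (j - 1)) * c i j * dX h v i j ^ 2
  have hFG : mixedResidual h c s v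
      = fun i j => (F (i + 1) j - F i j) + (G i (j + 1) - G i j) := by
    funext i j
    simp only [F, G, mixedResidual, dX, dY, add_sub_cancel_right, sub_add_cancel]
    ring
  rw [hFG]
  have e : (N : ℤ) + 2 - 1 = N + 1 := by ring
  refine boxSum_flux N F G (fun j => ?_) (fun j => ?_) (fun i => ?_) (fun i => ?_)
  · simp [F, dX, hv.eq_zero_left]
  · simp [F, dX, e, hv.eq_zero_right]
  · simp [G, dX, hv.eq_zero_bot]
  · simp [G, dX, hv.eq_zero_top]

/-- `⟨Δ₁ v, Δ₂ v⟩ ≥ 0`: it equals the norm of the mixed second difference. -/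
lemma boxSum_second_diff_mul_nonneg {N : ℕ} (h : ℝ) {v : ℤ → ℤ → ℝ}
    (hv : InteriorSupported N v) :
    0 ≤ boxSum N (fun i j =>
      (dX h v i j - dX h v (i - 1) j) * (dY h v i j - dY h v i (j - 1))) := by
  let F : ℤ → ℤ → ℝ := fun i j => dX h v (i - 1) j * (dY h v i j - dY h v i (j - 1))
  let G : ℤ → ℤ → ℝ := fun i j => - dX h v i j * (dX h v i j - dX h v i (j - 1))
  have hFG : (fun i j => (dX h v i j - dX h v (i - 1) j) * (dY h v i j - dY h v i (j - 1)))
      = fun i j => (dX h v i (j + 1) - dX h v i j) ^ 2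
        + ((F (i + 1) j - F i j) + (G i (j + 1) - G i j)) := by
    funext i j
    simp only [F, G, dX, dY, add_sub_cancel_right, sub_add_cancel]
    ring
  have e : (N : ℤ) + 2 - 1 = N + 1 := by ring
  rw [hFG, boxSum_add, boxSum_flux N F G, add_zero]
  · exact boxSum_nonneg N fun i j => sq_nonneg _
  · intro j; simp [F, dX, hv.eq_zero_left]
  · intro j; simp [F, dX, e, hv.eq_zero_right]
  · intro i; simp [G, dX, hv.eq_zero_bot]
  · intro i; simp [G, dX, hv.eq_zero_top]

/-- The coefficients of the conjugated wave operator at a fixed time. The arrays `c₁ s₁` (`c₂ s₂`)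
live on the edges `(i, j)–(i + 1, j)` (resp. `(i, j)–(i, j + 1)`) and are stored at the left (lower)
end; a trailing `t` marks the time derivative. `Y` is the coefficient of the artificial viscosity
in the multiplier `L₂`. -/
structure Coeffs where
  (h Y : ℝ)
  (b bt g gt q qt : ℤ → ℤ → ℝ)
  (c₁ c₁t s₁ s₁t : ℤ → ℤ → ℝ)
  (c₂ c₂t s₂ s₂t : ℤ → ℤ → ℝ)

namespace Coeffs

/-- `div (c ∇v)`, the principal spatial part of the symmetric operator. -/
def flux (K : Coeffs) (v : ℤ → ℤ → ℝ) : ℤ → ℤ → ℝ := fun i j =>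
  (K.c₁ i j * dX K.h v i j - K.c₁ (i - 1) j * dX K.h v (i - 1) j) / K.h
  + (K.c₂ i j * dY K.h v i j - K.c₂ i (j - 1) * dY K.h v i (j - 1)) / K.h

/-- The symmetric part `L₁ v = ∂ₜₜ v - div (c ∇v) + q v`. -/
def symPart (K : Coeffs) (v v₂ : ℤ → ℤ → ℝ) : ℤ → ℤ → ℝ := fun i j =>
  v₂ i j - K.flux v i j + K.q i j * v i j

/-- The sum of the undivided second differences in both directions, divided by `h`. -/
def jump (K : Coeffs) (v : ℤ → ℤ → ℝ) : ℤ → ℤ → ℝ := fun i j =>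
  (dX K.h v i j - dX K.h v (i - 1) j) + (dY K.h v i j - dY K.h v i (j - 1))

/-- The first-order spatial part of the multiplier. -/
def advect (K : Coeffs) (v : ℤ → ℤ → ℝ) : ℤ → ℤ → ℝ := fun i j =>
  (K.s₁ i j * dX K.h v i j + K.s₁ (i - 1) j * dX K.h v (i - 1) j)
  + (K.s₂ i j * dY K.h v i j + K.s₂ i (j - 1) * dY K.h v i (j - 1))

/-- The time derivative of `advect` falling on the coefficients. -/
def advectT (K : Coeffs) (v : ℤ → ℤ → ℝ) : ℤ → ℤ → ℝ := fun i j =>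
  (K.s₁t i j * dX K.h v i j + K.s₁t (i - 1) j * dX K.h v (i - 1) j)
  + (K.s₂t i j * dY K.h v i j + K.s₂t i (j - 1) * dY K.h v i (j - 1))

/-- The multiplier `L₂ v`: the antisymmetric part, up to terms of order zero, plus viscosity. -/
def multiplier (K : Coeffs) (v v₁ : ℤ → ℤ → ℝ) : ℤ → ℤ → ℝ := fun i j =>
  -2 * K.b i j * v₁ i j + K.advect v i j + K.g i j * v i j - K.Y * K.jump v i j

/-- The density of the energy whose time derivative occurs in `2 ⟨L₁ v, L₂ v⟩`. -/
def energy (K : Coeffs) (v v₁ : ℤ → ℤ → ℝ) : ℤ → ℤ → ℝ := fun i j =>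
  -2 * K.b i j * v₁ i j ^ 2 + 2 * v₁ i j * K.advect v i j + 2 * K.g i j * v i j * v₁ i j
  - 2 * K.Y * v₁ i j * K.jump v i j
  - K.c₁ i j * (K.b i j + K.b (i + 1) j) * dX K.h v i j ^ 2
  - K.c₂ i j * (K.b i j + K.b i (j + 1)) * dY K.h v i j ^ 2
  - 2 * K.q i j * K.b i j * v i j ^ 2

/-- The formal time derivative of `energy`. -/
def energyDeriv (K : Coeffs) (v v₁ v₂ : ℤ → ℤ → ℝ) : ℤ → ℤ → ℝ := fun i j =>
  -2 * K.bt i j * v₁ i j ^ 2 - 4 * K.b i j * v₁ i j * v₂ i j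
  + 2 * v₂ i j * K.advect v i j + 2 * v₁ i j * (K.advectT v i j + K.advect v₁ i j)
  + 2 * K.gt i j * v i j * v₁ i j + 2 * K.g i j * v₁ i j ^ 2 + 2 * K.g i j * v i j * v₂ i j
  - 2 * K.Y * (v₂ i j * K.jump v i j + v₁ i j * K.jump v₁ i j)
  - (K.c₁t i j * (K.b i j + K.b (i + 1) j) + K.c₁ i j * (K.bt i j + K.bt (i + 1) j))
      * dX K.h v i j ^ 2
  - 2 * K.c₁ i j * (K.b i j + K.b (i + 1) j) * dX K.h v i j * dX K.h v₁ i j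
  - (K.c₂t i j * (K.b i j + K.b i (j + 1)) + K.c₂ i j * (K.bt i j + K.bt i (j + 1)))
      * dY K.h v i j ^ 2
  - 2 * K.c₂ i j * (K.b i j + K.b i (j + 1)) * dY K.h v i j * dY K.h v₁ i j
  - 2 * (K.qt i j * K.b i j + K.q i j * K.bt i j) * v i j ^ 2
  - 4 * K.q i j * K.b i j * v i j * v₁ i j

/-- The part of the commutator density that involves the edges of the first direction, apart from
the terms that are symmetric in the two directions. -/
def lineDensity (h : ℝ) (b bt g q c ct s st s' v v₁ : ℤ → ℤ → ℝ) : ℤ → ℤ → ℝ := fun i j =>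
  2 * ((s i j - s (i - 1) j) / h) * v₁ i j ^ 2
  - 2 * v₁ i j * (st i j * dX h v i j + st (i - 1) j * dX h v (i - 1) j)
  + (ct i j * (b i j + b (i + 1) j) + c i j * (bt i j + bt (i + 1) j)) * dX h v i j ^ 2
  - 2 * v₁ i j * (c i j * ((b (i + 1) j - b i j) / h) * dX h v i j
        + c (i - 1) j * ((b i j - b (i - 1) j) / h) * dX h v (i - 1) j)
  + 2 * ((s i j * c (i - 1) j - c i j * s (i - 1) j) / h) * dX h v i j * dX h v (i - 1) j
  + 2 * c i j * g (i + 1) j * dX h v i j ^ 2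
  + 2 * c i j * ((g (i + 1) j - g i j) / h) * dX h v i j * v i j
  - 2 * q i j * ((s i j - s (i - 1) j) / h) * v i j ^ 2
  - 2 * s i j * ((q (i + 1) j - q i j) / h) * v i j * v (i + 1) j
  - c i j * ((s' i j - s' i (j - 1)) / h + (s' (i + 1) j - s' (i + 1) (j - 1)) / h)
      * dX h v i j ^ 2
  - (s' i j + s' (i + 1) j) * ((c i (j + 1) - c i j) / h) * dX h v i j * dX h v i (j + 1)
  + c i j * dX h v i j * ((s' (i + 1) j - s' i j) / h * dY h v i j
      + (s' (i + 1) (j - 1) - s' i (j - 1)) / h * dY h v i (j - 1))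
  + c (i - 1) j * dX h v (i - 1) j * ((s' i j - s' (i - 1) j) / h * dY h v i j
      + (s' i (j - 1) - s' (i - 1) (j - 1)) / h * dY h v i (j - 1))

/-- The density of the quadratic form that `2 ⟨L₁ v, L₂ v⟩` produces. -/
def density (K : Coeffs) (v v₁ : ℤ → ℤ → ℝ) : ℤ → ℤ → ℝ := fun i j =>
  (2 * K.bt i j - 2 * K.g i j) * v₁ i j ^ 2 - 2 * K.gt i j * v i j * v₁ i j
  + lineDensity K.h K.b K.bt K.g K.q K.c₁ K.c₁t K.s₁ K.s₁t K.s₂ v v₁ i j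
  + lineDensity K.h (swap K.b) (swap K.bt) (swap K.g) (swap K.q) (swap K.c₂) (swap K.c₂t)
      (swap K.s₂) (swap K.s₂t) (swap K.s₁) (swap v) (swap v₁) j i
  + 2 * (K.qt i j * K.b i j + K.q i j * K.bt i j) * v i j ^ 2
  + 2 * K.q i j * K.g i j * v i j ^ 2
  - 2 * K.Y * K.q i j * v i j * K.jump v i j
  + 2 * K.Y * (K.flux v i j * K.jump v i j
      - 2 / K.h * ((dX K.h v i j - dX K.h v (i - 1) j) * (dY K.h v i j - dY K.h v i (j - 1))))

/-- **The discrete multiplier identity**, with the nonnegative term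
`⟨Δ₁ v, Δ₂ v⟩` dropped: `2 ⟨L₁ v, L₂ v⟩` is at least the time derivative of the energy plus the
commutator density, up to the high-frequency term in `∇ ∂ₜ v`. -/
lemma boxSum_symPart_mul_multiplier (K : Coeffs) {N : ℕ} {v v₁ v₂ : ℤ → ℤ → ℝ} (hh : 0 < K.h)
    (hY : 0 ≤ K.Y) (hv : InteriorSupported N v) (hv₁ : InteriorSupported N v₁) :
    boxSum N (K.energyDeriv v v₁ v₂) + boxSum N (K.density v v₁)
      - 2 * K.Y * boxSum N (fun i j => (v₁ (i + 1) j - v₁ i j) * dX K.h v₁ i j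
          + (v₁ i (j + 1) - v₁ i j) * dY K.h v₁ i j)
      ≤ boxSum N (fun i j => 2 * K.symPart v v₂ i j * K.multiplier v v₁ i j) := by
  let D : ℤ → ℤ → ℝ := fun i j =>
    (dX K.h v i j - dX K.h v (i - 1) j) * (dY K.h v i j - dY K.h v i (j - 1))
  let P : ℤ → ℤ → ℝ := fun i j => (v₁ (i + 1) j - v₁ i j) * dX K.h v₁ i j
          + (v₁ i (j + 1) - v₁ i j) * dY K.h v₁ i j
  let R₁ := lineResidual K.h K.Y K.b K.g K.q K.c₁ K.s₁ v v₁
  let R₂ := lineResidual K.h K.Y (swap K.b) (swap K.g) (swap K.q) (swap K.c₂) (swap K.s₂)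
    (swap v) (swap v₁)
  let X₁ := mixedResidual K.h K.c₁ K.s₂ v
  let X₂ := mixedResidual K.h (swap K.c₂) (swap K.s₁) (swap v)
  have key : (fun i j => 2 * K.symPart v v₂ i j * K.multiplier v v₁ i j)
      = fun i j => (((((((K.energyDeriv v v₁ v₂ i j + K.density v v₁ i j)
        - 2 * K.Y * P i j) + 4 * K.Y / K.h * D i j) + R₁ i j) + swap R₂ i j) + X₁ i j)
        + swap X₂ i j) := by
    funext i j
    simp only [P, D, R₁, R₂, X₁, X₂, lineResidual, mixedResidual, density, lineDensity,
      energyDeriv, symPart, multiplier, flux, jump, advect, advectT, swap, dX, dY]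
    ring
  have hD : 0 ≤ boxSum N D := boxSum_second_diff_mul_nonneg K.h hv
  have h1 : boxSum N R₁ = 0 := boxSum_lineResidual _ _ _ _ _ _ _ hv hv₁
  have h2 : boxSum N R₂ = 0 := boxSum_lineResidual _ _ _ _ _ _ _ hv.swap hv₁.swap
  have h3 : boxSum N X₁ = 0 := boxSum_mixedResidual _ _ _ hv
  have h4 : boxSum N X₂ = 0 := boxSum_mixedResidual _ _ _ hv.swap
  have h5 : 0 ≤ 4 * K.Y / K.h * boxSum N D := by positivity
  rw [key]
  change _ + _ - 2 * K.Y * boxSum N P ≤ _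
  simp only [boxSum_add, boxSum_sub, boxSum_mul]
  rw [boxSum_swap, boxSum_swap]
  rw [h1, h2, h3, h4]
  linarith

/-- The density of the natural energy `|∂ₜ v|² + c |∇v|² + q |v|²` of the symmetric operator. -/
def natEnergy (K : Coeffs) (v v₁ : ℤ → ℤ → ℝ) : ℤ → ℤ → ℝ := fun i j =>
  v₁ i j ^ 2 + K.c₁ i j * dX K.h v i j ^ 2 + K.c₂ i j * dY K.h v i j ^ 2 + K.q i j * v i j ^ 2

/-- The formal time derivative of `natEnergy`. -/
def natEnergyDeriv (K : Coeffs) (v v₁ v₂ : ℤ → ℤ → ℝ) : ℤ → ℤ → ℝ := fun i j =>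
  2 * v₁ i j * v₂ i j
  + (K.c₁t i j * dX K.h v i j ^ 2 + 2 * K.c₁ i j * dX K.h v i j * dX K.h v₁ i j)
  + (K.c₂t i j * dY K.h v i j ^ 2 + 2 * K.c₂ i j * dY K.h v i j * dY K.h v₁ i j)
  + (K.qt i j * v i j ^ 2 + 2 * K.q i j * v i j * v₁ i j)

/-- The energy identity for the symmetric operator, tested with `∂ₜ v`. -/
lemma boxSum_natEnergyDeriv (K : Coeffs) {N : ℕ} {v v₁ v₂ : ℤ → ℤ → ℝ}
    (hv₁ : InteriorSupported N v₁) :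
    boxSum N (K.natEnergyDeriv v v₁ v₂)
      = boxSum N (fun i j => 2 * K.symPart v v₂ i j * v₁ i j
          + (K.c₁t i j * dX K.h v i j ^ 2 + K.c₂t i j * dY K.h v i j ^ 2
            + K.qt i j * v i j ^ 2)) := by
  let F : ℤ → ℤ → ℝ := fun i j => 2 / K.h * K.c₁ (i - 1) j * dX K.h v (i - 1) j * v₁ i j
  let G : ℤ → ℤ → ℝ := fun i j => 2 / K.h * K.c₂ i (j - 1) * dY K.h v i (j - 1) * v₁ i j
  have key : K.natEnergyDeriv v v₁ v₂ = fun i j => (2 * K.symPart v v₂ i j * v₁ i j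
          + (K.c₁t i j * dX K.h v i j ^ 2 + K.c₂t i j * dY K.h v i j ^ 2
            + K.qt i j * v i j ^ 2)) + ((F (i + 1) j - F i j) + (G i (j + 1) - G i j)) := by
    funext i j
    simp only [F, G, natEnergyDeriv, symPart, flux, dX, dY, add_sub_cancel_right, sub_add_cancel]
    ring
  rw [key, boxSum_add, boxSum_flux N F G, add_zero]
  · intro j; simp [F, hv₁.eq_zero_left]
  · intro j; simp [F, hv₁.eq_zero_right]
  · intro i; simp [G, hv₁.eq_zero_bot]
  · intro i; simp [G, hv₁.eq_zero_top]

/-- Shifting a squared edge difference transversally does not change its sum. -/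
lemma _root_.SemiDiscreteWave.boxSum_dX_shift_sq {N : ℕ} (h : ℝ) {v : ℤ → ℤ → ℝ}
    (hv : InteriorSupported N v) :
    boxSum N (fun i j => dX h v i (j + 1) ^ 2) = boxSum N (fun i j => dX h v i j ^ 2) := by
  have := boxSum_flux N (fun _ _ => 0) (fun i j => dX h v i j ^ 2) (fun _ => rfl) (fun _ => rfl)
    (fun i => by simp [dX, hv.eq_zero_bot]) (fun i => by simp [dX, hv.eq_zero_top])
  simp only [sub_zero, zero_add, boxSum_sub] at this
  linarith

lemma _root_.SemiDiscreteWave.boxSum_dY_shift_sq {N : ℕ} (h : ℝ) {v : ℤ → ℤ → ℝ}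
    (hv : InteriorSupported N v) :
    boxSum N (fun i j => dY h v (i + 1) j ^ 2) = boxSum N (fun i j => dY h v i j ^ 2) := by
  have := boxSum_dX_shift_sq h hv.swap
  rw [← boxSum_swap, ← boxSum_swap N (fun i j => dY h v i j ^ 2)]
  exact this

end Coeffs

/-! ### Difference quotients of the weight, continuous up to mesh size zero -/

/-- `sinh z / z`, extended continuously by `1` at `z = 0`. -/
def shc (z : ℝ) : ℝ := dslope Real.sinh 0 z

lemma mul_shc (z : ℝ) : z * shc z = Real.sinh z := by
  have := sub_smul_dslope Real.sinh 0 z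
  simpa [shc] using this

@[simp] lemma shc_zero : shc 0 = 1 := by
  simp [shc, dslope_same]

lemma continuous_shc : Continuous shc := by
  rw [← continuousOn_univ]
  exact (continuousOn_dslope Filter.univ_mem).2
    ⟨Real.continuous_sinh.continuousOn, Real.differentiable_sinh 0⟩

@[fun_prop]
lemma Continuous.shc {X : Type*} [TopologicalSpace X] {z : X → ℝ} (hz : Continuous z) :
    Continuous fun q => shc (z q) := continuous_shc.comp hz

/-- `sinh (ρ u) / ρ`, extended continuously to `ρ = 0`. -/
def sinhQuot (ρ u : ℝ) : ℝ := u * shc (ρ * u)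

/-- `(cosh (ρ u) - 1) / ρ²`, extended continuously to `ρ = 0`. -/
def coshQuot (ρ u : ℝ) : ℝ := u ^ 2 / 2 * shc (ρ * u / 2) ^ 2

/-- The difference quotient `(sinhQuot ρ u - sinhQuot ρ w) / h` for `u - w = h d`. -/
def sinhQuotDiff (ρ h u w d : ℝ) : ℝ := Real.cosh (ρ * (u + w) / 2) * d * shc (ρ * h * d / 2)

/-- The difference quotient `(coshQuot ρ u - coshQuot ρ w) / h` for `u - w = h d`. -/
def coshQuotDiff (ρ h u w d : ℝ) : ℝ :=
  (u + w) / 2 * shc (ρ * (u + w) / 2) * d * shc (ρ * h * d / 2)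

lemma mul_sinhQuot (ρ u : ℝ) : ρ * sinhQuot ρ u = Real.sinh (ρ * u) := by
  rw [← mul_shc, sinhQuot]; ring

lemma sq_mul_coshQuot (ρ u : ℝ) : ρ ^ 2 * coshQuot ρ u = Real.cosh (ρ * u) - 1 := by
  have h := mul_shc (ρ * u / 2)
  have h2 : Real.cosh (ρ * u) = 1 + 2 * Real.sinh (ρ * u / 2) ^ 2 := by
    have := Real.cosh_two_mul (ρ * u / 2)
    have h3 := Real.cosh_sq (ρ * u / 2)
    rw [show 2 * (ρ * u / 2) = ρ * u by ring] at this
    linarith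
  rw [h2, ← h, coshQuot]; ring

lemma sinhQuot_sub {ρ : ℝ} (hρ : ρ ≠ 0) {h u w d : ℝ} (hd : u - w = h * d) :
    sinhQuot ρ u - sinhQuot ρ w = h * sinhQuotDiff ρ h u w d := by
  apply mul_left_cancel₀ hρ
  have e1 : ρ * u = ρ * (u + w) / 2 + ρ * h * d / 2 := by
    linear_combination (ρ / 2) * hd
  have e2 : ρ * w = ρ * (u + w) / 2 - ρ * h * d / 2 := by
    linear_combination -(ρ / 2) * hd
  have e3 := mul_shc (ρ * h * d / 2)
  rw [mul_sub, mul_sinhQuot, mul_sinhQuot, sinhQuotDiff]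
  conv_lhs => rw [e1, e2, Real.sinh_add, Real.sinh_sub, ← e3]
  ring

lemma coshQuot_sub {ρ : ℝ} (hρ : ρ ≠ 0) {h u w d : ℝ} (hd : u - w = h * d) :
    coshQuot ρ u - coshQuot ρ w = h * coshQuotDiff ρ h u w d := by
  apply mul_left_cancel₀ (pow_ne_zero 2 hρ)
  have e1 : ρ * u = ρ * (u + w) / 2 + ρ * h * d / 2 := by
    linear_combination (ρ / 2) * hd
  have e2 : ρ * w = ρ * (u + w) / 2 - ρ * h * d / 2 := by
    linear_combination -(ρ / 2) * hd
  have e3 := mul_shc (ρ * h * d / 2)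
  have e4 := mul_shc (ρ * (u + w) / 2)
  rw [mul_sub, sq_mul_coshQuot, sq_mul_coshQuot, coshQuotDiff]
  conv_lhs => rw [e1, e2, Real.cosh_add, Real.cosh_sub, ← e3, ← e4]
  ring

@[fun_prop]
lemma Continuous.sinhQuot {X : Type*} [TopologicalSpace X] {ρ u : X → ℝ} (hρ : Continuous ρ)
    (hu : Continuous u) : Continuous fun q => sinhQuot (ρ q) (u q) := by
  unfold SemiDiscreteWave.sinhQuot; fun_prop

@[fun_prop]
lemma Continuous.coshQuot {X : Type*} [TopologicalSpace X] {ρ u : X → ℝ} (hρ : Continuous ρ)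
    (hu : Continuous u) : Continuous fun q => coshQuot (ρ q) (u q) := by
  unfold SemiDiscreteWave.coshQuot; fun_prop

@[fun_prop]
lemma Continuous.sinhQuotDiff {X : Type*} [TopologicalSpace X] {ρ h u w d : X → ℝ}
    (hρ : Continuous ρ) (hh : Continuous h) (hu : Continuous u) (hw : Continuous w)
    (hd : Continuous d) : Continuous fun q => sinhQuotDiff (ρ q) (h q) (u q) (w q) (d q) := by
  unfold SemiDiscreteWave.sinhQuotDiff; fun_prop

@[fun_prop]
lemma Continuous.coshQuotDiff {X : Type*} [TopologicalSpace X] {ρ h u w d : X → ℝ}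
    (hρ : Continuous ρ) (hh : Continuous h) (hu : Continuous u) (hw : Continuous w)
    (hd : Continuous d) : Continuous fun q => coshQuotDiff (ρ q) (h q) (u q) (w q) (d q) := by
  unfold SemiDiscreteWave.coshQuotDiff; fun_prop

/-- The parameters of the weight `φ`, together with the viscosity `Z` of the multiplier. -/
structure Params where
  (a β c₀ μ Z : ℝ)

namespace Params

/-- The spatial factor `exp (μ (x + a)²)` of the weight `φ(t, x, y) = A(t) e(x) e(y)`. -/
def e (P : Params) (x : ℝ) : ℝ := Real.exp (P.μ * (x + P.a) ^ 2)

/-- `(e (x + h) - e x) / h`, extended continuously to `h = 0`. -/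
def e₁ (P : Params) (h x : ℝ) : ℝ :=
  P.e x * (Real.exp (P.μ * h * (2 * (x + P.a) + h) / 2)
    * shc (P.μ * h * (2 * (x + P.a) + h) / 2)) * (P.μ * (2 * (x + P.a) + h))

/-- `(e (x + h) - 2 e x + e (x - h)) / h²`, extended continuously to `h = 0`. -/
def e₂ (P : Params) (h x : ℝ) : ℝ :=
  P.e x * (2 * P.μ * (Real.exp (P.μ * h ^ 2 / 2) * shc (P.μ * h ^ 2 / 2))
      * Real.cosh (2 * P.μ * (x + P.a) * h)
    + (2 * P.μ * (x + P.a)) ^ 2 * shc (P.μ * (x + P.a) * h) ^ 2)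

lemma mul_exp_shc (z : ℝ) : z * (Real.exp (z / 2) * shc (z / 2)) = Real.exp z - 1 := by
  have h := mul_shc (z / 2)
  have h1 : Real.exp z = Real.exp (z / 2) * Real.exp (z / 2) := by
    rw [← Real.exp_add]; congr 1; ring
  have h2 : Real.exp (z / 2) * Real.exp (-(z / 2)) = 1 := by
    rw [← Real.exp_add]; simp
  rw [show z * (Real.exp (z / 2) * shc (z / 2)) = 2 * Real.exp (z / 2) * (z / 2 * shc (z / 2))
    by ring, h, Real.sinh_eq, h1]
  linear_combination -h2

lemma mul_e₁ (P : Params) (h x : ℝ) : h * P.e₁ h x = P.e (x + h) - P.e x := by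
  have h1 := mul_exp_shc (P.μ * h * (2 * (x + P.a) + h))
  have h2 : P.e (x + h) = P.e x * Real.exp (P.μ * h * (2 * (x + P.a) + h)) := by
    rw [e, e, ← Real.exp_add]; congr 1; ring
  rw [h2, e₁]
  linear_combination (P.e x) * h1

lemma sq_mul_e₂ (P : Params) (h x : ℝ) :
    h ^ 2 * P.e₂ h x = P.e (x + h) - 2 * P.e x + P.e (x - h) := by
  have h1 := mul_exp_shc (P.μ * h ^ 2)
  have h2 : P.e (x + h) = P.e x * (Real.exp (P.μ * h ^ 2) * Real.exp (2 * P.μ * (x + P.a) * h)) := by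
    rw [e, e, ← Real.exp_add, ← Real.exp_add]; congr 1; ring
  have h3 : P.e (x - h)
      = P.e x * (Real.exp (P.μ * h ^ 2) * Real.exp (-(2 * P.μ * (x + P.a) * h))) := by
    rw [e, e, ← Real.exp_add, ← Real.exp_add]; congr 1; ring
  have h4 := mul_shc (P.μ * (x + P.a) * h)
  have h5 : Real.cosh (2 * P.μ * (x + P.a) * h) = 1 + 2 * Real.sinh (P.μ * (x + P.a) * h) ^ 2 := by
    have h6 := Real.cosh_two_mul (P.μ * (x + P.a) * h)
    have h7 := Real.cosh_sq (P.μ * (x + P.a) * h)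
    rw [show 2 * (P.μ * (x + P.a) * h) = 2 * P.μ * (x + P.a) * h by ring] at h6
    linarith
  have h8 : Real.exp (2 * P.μ * (x + P.a) * h) + Real.exp (-(2 * P.μ * (x + P.a) * h))
      = 2 * Real.cosh (2 * P.μ * (x + P.a) * h) := by
    rw [Real.cosh_eq]; ring
  have h9 : P.e (x + h) - 2 * P.e x + P.e (x - h)
      = P.e x * (Real.exp (P.μ * h ^ 2) * (2 * Real.cosh (2 * P.μ * (x + P.a) * h)) - 2) := by
    rw [h2, h3, ← h8]; ring
  rw [h9, e₂]
  linear_combination (2 * P.e x * Real.cosh (2 * P.μ * (x + P.a) * h)) * h1 - 2 * P.e x * h5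
    + 4 * P.e x * (P.μ * (x + P.a) * h * shc (P.μ * (x + P.a) * h)
      + Real.sinh (P.μ * (x + P.a) * h)) * h4

@[fun_prop]
lemma continuous_e (P : Params) : Continuous P.e := by
  unfold e; fun_prop

@[fun_prop]
lemma continuous_e₁ (P : Params) {X : Type*} [TopologicalSpace X] {h x : X → ℝ}
    (hh : Continuous h) (hx : Continuous x) : Continuous fun q => P.e₁ (h q) (x q) := by
  unfold e₁; fun_prop

@[fun_prop]
lemma continuous_e₂ (P : Params) {X : Type*} [TopologicalSpace X] {h x : X → ℝ}
    (hh : Continuous h) (hx : Continuous x) : Continuous fun q => P.e₂ (h q) (x q) := by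
  unfold e₂; fun_prop

lemma e_pos (P : Params) (x : ℝ) : 0 < P.e x := Real.exp_pos _

/-! ### Coefficients of the conjugated operator in normalized variables

Below `ρ = τ h`. Directional quantities are written for the direction of the first spatial
argument; for the other direction the two spatial arguments are exchanged, since `φ` is symmetric
in them. -/

/-- The temporal factor `exp (μ (c₀ - β t²))` of `φ`. -/
def amp (P : Params) (t : ℝ) : ℝ := Real.exp (P.μ * (P.c₀ - P.β * t ^ 2))

/-- The logarithmic time derivative `-2 μ β t` of `φ`. -/
def rate (P : Params) (t : ℝ) : ℝ := -2 * P.μ * P.β * t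

/-- The weight `φ`. -/
def ph (P : Params) (t x y : ℝ) : ℝ := P.amp t * P.e x * P.e y

/-- `∂ₜ φ`. -/
def phT (P : Params) (t x y : ℝ) : ℝ := P.rate t * P.ph t x y

/-- `∂ₜₜ φ`. -/
def phTT (P : Params) (t x y : ℝ) : ℝ := (P.rate t ^ 2 - 2 * P.μ * P.β) * P.ph t x y

/-- The difference quotient of `φ`. -/
def ph₁ (P : Params) (h t x y : ℝ) : ℝ := P.amp t * P.e₁ h x * P.e y

/-- The second difference quotient of `φ`. -/
def ph₁₁ (P : Params) (h t x y : ℝ) : ℝ := P.amp t * P.e₂ h x * P.e y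

/-- The mixed second difference quotient of `φ`. -/
def ph₁₂ (P : Params) (h t x y : ℝ) : ℝ := P.amp t * P.e₁ h x * P.e₁ h y

/-- `cosh (τ (φ(x + h) - φ(x)))`. -/
def cosC (P : Params) (ρ h t x y : ℝ) : ℝ := Real.cosh (ρ * P.ph₁ h t x y)

/-- The time derivative of `cosC`. -/
def cosT (P : Params) (ρ h t x y : ℝ) : ℝ :=
  Real.sinh (ρ * P.ph₁ h t x y) * (ρ * (P.rate t * P.ph₁ h t x y))

/-- `sinh (τ (φ(x + h) - φ(x))) / (τ h)`. -/
def sinC (P : Params) (ρ h t x y : ℝ) : ℝ := sinhQuot ρ (P.ph₁ h t x y)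

/-- The time derivative of `sinC`. -/
def sinT (P : Params) (ρ h t x y : ℝ) : ℝ :=
  Real.cosh (ρ * P.ph₁ h t x y) * (P.rate t * P.ph₁ h t x y)

/-- `(cosh (τ (φ(x + h) - φ(x))) - 1) / (τ h)²`. -/
def pot (P : Params) (ρ h t x y : ℝ) : ℝ := coshQuot ρ (P.ph₁ h t x y)

/-- Backward difference quotient of `sinC` in its own direction. -/
def sinL (P : Params) (ρ h t x y : ℝ) : ℝ :=
  sinhQuotDiff ρ h (P.ph₁ h t x y) (P.ph₁ h t (x - h) y) (P.ph₁₁ h t x y)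

/-- Forward difference quotient of `sinC` in the transverse direction. -/
def sinX (P : Params) (ρ h t x y : ℝ) : ℝ :=
  sinhQuotDiff ρ h (P.ph₁ h t x (y + h)) (P.ph₁ h t x y) (P.ph₁₂ h t x y)

/-- Backward difference quotient of `pot` in its own direction. -/
def potL (P : Params) (ρ h t x y : ℝ) : ℝ :=
  coshQuotDiff ρ h (P.ph₁ h t x y) (P.ph₁ h t (x - h) y) (P.ph₁₁ h t x y)

/-- Forward difference quotient of `pot` in the transverse direction. -/
def potX (P : Params) (ρ h t x y : ℝ) : ℝ :=
  coshQuotDiff ρ h (P.ph₁ h t x (y + h)) (P.ph₁ h t x y) (P.ph₁₂ h t x y)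

/-- `sinh` of the second difference of `τ φ`, divided by `τ h²`. -/
def kap (P : Params) (ρ h t x y : ℝ) : ℝ := sinhQuot (ρ * h) (P.ph₁₁ h t x y)

/-- `|∇ψ|² - |∂ₜψ|²`. -/
def qf (P : Params) (t x y : ℝ) : ℝ :=
  4 * (x + P.a) ^ 2 + 4 * (y + P.a) ^ 2 - 4 * P.β ^ 2 * t ^ 2

/-- The zero-order coefficient of the multiplier, `μ φ (2 + μ (|∇ψ|² - |∂ₜψ|²))`, which moves
positivity from the gradient to the time derivative. -/
def gee (P : Params) (t x y : ℝ) : ℝ := P.μ * P.ph t x y * (2 + P.μ * P.qf t x y)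

/-- `∂ₜ gee`. -/
def geeT (P : Params) (t x y : ℝ) : ℝ :=
  P.μ * P.phT t x y * (2 + P.μ * P.qf t x y)
    + P.μ * P.ph t x y * (P.μ * (-8 * P.β ^ 2 * t))

/-- Forward difference quotient of `gee`. -/
def gee₁ (P : Params) (h t x y : ℝ) : ℝ :=
  P.μ * (P.ph₁ h t x y * (2 + P.μ * P.qf t (x + h) y)
    + P.ph t x y * (P.μ * (4 * (2 * (x + P.a) + h))))

/-- The potential of the symmetric operator divided by `τ²`; it tends to
`|∂ₜφ|² - |∇φ|²`. -/
def qu (P : Params) (ρ h t x y : ℝ) : ℝ :=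
  P.phT t x y ^ 2 - (P.pot ρ h t x y + P.pot ρ h t (x - h) y)
    - (P.pot ρ h t y x + P.pot ρ h t (y - h) x)

/-- The time derivative of `pot`. -/
def potT (P : Params) (ρ h t x y : ℝ) : ℝ := P.sinC ρ h t x y * (P.rate t * P.ph₁ h t x y)

/-- The time derivative of `qu`. -/
def quT (P : Params) (ρ h t x y : ℝ) : ℝ :=
  2 * P.phT t x y * P.phTT t x y - (P.potT ρ h t x y + P.potT ρ h t (x - h) y)
    - (P.potT ρ h t y x + P.potT ρ h t (y - h) x)

/-- Forward difference quotient of `qu`. -/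
def qu₁ (P : Params) (ρ h t x y : ℝ) : ℝ :=
  P.rate t ^ 2 * (P.ph t (x + h) y + P.ph t x y) * P.ph₁ h t x y
    - (P.potL ρ h t (x + h) y + P.potL ρ h t x y) - (P.potX ρ h t y x + P.potX ρ h t (y - h) x)

section Specs

variable (P : Params) {ρ h : ℝ} (t x y : ℝ)

lemma ph_comm : P.ph t x y = P.ph t y x := by unfold ph; ring
lemma phT_comm : P.phT t x y = P.phT t y x := by unfold phT; rw [ph_comm]
lemma phTT_comm : P.phTT t x y = P.phTT t y x := by unfold phTT; rw [ph_comm]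
lemma gee_comm : P.gee t x y = P.gee t y x := by unfold gee qf; rw [ph_comm]; ring
lemma qu_comm : P.qu ρ h t x y = P.qu ρ h t y x := by unfold qu; rw [phT_comm]; ring

lemma ph_sub : P.ph t (x + h) y - P.ph t x y = h * P.ph₁ h t x y := by
  unfold ph ph₁; linear_combination (-(P.amp t * P.e y)) * P.mul_e₁ h x

lemma phT_sub : P.phT t (x + h) y - P.phT t x y = h * (P.rate t * P.ph₁ h t x y) := by
  unfold phT; linear_combination (P.rate t) * P.ph_sub (h := h) t x y

lemma ph₁_sub (hh : h ≠ 0) : P.ph₁ h t x y - P.ph₁ h t (x - h) y = h * P.ph₁₁ h t x y := by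
  apply mul_left_cancel₀ hh
  have h1 := P.mul_e₁ h x
  have h2 := P.mul_e₁ h (x - h)
  have h3 := P.sq_mul_e₂ h x
  rw [sub_add_cancel] at h2
  unfold ph₁ ph₁₁
  linear_combination (P.amp t * P.e y) * (h1 - h2 - h3)

lemma ph₁_sub_transverse : P.ph₁ h t x (y + h) - P.ph₁ h t x y = h * P.ph₁₂ h t x y := by
  have h1 := P.mul_e₁ h y
  unfold ph₁ ph₁₂
  linear_combination (-(P.amp t * P.e₁ h x)) * h1

lemma sinC_sub (hρ : ρ ≠ 0) (hh : h ≠ 0) :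
    P.sinC ρ h t x y - P.sinC ρ h t (x - h) y = h * P.sinL ρ h t x y :=
  sinhQuot_sub hρ (P.ph₁_sub t x y hh)

lemma sinC_sub_transverse (hρ : ρ ≠ 0) :
    P.sinC ρ h t x (y + h) - P.sinC ρ h t x y = h * P.sinX ρ h t x y :=
  sinhQuot_sub hρ (P.ph₁_sub_transverse t x y)

lemma pot_sub (hρ : ρ ≠ 0) (hh : h ≠ 0) :
    P.pot ρ h t x y - P.pot ρ h t (x - h) y = h * P.potL ρ h t x y :=
  coshQuot_sub hρ (P.ph₁_sub t x y hh)

lemma pot_sub_transverse (hρ : ρ ≠ 0) :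
    P.pot ρ h t x (y + h) - P.pot ρ h t x y = h * P.potX ρ h t x y :=
  coshQuot_sub hρ (P.ph₁_sub_transverse t x y)

lemma cosC_eq : P.cosC ρ h t x y = 1 + ρ ^ 2 * P.pot ρ h t x y := by
  rw [cosC, pot, sq_mul_coshQuot]; ring

lemma cosC_sub_transverse (hρ : ρ ≠ 0) :
    P.cosC ρ h t x (y + h) - P.cosC ρ h t x y = h * (ρ ^ 2 * P.potX ρ h t x y) := by
  rw [cosC_eq, cosC_eq]
  linear_combination ρ ^ 2 * P.pot_sub_transverse (h := h) t x y hρ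

lemma sinC_mul_cosC_sub (hρ : ρ ≠ 0) (hh : h ≠ 0) :
    P.sinC ρ h t x y * P.cosC ρ h t (x - h) y - P.cosC ρ h t x y * P.sinC ρ h t (x - h) y
      = h * P.kap ρ h t x y := by
  apply mul_left_cancel₀ hρ
  have h1 := mul_sinhQuot ρ (P.ph₁ h t x y)
  have h2 := mul_sinhQuot ρ (P.ph₁ h t (x - h) y)
  have h3 := mul_sinhQuot (ρ * h) (P.ph₁₁ h t x y)
  have h4 : ρ * h * P.ph₁₁ h t x y = ρ * P.ph₁ h t x y - ρ * P.ph₁ h t (x - h) y := by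
    linear_combination -ρ * P.ph₁_sub t x y hh
  rw [h4, Real.sinh_sub] at h3
  unfold kap sinC cosC
  linear_combination Real.cosh (ρ * P.ph₁ h t (x - h) y) * h1
    - Real.cosh (ρ * P.ph₁ h t x y) * h2 - h3

lemma gee_sub : P.gee t (x + h) y - P.gee t x y = h * P.gee₁ h t x y := by
  unfold gee gee₁ qf
  linear_combination (P.μ * (2 + P.μ * (4 * (x + h + P.a) ^ 2 + 4 * (y + P.a) ^ 2
    - 4 * P.β ^ 2 * t ^ 2))) * P.ph_sub (h := h) t x y

lemma qu_sub (hρ : ρ ≠ 0) (hh : h ≠ 0) :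
    P.qu ρ h t (x + h) y - P.qu ρ h t x y = h * P.qu₁ ρ h t x y := by
  have h1 := P.pot_sub t (x + h) y hρ hh
  have h2 := P.pot_sub t x y hρ hh
  have h3 := P.pot_sub_transverse (h := h) t y x hρ
  have h4 := P.pot_sub_transverse (h := h) t (y - h) x hρ
  have h5 := P.ph_sub (h := h) t x y
  rw [add_sub_cancel_right] at h1
  unfold qu qu₁ phT
  rw [add_sub_cancel_right]
  linear_combination P.rate t ^ 2 * (P.ph t (x + h) y + P.ph t x y) * h5 - h1 - h2 - h3 - h4

end Specs

section Continuity

variable (P : Params) {X : Type*} [TopologicalSpace X] {ρ h t x y : X → ℝ}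

@[fun_prop]
lemma continuous_amp (ht : Continuous t) : Continuous fun q => P.amp (t q) := by
  unfold amp; fun_prop

@[fun_prop]
lemma continuous_rate (ht : Continuous t) : Continuous fun q => P.rate (t q) := by
  unfold rate; fun_prop

@[fun_prop]
lemma continuous_ph (ht : Continuous t) (hx : Continuous x) (hy : Continuous y) :
    Continuous fun q => P.ph (t q) (x q) (y q) := by
  unfold ph; fun_prop

@[fun_prop]
lemma continuous_phT (ht : Continuous t) (hx : Continuous x) (hy : Continuous y) :
    Continuous fun q => P.phT (t q) (x q) (y q) := by
  unfold phT; fun_prop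

@[fun_prop]
lemma continuous_phTT (ht : Continuous t) (hx : Continuous x) (hy : Continuous y) :
    Continuous fun q => P.phTT (t q) (x q) (y q) := by
  unfold phTT; fun_prop

@[fun_prop]
lemma continuous_gee (ht : Continuous t) (hx : Continuous x) (hy : Continuous y) :
    Continuous fun q => P.gee (t q) (x q) (y q) := by
  unfold gee qf; fun_prop

@[fun_prop]
lemma continuous_geeT (ht : Continuous t) (hx : Continuous x) (hy : Continuous y) :
    Continuous fun q => P.geeT (t q) (x q) (y q) := by
  unfold geeT qf; fun_prop

variable (hρ : Continuous ρ) (hh : Continuous h) (ht : Continuous t) (hx : Continuous x)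
  (hy : Continuous y)
include hh ht hx hy

@[fun_prop]
lemma continuous_ph₁ : Continuous fun q => P.ph₁ (h q) (t q) (x q) (y q) := by
  unfold ph₁; fun_prop

@[fun_prop]
lemma continuous_ph₁₁ : Continuous fun q => P.ph₁₁ (h q) (t q) (x q) (y q) := by
  unfold ph₁₁; fun_prop

@[fun_prop]
lemma continuous_ph₁₂ : Continuous fun q => P.ph₁₂ (h q) (t q) (x q) (y q) := by
  unfold ph₁₂; fun_prop

@[fun_prop]
lemma continuous_gee₁ : Continuous fun q => P.gee₁ (h q) (t q) (x q) (y q) := by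
  unfold gee₁ qf; fun_prop

include hρ

@[fun_prop]
lemma continuous_cosC : Continuous fun q => P.cosC (ρ q) (h q) (t q) (x q) (y q) := by
  unfold cosC; fun_prop

@[fun_prop]
lemma continuous_cosT : Continuous fun q => P.cosT (ρ q) (h q) (t q) (x q) (y q) := by
  unfold cosT; fun_prop

@[fun_prop]
lemma continuous_sinC : Continuous fun q => P.sinC (ρ q) (h q) (t q) (x q) (y q) := by
  unfold sinC; fun_prop

@[fun_prop]
lemma continuous_sinT : Continuous fun q => P.sinT (ρ q) (h q) (t q) (x q) (y q) := by
  unfold sinT; fun_prop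

@[fun_prop]
lemma continuous_pot : Continuous fun q => P.pot (ρ q) (h q) (t q) (x q) (y q) := by
  unfold pot; fun_prop

@[fun_prop]
lemma continuous_potT : Continuous fun q => P.potT (ρ q) (h q) (t q) (x q) (y q) := by
  unfold potT; fun_prop

@[fun_prop]
lemma continuous_sinL : Continuous fun q => P.sinL (ρ q) (h q) (t q) (x q) (y q) := by
  unfold sinL; fun_prop

@[fun_prop]
lemma continuous_sinX : Continuous fun q => P.sinX (ρ q) (h q) (t q) (x q) (y q) := by
  unfold sinX; fun_prop

@[fun_prop]
lemma continuous_potL : Continuous fun q => P.potL (ρ q) (h q) (t q) (x q) (y q) := by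
  unfold potL; fun_prop

@[fun_prop]
lemma continuous_potX : Continuous fun q => P.potX (ρ q) (h q) (t q) (x q) (y q) := by
  unfold potX; fun_prop

@[fun_prop]
lemma continuous_kap : Continuous fun q => P.kap (ρ q) (h q) (t q) (x q) (y q) := by
  unfold kap; fun_prop

@[fun_prop]
lemma continuous_qu : Continuous fun q => P.qu (ρ q) (h q) (t q) (x q) (y q) := by
  unfold qu; fun_prop

@[fun_prop]
lemma continuous_quT : Continuous fun q => P.quT (ρ q) (h q) (t q) (x q) (y q) := by
  unfold quT; fun_prop

@[fun_prop]
lemma continuous_qu₁ : Continuous fun q => P.qu₁ (ρ q) (h q) (t q) (x q) (y q) := by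
  unfold qu₁; fun_prop

end Continuity

/-! ### The commutator density as a quadratic form in normalized unknowns -/

/-- The coefficients of the operator conjugated by `exp (τ φ)` at time `t`. -/
def coeffs (P : Params) (τ h t : ℝ) : Coeffs where
  h := h
  Y := P.Z * (τ * h)
  b := fun i j => τ * P.phT t (i * h) (j * h)
  bt := fun i j => τ * P.phTT t (i * h) (j * h)
  g := fun i j => τ * P.gee t (i * h) (j * h)
  gt := fun i j => τ * P.geeT t (i * h) (j * h)
  q := fun i j => τ ^ 2 * P.qu (τ * h) h t (i * h) (j * h)
  qt := fun i j => τ ^ 2 * P.quT (τ * h) h t (i * h) (j * h)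
  c₁ := fun i j => P.cosC (τ * h) h t (i * h) (j * h)
  c₁t := fun i j => P.cosT (τ * h) h t (i * h) (j * h)
  s₁ := fun i j => τ * P.sinC (τ * h) h t (i * h) (j * h)
  s₁t := fun i j => τ * P.sinT (τ * h) h t (i * h) (j * h)
  c₂ := fun i j => P.cosC (τ * h) h t (j * h) (i * h)
  c₂t := fun i j => P.cosT (τ * h) h t (j * h) (i * h)
  s₂ := fun i j => τ * P.sinC (τ * h) h t (j * h) (i * h)
  s₂t := fun i j => τ * P.sinT (τ * h) h t (j * h) (i * h)

/-- The normalization of `Coeffs.lineDensity`. The unknowns are `ω = τ v`, `ν = v`, `u = ∂ₜ v`, the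
difference quotients `p, p'` (first direction, forward and backward), `r, r'` (second direction),
and `s`, the neighbour of `p` in the transverse direction. -/
def lineForm (P : Params) (ρ h t x y ω ν u p p' r r' s : ℝ) : ℝ :=
  2 * P.sinL ρ h t x y * u ^ 2
  - 2 * u * (P.sinT ρ h t x y * p + P.sinT ρ h t (x - h) y * p')
  + (P.cosT ρ h t x y * (P.phT t x y + P.phT t (x + h) y)
      + P.cosC ρ h t x y * (P.phTT t x y + P.phTT t (x + h) y)) * p ^ 2
  - 2 * u * (P.cosC ρ h t x y * (P.rate t * P.ph₁ h t x y) * p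
      + P.cosC ρ h t (x - h) y * (P.rate t * P.ph₁ h t (x - h) y) * p')
  + 2 * P.kap ρ h t x y * p * p'
  + 2 * P.cosC ρ h t x y * P.gee t (x + h) y * p ^ 2
  + 2 * P.cosC ρ h t x y * P.gee₁ h t x y * p * ν
  - 2 * P.qu ρ h t x y * P.sinL ρ h t x y * ω ^ 2
  - 2 * P.sinC ρ h t x y * P.qu₁ ρ h t x y * (ω ^ 2 + ρ * ω * p)
  - P.cosC ρ h t x y * (P.sinL ρ h t y x + P.sinL ρ h t y (x + h)) * p ^ 2
  - (P.sinC ρ h t y x + P.sinC ρ h t y (x + h)) * (ρ ^ 2 * P.potX ρ h t x y) * p * s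
  + P.cosC ρ h t x y * p * (P.sinX ρ h t y x * r + P.sinX ρ h t (y - h) x * r')
  + P.cosC ρ h t (x - h) y * p'
      * (P.sinX ρ h t y (x - h) * r + P.sinX ρ h t (y - h) (x - h) * r')

/-- `h` times the flux `div (c ∇v)`. -/
def fluxForm (P : Params) (ρ h t x y p p' r r' : ℝ) : ℝ :=
  (P.cosC ρ h t x y * p - P.cosC ρ h t (x - h) y * p')
  + (P.cosC ρ h t y x * r - P.cosC ρ h t (y - h) x * r')

/-- The normalization of `Coeffs.density`; `s` and `s'` are the transverse neighbours of `p` and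
`r`. -/
def form (P : Params) (ρ h t x y ω ν u p p' r r' s s' : ℝ) : ℝ :=
  (2 * P.phTT t x y - 2 * P.gee t x y) * u ^ 2 - 2 * P.geeT t x y * ν * u
  + P.lineForm ρ h t x y ω ν u p p' r r' s
  + P.lineForm ρ h t y x ω ν u r r' p p' s'
  + 2 * (P.quT ρ h t x y * P.phT t x y + P.qu ρ h t x y * P.phTT t x y) * ω ^ 2
  + 2 * P.qu ρ h t x y * P.gee t x y * ω ^ 2
  - 2 * P.Z * ρ * P.qu ρ h t x y * ω * ((p - p') + (r - r'))
  + 2 * P.Z * (P.fluxForm ρ h t x y p p' r r' * ((p - p') + (r - r'))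
      - 2 * ((p - p') * (r - r')))

/-- The edge part of the commutator density is `τ` times the normalized form: the difference quotients
of the coefficients are replaced by functions that are continuous up to `h = 0`. -/
lemma lineDensity_eq (P : Params) {τ h t : ℝ} (hτ : τ ≠ 0) (hh : h ≠ 0) (v v₁ : ℤ → ℤ → ℝ)
    (i j : ℤ) :
    Coeffs.lineDensity h (P.coeffs τ h t).b (P.coeffs τ h t).bt (P.coeffs τ h t).g
      (P.coeffs τ h t).q (P.coeffs τ h t).c₁ (P.coeffs τ h t).c₁t (P.coeffs τ h t).s₁
      (P.coeffs τ h t).s₁t (P.coeffs τ h t).s₂ v v₁ i j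
    = τ * P.lineForm (τ * h) h t (i * h) (j * h) (τ * v i j) (v i j) (v₁ i j) (dX h v i j)
        (dX h v (i - 1) j) (dY h v i j) (dY h v i (j - 1)) (dX h v i (j + 1)) := by
  have hρ : τ * h ≠ 0 := mul_ne_zero hτ hh
  have cp : ∀ k : ℤ, ((k + 1 : ℤ) : ℝ) * h = k * h + h := fun k => by push_cast; ring
  have cm : ∀ k : ℤ, ((k - 1 : ℤ) : ℝ) * h = k * h - h := fun k => by push_cast; ring
  have hv : v (i + 1) j = v i j + h * dX h v i j := by simp only [dX]; field_simp; ring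
  have quot : ∀ {a b d : ℝ} (k : ℝ), a - b = h * d → (k * a - k * b) / h = k * d := by
    intro a b d k hd
    rw [← mul_sub, hd]; field_simp
  have d1 : ∀ x y, (τ * P.sinC (τ * h) h t x y - τ * P.sinC (τ * h) h t (x - h) y) / h
      = τ * P.sinL (τ * h) h t x y := fun x y => quot τ (P.sinC_sub t x y hρ hh)
  have d2 : ∀ x y, (τ * P.phT t (x + h) y - τ * P.phT t x y) / h
      = τ * (P.rate t * P.ph₁ h t x y) := fun x y => quot τ (P.phT_sub t x y)
  have d2' : ∀ x y, (τ * P.phT t x y - τ * P.phT t (x - h) y) / h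
      = τ * (P.rate t * P.ph₁ h t (x - h) y) := fun x y => by
    have := d2 (x - h) y
    rwa [sub_add_cancel] at this
  have d3 : ∀ x y, (τ * P.sinC (τ * h) h t x y * P.cosC (τ * h) h t (x - h) y
      - P.cosC (τ * h) h t x y * (τ * P.sinC (τ * h) h t (x - h) y)) / h
      = τ * P.kap (τ * h) h t x y := fun x y => by
    have := quot τ (P.sinC_mul_cosC_sub t x y hρ hh)
    rw [← this]; ring
  have d4 : ∀ x y, (τ * P.gee t (x + h) y - τ * P.gee t x y) / h
      = τ * P.gee₁ h t x y := fun x y => quot τ (P.gee_sub t x y)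
  have d5 : ∀ x y, (τ ^ 2 * P.qu (τ * h) h t (x + h) y - τ ^ 2 * P.qu (τ * h) h t x y) / h
      = τ ^ 2 * P.qu₁ (τ * h) h t x y := fun x y => quot _ (P.qu_sub t x y hρ hh)
  have d6 : ∀ x y, (P.cosC (τ * h) h t x (y + h) - P.cosC (τ * h) h t x y) / h
      = (τ * h) ^ 2 * P.potX (τ * h) h t x y := fun x y => by
    rw [P.cosC_sub_transverse t x y hρ]; field_simp
  have d7 : ∀ x y, (τ * P.sinC (τ * h) h t x (y + h) - τ * P.sinC (τ * h) h t x y) / h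
      = τ * P.sinX (τ * h) h t x y := fun x y => quot τ (P.sinC_sub_transverse t x y hρ)
  have d7' : ∀ x y, (τ * P.sinC (τ * h) h t x y - τ * P.sinC (τ * h) h t x (y - h)) / h
      = τ * P.sinX (τ * h) h t x (y - h) := fun x y => by
    have := d7 x (y - h)
    rwa [sub_add_cancel] at this
  simp only [Coeffs.lineDensity, coeffs, cp, cm, hv, d1, d2, d2', d3, d4, d5, d6, d7, d7', lineForm]
  ring

/-- The commutator density is `τ` times the normalized quadratic form. -/
lemma density_eq (P : Params) {τ h t : ℝ} (hτ : τ ≠ 0) (hh : h ≠ 0) (v v₁ : ℤ → ℤ → ℝ)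
    (i j : ℤ) :
    (P.coeffs τ h t).density v v₁ i j
    = τ * P.form (τ * h) h t (i * h) (j * h) (τ * v i j) (v i j) (v₁ i j) (dX h v i j)
        (dX h v (i - 1) j) (dY h v i j) (dY h v i (j - 1)) (dX h v i (j + 1))
        (dY h v (i + 1) j) := by
  have h1 := P.lineDensity_eq (t := t) hτ hh v v₁ i j
  have h2 := P.lineDensity_eq (t := t) hτ hh (swap v) (swap v₁) j i
  have sb : swap (P.coeffs τ h t).b = (P.coeffs τ h t).b := by
    funext i j; simp only [swap, coeffs]; rw [phT_comm]
  have sbt : swap (P.coeffs τ h t).bt = (P.coeffs τ h t).bt := by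
    funext i j; simp only [swap, coeffs]; rw [phTT_comm]
  have sg : swap (P.coeffs τ h t).g = (P.coeffs τ h t).g := by
    funext i j; simp only [swap, coeffs]; rw [gee_comm]
  have sq : swap (P.coeffs τ h t).q = (P.coeffs τ h t).q := by
    funext i j; simp only [swap, coeffs]; rw [qu_comm]
  have s1 : swap (P.coeffs τ h t).c₂ = (P.coeffs τ h t).c₁ := rfl
  have s2 : swap (P.coeffs τ h t).c₂t = (P.coeffs τ h t).c₁t := rfl
  have s3 : swap (P.coeffs τ h t).s₂ = (P.coeffs τ h t).s₁ := rfl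
  have s4 : swap (P.coeffs τ h t).s₂t = (P.coeffs τ h t).s₁t := rfl
  have s5 : swap (P.coeffs τ h t).s₁ = (P.coeffs τ h t).s₂ := rfl
  have sh : (P.coeffs τ h t).h = h := rfl
  rw [Coeffs.density, sb, sbt, sg, sq, s1, s2, s3, s4, s5, sh, h1, h2]
  have hf : (P.coeffs τ h t).flux v i j = P.fluxForm (τ * h) h t (i * h) (j * h) (dX h v i j)
        (dX h v (i - 1) j) (dY h v i j) (dY h v i (j - 1)) / h := by
    have cm : ∀ k : ℤ, ((k - 1 : ℤ) : ℝ) * h = k * h - h := fun k => by push_cast; ring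
    simp only [Coeffs.flux, coeffs, cm, fluxForm]; ring
  have hZ : ∀ A B D : ℝ, 2 * (P.Z * (τ * h)) * (A / h * B - 2 / h * D)
      = τ * (2 * P.Z * (A * B - 2 * D)) := fun A B D => by field_simp
  have hJ : (P.coeffs τ h t).jump v i j
      = (dX h v i j - dX h v (i - 1) j) + (dY h v i j - dY h v i (j - 1)) := rfl
  have hY : (P.coeffs τ h t).Y = P.Z * (τ * h) := rfl
  rw [hf, hY, hJ, hZ]
  have w1 : dX h (swap v) j i = dY h v i j := rfl
  have w2 : dX h (swap v) (j - 1) i = dY h v i (j - 1) := rfl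
  have w3 : dY h (swap v) j i = dX h v i j := rfl
  have w4 : dY h (swap v) j (i - 1) = dX h v (i - 1) j := rfl
  have w5 : dX h (swap v) j (i + 1) = dY h v (i + 1) j := rfl
  have w6 : swap v j i = v i j := rfl
  have w7 : swap v₁ j i = v₁ i j := rfl
  rw [w1, w2, w3, w4, w5, w6, w7]
  simp only [coeffs, form]
  ring

end Params

/-! ### Positivity of the quadratic form -/

/-- On a compact set, a small multiple of a bounded function lies below a positive one. -/
lemma exists_pos_mul_le {X : Type*} [TopologicalSpace X] {K : Set X} (hK : IsCompact K)
    {f g : X → ℝ} (hf : ContinuousOn f K) (hg : ContinuousOn g K) (hpos : ∀ x ∈ K, 0 < f x) :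
    ∃ c > 0, ∀ x ∈ K, c * |g x| ≤ f x := by
  rcases K.eq_empty_or_nonempty with rfl | hne
  · exact ⟨1, one_pos, by simp⟩
  obtain ⟨x₀, hx₀, hmin⟩ := hK.exists_isMinOn hne hf
  obtain ⟨B, hB⟩ := hK.exists_bound_of_continuousOn hg
  have hB0 : 0 ≤ B := (norm_nonneg _).trans (hB x₀ hx₀)
  refine ⟨f x₀ / (B + 1), div_pos (hpos x₀ hx₀) (by linarith), fun x hx => ?_⟩
  have h1 : |g x| ≤ B := hB x hx
  have h2 : f x₀ ≤ f x := hmin hx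
  have h3 := hpos x₀ hx₀
  rw [div_mul_eq_mul_div, div_le_iff₀ (by linarith)]
  nlinarith [abs_nonneg (g x)]

/-- If `f > 0` on the zero set of `g ≥ 0`, then `f + Z g > 0` for large `Z`. -/
lemma exists_add_mul_pos {X : Type*} [TopologicalSpace X] {K : Set X} (hK : IsCompact K)
    {f g : X → ℝ} (hf : Continuous f) (hg : Continuous g) (hg0 : ∀ x ∈ K, 0 ≤ g x)
    (hpos : ∀ x ∈ K, g x = 0 → 0 < f x) : ∃ Z, 0 ≤ Z ∧ ∀ x ∈ K, 0 < f x + Z * g x := by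
  have hK' : IsCompact (K ∩ {x | f x ≤ 0}) :=
    hK.inter_right (isClosed_le hf continuous_const)
  obtain ⟨c, hc, hcg⟩ := exists_pos_mul_le hK' (f := g) (g := f) hg.continuousOn hf.continuousOn
    (fun x hx => (hg0 x hx.1).lt_of_ne' fun h0 => (hpos x hx.1 h0).not_ge hx.2)
  refine ⟨2 / c, by positivity, fun x hx => ?_⟩
  rcases lt_or_ge 0 (f x) with h | h
  · have := hg0 x hx; positivity
  · have h1 := hcg x ⟨hx, h⟩
    rw [abs_of_nonpos h] at h1
    have hgx : 0 < g x := (hg0 x hx).lt_of_ne' fun h0 => (hpos x hx h0).not_ge h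
    have h2 : 2 / c * (c * -f x) ≤ 2 / c * g x := by gcongr
    have h3 : 2 / c * (c * -f x) = 2 * -f x := by field_simp
    have h4 : 0 < 2 / c * g x := by positivity
    linarith

/-- Positivity at parameter value zero persists for small parameters, uniformly over a compact
set. -/
lemma exists_forall_small_pos {Y : Type*} [TopologicalSpace Y] {K : Set Y} (hK : IsCompact K)
    {F : ℝ × ℝ × ℝ → Y → ℝ} (hF : Continuous fun z : (ℝ × ℝ × ℝ) × Y => F z.1 z.2)
    (hpos : ∀ y ∈ K, 0 < F 0 y) :
    ∃ ε > 0, ∀ r ρ h : ℝ, |r| < ε → |ρ| < ε → |h| < ε → ∀ y ∈ K, 0 < F (r, ρ, h) y := by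
  have := hK.eventually_forall_of_forall_eventually (x₀ := (0 : ℝ × ℝ × ℝ))
    (P := fun z y => 0 < F z y)
    (fun y hy => hF.continuousAt.eventually (lt_mem_nhds (hpos y hy)))
  obtain ⟨ε, hε, h⟩ := Metric.eventually_nhds_iff.1 this
  refine ⟨ε, hε, fun r ρ k hr hρ hk y hy => h ?_ y hy⟩
  simp only [Prod.dist_eq, Prod.fst_zero, Prod.snd_zero, Real.dist_eq, sub_zero]
  exact max_lt hr (max_lt hρ hk)

namespace Params

/-- The zero-order and viscous remainder of the splitting `L = L₁ + L₂ + …`, normalized. -/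
def remForm (P : Params) (ρ h t x y ω p p' r r' : ℝ) : ℝ :=
  (-P.phTT t x y + P.sinL ρ h t x y + P.sinL ρ h t y x - P.gee t x y) * ω
    + P.Z * ρ * ((p - p') + (r - r'))

/-- The part of `∂ₓ⁺ ∂ₜ v` (times `h`) that is not `∂ₓ⁺` of `∂ₜ w`, for `v = exp (τ φ) w`. -/
def tailForm (P : Params) (ρ h t x y ω u p : ℝ) : ℝ :=
  (Real.exp (ρ * P.ph₁ h t x y) - 1) * (u - P.phT t x y * ω)
    + ρ * P.phT t (x + h) y * p + h * (P.rate t * P.ph₁ h t x y) * ω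

/-- `exp (τ φ) ∂ₓ⁺ w` expressed through `v = exp (τ φ) w`. -/
def gradForm (P : Params) (ρ h t x y ω p : ℝ) : ℝ :=
  Real.exp (-(ρ * P.ph₁ h t x y)) * p
    - P.ph₁ h t x y * (Real.exp (-(ρ * P.ph₁ h t x y) / 2) * shc (-(ρ * P.ph₁ h t x y) / 2)) * ω

/-- The quantities bounded by the Carleman estimate: the left-hand side for `w` and the terms
needed for the estimate at time zero. -/
def target (P : Params) (ρ h t x y ω u p r : ℝ) : ℝ :=
  (u - P.phT t x y * ω) ^ 2 + P.gradForm ρ h t x y ω p ^ 2 + P.gradForm ρ h t y x ω r ^ 2 + ω ^ 2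
    + u ^ 2 + |P.cosT ρ h t x y| * p ^ 2 + |P.cosT ρ h t y x| * r ^ 2
    + |P.quT ρ h t x y| * ω ^ 2 + p ^ 2 + r ^ 2

/-- The commutator form minus everything that has to be absorbed in it; `θ` is the reciprocal of
the large parameter `τ`. -/
def netForm (P : Params) (κ θ ρ h t x y ω u p p' r r' s s' : ℝ) : ℝ :=
  P.form ρ h t x y ω (θ * ω) u p p' r r' s s' - 2 * θ * P.remForm ρ h t x y ω p p' r r' ^ 2
    - 4 * P.Z * (P.tailForm ρ h t x y ω u p ^ 2 + P.tailForm ρ h t y x ω u r ^ 2)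
    - κ * P.target ρ h t x y ω u p r + κ * (s ^ 2 + s' ^ 2)

section Continuity

variable (P : Params) {X : Type*} [TopologicalSpace X] {ρ h t x y ω ν u p p' r r' s s' θ : X → ℝ}
  (hρ : Continuous ρ) (hh : Continuous h) (ht : Continuous t) (hx : Continuous x)
  (hy : Continuous y) (hω : Continuous ω) (hν : Continuous ν) (hu : Continuous u)
  (hp : Continuous p) (hp' : Continuous p') (hr : Continuous r) (hr' : Continuous r')
  (hs : Continuous s) (hs' : Continuous s')
include hρ hh ht hx hy

lemma continuous_target (hω : Continuous ω) (hu : Continuous u) (hp : Continuous p)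
    (hr : Continuous r) : Continuous fun q =>
    P.target (ρ q) (h q) (t q) (x q) (y q) (ω q) (u q) (p q) (r q) := by
  unfold target gradForm; fun_prop

include hω hν hu hp hp' hr hr' hs

lemma continuous_lineForm : Continuous fun q => P.lineForm (ρ q) (h q) (t q) (x q) (y q) (ω q)
    (ν q) (u q) (p q) (p' q) (r q) (r' q) (s q) := by
  unfold lineForm; fun_prop

include hs'

lemma continuous_form : Continuous fun q => P.form (ρ q) (h q) (t q) (x q) (y q) (ω q)
    (ν q) (u q) (p q) (p' q) (r q) (r' q) (s q) (s' q) := by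
  have h1 := continuous_lineForm P hρ hh ht hx hy hω hν hu hp hp' hr hr' hs
  have h2 := continuous_lineForm P hρ hh ht hy hx hω hν hu hr hr' hp hp' hs'
  unfold form fluxForm; fun_prop

omit hν

lemma continuous_netForm (κ : ℝ) (hθ : Continuous θ) : Continuous fun q =>
    P.netForm κ (θ q) (ρ q) (h q) (t q) (x q) (y q) (ω q)
      (u q) (p q) (p' q) (r q) (r' q) (s q) (s' q) := by
  have h1 := continuous_form P hρ hh ht hx hy hω (hθ.mul hω) hu hp hp' hr hr' hs hs'
  have h2 := continuous_target P hρ hh ht hx hy hω hu hp hr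
  unfold netForm remForm tailForm; fun_prop

end Continuity

lemma e₁_zero (P : Params) (x : ℝ) : P.e₁ 0 x = 2 * P.μ * (x + P.a) * P.e x := by
  simp [e₁]; ring

lemma e₂_zero (P : Params) (x : ℝ) :
    P.e₂ 0 x = (2 * P.μ + (2 * P.μ * (x + P.a)) ^ 2) * P.e x := by
  simp [e₂]; ring

/-- In the limit of vanishing mesh size, on functions without high-frequency part, the form is the
classical one: with the choice of `gee` it is a sum of nonnegative terms. -/
lemma form_zero (P : Params) (t x y ω u p r s s' : ℝ) :
    P.form 0 0 t x y ω 0 u p p r r s s'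
      = 4 * (1 - P.β) * P.μ * P.ph t x y * (u ^ 2 + p ^ 2 + r ^ 2)
        + 4 * P.μ ^ 2 * P.ph t x y
          * (-2 * P.β * t * u - 2 * (x + P.a) * p - 2 * (y + P.a) * r) ^ 2
        + P.μ ^ 3 * P.ph t x y ^ 3 * ω ^ 2 * (8 * (1 - P.β) * (2 * P.β * t) ^ 2
          + (12 + 4 * P.β) * P.qf t x y + 4 * P.μ * P.qf t x y ^ 2) := by
  simp only [form, lineForm, fluxForm, sinL, sinX, potL, potX, sinC, sinT, cosC, cosT, pot, potT,
    kap, qu, quT, qu₁, gee, geeT, gee₁, sinhQuot, coshQuot, sinhQuotDiff, coshQuotDiff, zero_mul,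
    mul_zero, add_zero, sub_zero, zero_div, shc_zero, Real.cosh_zero, Real.sinh_zero, ph₁, ph₁₁,
    ph₁₂, e₁_zero, e₂_zero, ph, phT, phTT, qf, rate]
  ring

lemma ph_pos (P : Params) (t x y : ℝ) : 0 < P.ph t x y :=
  mul_pos (mul_pos (Real.exp_pos _) (P.e_pos x)) (P.e_pos y)

/-- The limiting form is positive definite where forward and backward differences agree; the condition
on `μ` makes the coefficient of `ω²` positive. -/
lemma form_zero_pos (P : Params) (ha : 0 < P.a) (hβ : 0 < P.β) (hβ₁ : P.β < 1)
    (hμ : 1 < P.μ * ((1 - P.β) * P.a ^ 2)) (hμ₀ : 0 < P.μ) {t x y ω u p r : ℝ} (hx : 0 ≤ x)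
    (hy : 0 ≤ y) (hne : ω ≠ 0 ∨ u ≠ 0 ∨ p ≠ 0 ∨ r ≠ 0) (s s' : ℝ) :
    0 < P.form 0 0 t x y ω 0 u p p r r s s' := by
  rw [form_zero]
  have hph := P.ph_pos t x y
  have hb : 0 < 1 - P.β := by linarith
  have hW : 0 < 8 * (1 - P.β) * (2 * P.β * t) ^ 2
      + (12 + 4 * P.β) * P.qf t x y + 4 * P.μ * P.qf t x y ^ 2 := by
    -- `|∂ₜψ|² = |∇ψ|² - q` and `|∇ψ|² ≥ 8 a²`; the negative part of the linear term in `q` is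
    -- dominated by `4 μ q²`.
    set q := P.qf t x y with hq
    have e1 : (2 * P.β * t) ^ 2 = 4 * (x + P.a) ^ 2 + 4 * (y + P.a) ^ 2 - q := by
      rw [hq, qf]; ring
    have hG : 8 * P.a ^ 2 ≤ 4 * (x + P.a) ^ 2 + 4 * (y + P.a) ^ 2 := by nlinarith
    rw [e1]
    refine pos_of_mul_pos_right (a := P.μ) ?_ hμ₀.le
    have h1 : 64 < 8 * (P.μ * (1 - P.β)) * (4 * (x + P.a) ^ 2 + 4 * (y + P.a) ^ 2) := by
      have : 8 * (P.μ * (1 - P.β)) * (8 * P.a ^ 2)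
          ≤ 8 * (P.μ * (1 - P.β)) * (4 * (x + P.a) ^ 2 + 4 * (y + P.a) ^ 2) := by
        gcongr
      nlinarith
    have h2 : 0 ≤ (2 * (P.μ * q) + (4 + 12 * P.β) / 4) ^ 2 := sq_nonneg _
    have h3 : (4 + 12 * P.β) ^ 2 ≤ 16 ^ 2 := by gcongr; linarith
    nlinarith
  have h1 : 0 ≤ 4 * P.μ ^ 2 * P.ph t x y
          * (-2 * P.β * t * u - 2 * (x + P.a) * p - 2 * (y + P.a) * r) ^ 2 := by positivity
  rcases hne with h | h
  · have : 0 < ω ^ 2 := by positivity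
    have h2 : 0 ≤ 4 * (1 - P.β) * P.μ * P.ph t x y * (u ^ 2 + p ^ 2 + r ^ 2) := by positivity
    have h3 := mul_pos (mul_pos (mul_pos (pow_pos hμ₀ 3) (pow_pos hph 3)) this) hW
    linarith
  · have h2 : 0 < u ^ 2 + p ^ 2 + r ^ 2 := by
      rcases h with h | h | h <;> positivity
    have h3 : 0 < 4 * (1 - P.β) * P.μ * P.ph t x y * (u ^ 2 + p ^ 2 + r ^ 2) := by positivity
    have h4 : 0 ≤ P.μ ^ 3 * P.ph t x y ^ 3 * ω ^ 2 * (8 * (1 - P.β) * (2 * P.β * t) ^ 2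
          + (12 + 4 * P.β) * P.qf t x y + 4 * P.μ * P.qf t x y ^ 2) := by positivity
    linarith

/-- In the limit, the viscosity contributes the squared jumps of the difference quotients, and the
transverse neighbours drop out. -/
lemma form_zero_viscosity (a β c₀ μ Z t x y ω u p p' r r' s s' : ℝ) :
    (⟨a, β, c₀, μ, Z⟩ : Params).form 0 0 t x y ω 0 u p p' r r' s s'
      = (⟨a, β, c₀, μ, 0⟩ : Params).form 0 0 t x y ω 0 u p p' r r' 0 0
        + Z * (2 * ((p - p') ^ 2 + (r - r') ^ 2)) := by
  have hL : (⟨a, β, c₀, μ, Z⟩ : Params).lineForm = (⟨a, β, c₀, μ, 0⟩ : Params).lineForm := rfl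
  have h1 : (⟨a, β, c₀, μ, Z⟩ : Params).phTT = (⟨a, β, c₀, μ, 0⟩ : Params).phTT := rfl
  have h2 : (⟨a, β, c₀, μ, Z⟩ : Params).phT = (⟨a, β, c₀, μ, 0⟩ : Params).phT := rfl
  have h3 : (⟨a, β, c₀, μ, Z⟩ : Params).gee = (⟨a, β, c₀, μ, 0⟩ : Params).gee := rfl
  have h4 : (⟨a, β, c₀, μ, Z⟩ : Params).quT = (⟨a, β, c₀, μ, 0⟩ : Params).quT := rfl
  have h5 : (⟨a, β, c₀, μ, Z⟩ : Params).qu = (⟨a, β, c₀, μ, 0⟩ : Params).qu := rfl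
  simp only [form, hL, h1, h2, h3, h4, h5, fluxForm, cosC, zero_mul, Real.cosh_zero]
  simp only [lineForm]
  ring

lemma form_smul (P : Params) (l ρ h t x y ω ν u p p' r r' s s' : ℝ) :
    P.form ρ h t x y (l * ω) (l * ν) (l * u) (l * p) (l * p') (l * r) (l * r') (l * s) (l * s')
      = l ^ 2 * P.form ρ h t x y ω ν u p p' r r' s s' := by
  unfold form fluxForm lineForm; ring

lemma target_smul (P : Params) (l ρ h t x y ω u p r : ℝ) :
    P.target ρ h t x y (l * ω) (l * u) (l * p) (l * r)
      = l ^ 2 * P.target ρ h t x y ω u p r := by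
  unfold target gradForm; ring

lemma netForm_smul (P : Params) (l κ θ ρ h t x y ω u p p' r r' s s' : ℝ) :
    P.netForm κ θ ρ h t x y (l * ω) (l * u) (l * p) (l * p') (l * r) (l * r') (l * s) (l * s')
      = l ^ 2 * P.netForm κ θ ρ h t x y ω u p p' r r' s s' := by
  have h1 := P.form_smul l ρ h t x y ω (θ * ω) u p p' r r' s s'
  rw [mul_left_comm] at h1
  unfold netForm remForm tailForm
  rw [target_smul, h1]
  ring

lemma target_nonneg (P : Params) (ρ h t x y ω u p r : ℝ) : 0 ≤ P.target ρ h t x y ω u p r := by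
  unfold target; positivity

/-- Every nonzero vector is a positive multiple of a vector on the unit sphere. -/
lemma exists_smul_sphere {n : ℕ} {ξ : Fin n → ℝ} (hξ : ξ ≠ 0) :
    ∃ l > 0, ∃ η ∈ Metric.sphere (0 : Fin n → ℝ) 1, ∀ i, ξ i = l * η i := by
  have h : 0 < ‖ξ‖ := norm_pos_iff.2 hξ
  refine ⟨‖ξ‖, h, ‖ξ‖⁻¹ • ξ, ?_, fun i => ?_⟩
  · simp [norm_smul, h.ne']
  · simp [h.ne']

/-- The space-time cylinder, parametrized by `(t, x, y)`. -/
def cylinder (T : ℝ) : Set (ℝ × ℝ × ℝ) := Icc (-T) T ×ˢ (Icc 0 1 ×ˢ Icc 0 1)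

lemma isCompact_cylinder (T : ℝ) : IsCompact (cylinder T) :=
  isCompact_Icc.prod (isCompact_Icc.prod isCompact_Icc)

/-- For large viscosity the limiting form is positive on all nonzero vectors, also where forward and
backward differences disagree. -/
lemma exists_viscosity {a β c₀ μ : ℝ} (T : ℝ) (ha : 0 < a) (hβ : 0 < β) (hβ₁ : β < 1)
    (hμ : 1 < μ * ((1 - β) * a ^ 2)) (hμ₀ : 0 < μ) :
    ∃ Z, 0 ≤ Z ∧ ∀ t x y, (t, x, y) ∈ cylinder T → ∀ η ∈ Metric.sphere (0 : Fin 6 → ℝ) 1,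
      0 < (⟨a, β, c₀, μ, Z⟩ : Params).form 0 0 t x y (η 0) 0 (η 1) (η 2) (η 3) (η 4) (η 5) 0 0 := by
  let P₀ : Params := ⟨a, β, c₀, μ, 0⟩
  have hK : IsCompact (cylinder T ×ˢ Metric.sphere (0 : Fin 6 → ℝ) 1) :=
    (isCompact_cylinder T).prod (isCompact_sphere _ _)
  obtain ⟨Z, hZ, H⟩ := exists_add_mul_pos hK
    (f := fun q => P₀.form 0 0 q.1.1 q.1.2.1 q.1.2.2 (q.2 0) 0 (q.2 1) (q.2 2) (q.2 3) (q.2 4)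
      (q.2 5) 0 0)
    (g := fun q => 2 * ((q.2 2 - q.2 3) ^ 2 + (q.2 4 - q.2 5) ^ 2))
    (by apply continuous_form <;> fun_prop) (by fun_prop) (fun q _ => by positivity)
    (by
      rintro ⟨⟨t, x, y⟩, η⟩ hq h0
      simp only [cylinder, mem_prod, mem_Icc, mem_sphere_zero_iff_norm] at hq h0 ⊢
      have e1 : η 3 = η 2 := by nlinarith [sq_nonneg (η 2 - η 3), sq_nonneg (η 4 - η 5)]
      have e2 : η 5 = η 4 := by nlinarith [sq_nonneg (η 2 - η 3), sq_nonneg (η 4 - η 5)]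
      rw [e1, e2]
      refine P₀.form_zero_pos ha hβ hβ₁ hμ hμ₀ hq.1.2.1.1 hq.1.2.2.1 ?_ 0 0
      by_contra hcon
      push Not at hcon
      have : η = 0 := by
        funext i
        fin_cases i
        · exact hcon.1
        · exact hcon.2.1
        · exact hcon.2.2.1
        · exact e1.trans hcon.2.2.1
        · exact hcon.2.2.2
        · exact e2.trans hcon.2.2.2
      rw [this] at hq
      simp at hq)
  refine ⟨Z, hZ, fun t x y hc η hη => ?_⟩
  rw [form_zero_viscosity]
  exact H ((t, x, y), η) ⟨hc, hη⟩

/-- Coercivity of the net form for small `1 / τ`, `τ h` and `h`. -/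
lemma exists_netForm_nonneg {a β c₀ μ : ℝ} (T : ℝ) (ha : 0 < a) (hβ : 0 < β) (hβ₁ : β < 1)
    (hμ : 1 < μ * ((1 - β) * a ^ 2)) (hμ₀ : 0 < μ) :
    ∃ Z, 0 ≤ Z ∧ ∃ κ > 0, ∃ ε > 0, ∀ θ ρ h t x y, |θ| < ε → |ρ| < ε → |h| < ε →
      (t, x, y) ∈ cylinder T → ∀ ω u p p' r r' s s',
        0 ≤ (⟨a, β, c₀, μ, Z⟩ : Params).netForm κ θ ρ h t x y ω u p p' r r' s s' := by
  obtain ⟨Z, hZ, hpos⟩ := exists_viscosity (c₀ := c₀) T ha hβ hβ₁ hμ hμ₀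
  set P : Params := ⟨a, β, c₀, μ, Z⟩ with hP
  have hK : IsCompact (cylinder T ×ˢ Metric.sphere (0 : Fin 6 → ℝ) 1) :=
    (isCompact_cylinder T).prod (isCompact_sphere _ _)
  obtain ⟨κ, hκ, hle⟩ := exists_pos_mul_le hK
    (f := fun q => P.form 0 0 q.1.1 q.1.2.1 q.1.2.2 (q.2 0) 0 (q.2 1) (q.2 2) (q.2 3) (q.2 4)
      (q.2 5) 0 0)
    (g := fun q => 2 * P.target 0 0 q.1.1 q.1.2.1 q.1.2.2 (q.2 0) (q.2 1) (q.2 2) (q.2 4))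
    (by apply Continuous.continuousOn; apply continuous_form <;> fun_prop)
    (by
      apply Continuous.continuousOn
      apply Continuous.mul continuous_const
      apply continuous_target <;> fun_prop)
    (fun q hq => hpos _ _ _ hq.1 _ hq.2)
  -- the estimate on the sphere, extended to all nonzero vectors by homogeneity
  have hle' : ∀ t x y, (t, x, y) ∈ cylinder T → ∀ ω u p p' r r',
      (![ω, u, p, p', r, r'] : Fin 6 → ℝ) ≠ 0 →
      0 < P.form 0 0 t x y ω 0 u p p' r r' 0 0 ∧
      2 * κ * P.target 0 0 t x y ω u p r ≤ P.form 0 0 t x y ω 0 u p p' r r' 0 0 := by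
    intro t x y hc ω u p p' r r' hne
    obtain ⟨l, hl, η, hη, he⟩ := exists_smul_sphere hne
    have e0 : ω = l * η 0 := he 0
    have e1 : u = l * η 1 := he 1
    have e2 : p = l * η 2 := he 2
    have e3 : p' = l * η 3 := he 3
    have e4 : r = l * η 4 := he 4
    have e5 : r' = l * η 5 := he 5
    have hf := P.form_smul l 0 0 t x y (η 0) 0 (η 1) (η 2) (η 3) (η 4) (η 5) 0 0
    rw [mul_zero] at hf
    rw [e0, e1, e2, e3, e4, e5, hf, target_smul]
    have h1 := hle ((t, x, y), η) ⟨hc, hη⟩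
    have h2 := hpos t x y hc η hη
    simp only [abs_mul, abs_of_nonneg (P.target_nonneg _ _ _ _ _ _ _ _ _), abs_two] at h1
    refine ⟨by positivity, ?_⟩
    have : 0 < l ^ 2 := by positivity
    nlinarith
  have hK' : IsCompact (cylinder T ×ˢ Metric.sphere (0 : Fin 8 → ℝ) 1) :=
    (isCompact_cylinder T).prod (isCompact_sphere _ _)
  obtain ⟨ε, hε, H⟩ := exists_forall_small_pos hK'
    (F := fun z q => P.netForm κ z.1 z.2.1 z.2.2 q.1.1 q.1.2.1 q.1.2.2 (q.2 0) (q.2 1) (q.2 2)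
      (q.2 3) (q.2 4) (q.2 5) (q.2 6) (q.2 7))
    (by apply continuous_netForm <;> fun_prop)
    (by
      rintro ⟨⟨t, x, y⟩, η⟩ ⟨hc, hη⟩
      simp only at hc hη ⊢
      have e : P.netForm κ 0 0 0 t x y (η 0) (η 1) (η 2) (η 3) (η 4) (η 5) (η 6) (η 7)
          = P.form 0 0 t x y (η 0) 0 (η 1) (η 2) (η 3) (η 4) (η 5) 0 0
            - κ * P.target 0 0 t x y (η 0) (η 1) (η 2) (η 4) + κ * (η 6 ^ 2 + η 7 ^ 2) := by
        have f₁ := form_zero_viscosity a β c₀ μ Z t x y (η 0) (η 1) (η 2) (η 3) (η 4) (η 5)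
          (η 6) (η 7)
        have f₂ := form_zero_viscosity a β c₀ μ Z t x y (η 0) (η 1) (η 2) (η 3) (η 4) (η 5) 0 0
        rw [← hP] at f₁ f₂
        simp only [netForm, tailForm, zero_mul, mul_zero, Real.exp_zero]
        linear_combination f₁ - f₂
      simp only [Prod.fst_zero, Prod.snd_zero]
      rw [e]
      have ht := P.target_nonneg 0 0 t x y (η 0) (η 1) (η 2) (η 4)
      by_cases h6 : (![η 0, η 1, η 2, η 3, η 4, η 5] : Fin 6 → ℝ) = 0
      · have g : ∀ i : Fin 6, (![η 0, η 1, η 2, η 3, η 4, η 5] : Fin 6 → ℝ) i = 0 :=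
          fun i => by rw [h6]; rfl
        have g0 : η 0 = 0 := g 0
        have g1 : η 1 = 0 := g 1
        have g2 : η 2 = 0 := g 2
        have g3 : η 3 = 0 := g 3
        have g4 : η 4 = 0 := g 4
        have g5 : η 5 = 0 := g 5
        have hne : η 6 ≠ 0 ∨ η 7 ≠ 0 := by
          by_contra hcon
          push Not at hcon
          have : η = 0 := by
            funext i
            fin_cases i
            exacts [g0, g1, g2, g3, g4, g5, hcon.1, hcon.2]
          rw [this] at hη
          simp at hη
        have h1 : P.form 0 0 t x y 0 0 0 0 0 0 0 0 0 = 0 := by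
          have := P.form_smul 0 0 0 t x y 0 0 0 0 0 0 0 0 0
          simpa using this
        have h2 : P.target 0 0 t x y 0 0 0 0 = 0 := by
          have := P.target_smul 0 0 0 t x y 0 0 0 0
          simpa using this
        rw [g0, g1, g2, g3, g4, g5, h1, h2]
        have : 0 < η 6 ^ 2 + η 7 ^ 2 := by
          rcases hne with h | h <;> positivity
        have := mul_pos hκ this
        linarith
      · obtain ⟨h1, h2⟩ := hle' t x y hc _ _ _ _ _ _ h6
        have h3 : 0 ≤ κ * (η 6 ^ 2 + η 7 ^ 2) := by positivity
        linarith)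
  refine ⟨Z, hZ, κ, hκ, ε, hε, fun θ ρ h t x y hθ hρ hh hc ω u p p' r r' s s' => ?_⟩
  by_cases h0 : (![ω, u, p, p', r, r', s, s'] : Fin 8 → ℝ) = 0
  · have g : ∀ i : Fin 8, (![ω, u, p, p', r, r', s, s'] : Fin 8 → ℝ) i = 0 :=
      fun i => by rw [h0]; rfl
    have g0 : ω = 0 := g 0
    have g1 : u = 0 := g 1
    have g2 : p = 0 := g 2
    have g3 : p' = 0 := g 3
    have g4 : r = 0 := g 4
    have g5 : r' = 0 := g 5
    have g6 : s = 0 := g 6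
    have g7 : s' = 0 := g 7
    rw [g0, g1, g2, g3, g4, g5, g6, g7]
    have := P.netForm_smul 0 κ θ ρ h t x y 0 0 0 0 0 0 0 0
    simp only [mul_zero, ne_eq, OfNat.ofNat_ne_zero, not_false_eq_true, zero_pow, zero_mul] at this
    exact this.ge
  · obtain ⟨l, hl, η, hη, he⟩ := exists_smul_sphere h0
    have e0 : ω = l * η 0 := he 0
    have e1 : u = l * η 1 := he 1
    have e2 : p = l * η 2 := he 2
    have e3 : p' = l * η 3 := he 3
    have e4 : r = l * η 4 := he 4
    have e5 : r' = l * η 5 := he 5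
    have e6 : s = l * η 6 := he 6
    have e7 : s' = l * η 7 := he 7
    have := H θ ρ h hθ hρ hh ((t, x, y), η) ⟨hc, hη⟩
    rw [e0, e1, e2, e3, e4, e5, e6, e7, netForm_smul]
    simp only at this
    positivity

end Params

/-! ### The differential inequality at a fixed time -/

lemma mesh_pos (N : ℕ) : 0 < mesh N := by unfold mesh; positivity

lemma mul_mesh_mem {N : ℕ} {i : ℤ} (h0 : 0 ≤ i) (h1 : i ≤ (N : ℤ) + 1) :
    (i : ℝ) * mesh N ∈ Icc (0 : ℝ) 1 := by
  have h2 : (i : ℝ) ≤ (N : ℝ) + 1 := by exact_mod_cast h1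
  have h3 : (0 : ℝ) ≤ i := by exact_mod_cast h0
  refine ⟨mul_nonneg h3 (mesh_pos N).le, ?_⟩
  unfold mesh
  rw [mul_one_div, div_le_one (by positivity)]
  exact h2

lemma boxSum_le_boxSum {N : ℕ} {f g : ℤ → ℤ → ℝ}
    (h : ∀ i j : ℤ, 0 ≤ i → i ≤ (N : ℤ) + 1 → 0 ≤ j → j ≤ (N : ℤ) + 1 → f i j ≤ g i j) :
    boxSum N f ≤ boxSum N g := by
  refine Finset.sum_le_sum fun i hi => Finset.sum_le_sum fun j hj => ?_
  rw [Finset.mem_range] at hi hj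
  exact h i j (by omega) (by omega) (by omega) (by omega)

/-- The restriction of an array to the interior nodes. -/
def interior (N : ℕ) (f : ℤ → ℤ → ℝ) : ℤ → ℤ → ℝ := fun i j =>
  if 1 ≤ i ∧ i ≤ N ∧ 1 ≤ j ∧ j ≤ N then f i j else 0

/-- The squared outward differences at the right and the upper side of the square. -/
def outflow (N : ℕ) (h : ℝ) (v : ℤ → ℤ → ℝ) : ℤ → ℤ → ℝ := fun i j =>
  (if i = (N : ℤ) + 1 then dX h v (i - 1) j ^ 2 else 0)
    + (if j = (N : ℤ) + 1 then dY h v i (j - 1) ^ 2 else 0)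

namespace Params

/-- The smallness conditions on `θ = 1 / τ`, `ρ = τ h` and `h` under which the estimate holds:
coercivity of the net form, the favourable sign on the lower sides of the square, and bounds for
the coefficients of the terms on the right-hand side. -/
def Coercive (P : Params) (T κ B θ ρ h : ℝ) : Prop :=
  ∀ t x y, (t, x, y) ∈ cylinder T →
    (∀ ω u p p' r r' s s', 0 ≤ P.netForm κ θ ρ h t x y ω u p p' r r' s s') ∧
    P.Z * h ≤ P.sinC ρ h t 0 y ∧
    2 * P.cosC ρ h t x y * (P.sinC ρ h t x y + P.Z * h) ≤ B ∧
    Real.exp (ρ * P.ph₁ h t x y) ^ 2 ≤ B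

/-- The choice of the parameters: first `μ`, then the viscosity `Z`, then `κ`, and last the threshold
`ε`. -/
lemma exists_coercive {a β : ℝ} (c₀ T : ℝ) (ha : 0 < a) (hβ : 0 < β) (hβ₁ : β < 1) :
    ∃ P : Params, P.a = a ∧ P.β = β ∧ P.c₀ = c₀ ∧ 1 ≤ P.μ ∧ 0 ≤ P.Z ∧ ∃ κ > 0, ∃ B > 0, ∃ ε > 0,
      ∀ θ ρ h, |θ| < ε → |ρ| < ε → |h| < ε → P.Coercive T κ B θ ρ h := by
  have hb : 0 < (1 - β) * a ^ 2 := mul_pos (by linarith) (by positivity)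
  -- `form_zero_pos` requires `μ (1 - β) a² > 1`; any such `μ ≥ 1` would do
  set μ := 1 + 1 / ((1 - β) * a ^ 2) with hμ
  have hμ1 : 1 ≤ μ := by rw [hμ]; have := one_div_pos.2 hb; linarith
  have hμ2 : 1 < μ * ((1 - β) * a ^ 2) := by
    rw [hμ, add_mul, one_div_mul_cancel hb.ne']; linarith
  obtain ⟨Z, hZ, κ, hκ, ε₁, hε₁, H₁⟩ :=
    exists_netForm_nonneg (c₀ := c₀) T ha hβ hβ₁ hμ2 (by linarith)
  set P : Params := ⟨a, β, c₀, μ, Z⟩ with hP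
  have hK := isCompact_cylinder T
  obtain ⟨ε₂, hε₂, H₂⟩ := exists_forall_small_pos hK
    (F := fun z q => P.sinC z.2.1 z.2.2 q.1 0 q.2.2 - P.Z * z.2.2) (by fun_prop) (by
      rintro ⟨t, x, y⟩ -
      simp only [Prod.snd_zero, Prod.fst_zero, mul_zero, sub_zero, sinC, sinhQuot, zero_mul,
        shc_zero, mul_one, ph₁, e₁_zero, zero_add]
      have h1 := P.e_pos 0
      have h2 := P.e_pos y
      have h3 : 0 < P.amp t := Real.exp_pos _
      have h4 : 0 < P.μ := by simp only [hP]; linarith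
      have h5 : 0 < P.a := ha
      positivity)
  obtain ⟨B, hB⟩ := hK.exists_bound_of_continuousOn
    (f := fun q : ℝ × ℝ × ℝ => 2 * P.cosC 0 0 q.1 q.2.1 q.2.2 * (P.sinC 0 0 q.1 q.2.1 q.2.2))
    (by fun_prop)
  obtain ⟨ε₃, hε₃, H₃⟩ := exists_forall_small_pos hK
    (F := fun z q => max B 1 + 1 - 2 * P.cosC z.2.1 z.2.2 q.1 q.2.1 q.2.2
      * (P.sinC z.2.1 z.2.2 q.1 q.2.1 q.2.2 + P.Z * z.2.2)) (by fun_prop) (by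
      intro q hq
      have := (le_abs_self _).trans (hB q hq)
      simp only [Prod.snd_zero, Prod.fst_zero, mul_zero, add_zero]
      have := le_max_left B 1
      linarith)
  obtain ⟨ε₄, hε₄, H₄⟩ := exists_forall_small_pos hK
    (F := fun z q => max B 1 + 1 - Real.exp (z.2.1 * P.ph₁ z.2.2 q.1 q.2.1 q.2.2) ^ 2)
    (by fun_prop) (by
      intro q hq
      simp only [Prod.snd_zero, Prod.fst_zero, zero_mul, Real.exp_zero]
      have := le_max_right B 1
      linarith)
  refine ⟨P, rfl, rfl, rfl, hμ1, hZ, κ, hκ, max B 1 + 1, by positivity,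
    min (min ε₁ ε₂) (min ε₃ ε₄), by positivity, fun θ ρ h hθ hρ hh t x y hq => ?_⟩
  simp only [lt_min_iff] at hθ hρ hh
  refine ⟨H₁ θ ρ h t x y hθ.1.1 hρ.1.1 hh.1.1 hq, ?_, ?_, ?_⟩
  · have := H₂ θ ρ h hθ.1.2 hρ.1.2 hh.1.2 _ hq
    simp only at this; linarith
  · have := H₃ θ ρ h hθ.2.1 hρ.2.1 hh.2.1 _ hq
    simp only at this; linarith
  · have := H₄ θ ρ h hθ.2.2 hρ.2.2 hh.2.2 _ hq
    simp only at this; linarith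

/-- `target` without the last two terms, which compensate the transverse neighbours in the form. -/
def coreTarget (P : Params) (ρ h t x y ω u p r : ℝ) : ℝ :=
  (u - P.phT t x y * ω) ^ 2 + P.gradForm ρ h t x y ω p ^ 2 + P.gradForm ρ h t y x ω r ^ 2 + ω ^ 2
    + u ^ 2 + |P.cosT ρ h t x y| * p ^ 2 + |P.cosT ρ h t y x| * r ^ 2
    + |P.quT ρ h t x y| * ω ^ 2

/-- `2 L₁ v L₂ v` at an arbitrary node: the lower sides of the square contribute with a good sign,
and the right and upper sides are controlled by the outward differences. -/
lemma symPart_mul_multiplier_le (P : Params) {T κ B τ t : ℝ} {N : ℕ} (hτ : 0 < τ)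
    (hP : P.Coercive T κ B τ⁻¹ (τ * mesh N) (mesh N)) (ht : t ∈ Icc (-T) T) (hB : 0 < B)
    {v v₁ v₂ L R : ℤ → ℤ → ℝ} (hv : InteriorSupported N v) (hv₁ : InteriorSupported N v₁)
    (hv₂ : InteriorSupported N v₂)
    (hL : ∀ i j, L i j = (P.coeffs τ (mesh N) t).symPart v v₂ i j
      + (P.coeffs τ (mesh N) t).multiplier v v₁ i j + R i j)
    {i j : ℤ} (hi0 : 0 ≤ i) (hi1 : i ≤ (N : ℤ) + 1) (hj0 : 0 ≤ j) (hj1 : j ≤ (N : ℤ) + 1) :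
    2 * (P.coeffs τ (mesh N) t).symPart v v₂ i j * (P.coeffs τ (mesh N) t).multiplier v v₁ i j
      ≤ interior N (fun i j => 2 * L i j ^ 2 - (P.coeffs τ (mesh N) t).symPart v v₂ i j ^ 2) i j
        + 2 * R i j ^ 2 + B * τ / mesh N * outflow N (mesh N) v i j := by
  have hh := mesh_pos N
  set h := mesh N with hh'
  have cm : ∀ k : ℤ, ((k - 1 : ℤ) : ℝ) * h = k * h - h := fun k => by push_cast; ring
  have hout : 0 ≤ B * τ / h * outflow N h v i j := by
    have : 0 ≤ outflow N h v i j := by unfold outflow; positivity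
    positivity
  have hc : ∀ ρ h t x y, 0 < P.cosC ρ h t x y := fun _ _ _ _ _ => Real.cosh_pos _
  by_cases hint : 1 ≤ i ∧ i ≤ N ∧ 1 ≤ j ∧ j ≤ N
  · rw [interior, if_pos hint, hL]
    nlinarith [sq_nonneg ((P.coeffs τ h t).multiplier v v₁ i j),
      sq_nonneg ((P.coeffs τ h t).symPart v v₂ i j + (P.coeffs τ h t).multiplier v v₁ i j
        + 2 * R i j)]
  · rw [interior, if_neg hint]
    have hR : 0 ≤ 2 * R i j ^ 2 := by positivity
    have hv1 : v₁ i j = 0 := hv₁ i j (by omega)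
    have hv2 : v₂ i j = 0 := hv₂ i j (by omega)
    have hv0 : v i j = 0 := hv i j (by omega)
    have hx := mul_mesh_mem hi0 hi1
    have hy := mul_mesh_mem hj0 hj1
    rw [← hh'] at hx hy
    have cases : i = 0 ∨ i = (N : ℤ) + 1 ∨ j = 0 ∨ j = (N : ℤ) + 1 := by omega
    rcases cases with hi | hi | hj | hj
    · subst hi
      have z1 : dX h v (-1) j = 0 := by simp [dX, hv.eq_zero_left]
      have z2 : dY h v 0 j = 0 := by simp [dY, hv.eq_zero_left]
      have z3 : dY h v 0 (j - 1) = 0 := by simp [dY, hv.eq_zero_left]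
      have hs := (hP t 0 (j * h) ⟨ht, ⟨le_rfl, zero_le_one⟩, hy⟩).2.1
      have hcp := hc (τ * h) h t 0 (j * h)
      simp only [Coeffs.symPart, Coeffs.multiplier, Coeffs.flux, Coeffs.advect, Coeffs.jump, coeffs,
        z1, z2, z3, hv0, hv1, hv2, Int.cast_zero, zero_mul, mul_zero, sub_zero, add_zero, zero_div,
        zero_sub, zero_add] at hout hR ⊢
      have e : 2 * -(P.cosC (τ * h) h t 0 (↑j * h) * dX h v 0 j / h)
          * (τ * P.sinC (τ * h) h t 0 (↑j * h) * dX h v 0 j - P.Z * (τ * h) * dX h v 0 j)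
          = -(2 * P.cosC (τ * h) h t 0 (↑j * h) * τ / h
            * (P.sinC (τ * h) h t 0 (↑j * h) - P.Z * h) * dX h v 0 j ^ 2) := by ring
      rw [e]
      have : 0 ≤ P.sinC (τ * h) h t 0 (↑j * h) - P.Z * h := by linarith
      have : 0 ≤ 2 * P.cosC (τ * h) h t 0 (↑j * h) * τ / h
            * (P.sinC (τ * h) h t 0 (↑j * h) - P.Z * h) * dX h v 0 j ^ 2 := by positivity
      linarith
    · have z1 : dX h v i j = 0 := by
        simp [dX, hv0, hv.eq_zero_right (show (N : ℤ) + 1 ≤ i + 1 by omega)]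
      have z2 : dY h v i j = 0 := by simp [dY, hv.eq_zero_right hi.ge]
      have z3 : dY h v i (j - 1) = 0 := by simp [dY, hv.eq_zero_right hi.ge]
      have hx' := mul_mesh_mem (N := N) (i := i - 1) (by omega) (by omega)
      have hs := (hP t _ (j * h) ⟨ht, hx', hy⟩).2.2.1
      rw [← hh'] at hs
      have ho : dX h v (i - 1) j ^ 2 ≤ outflow N h v i j := by
        rw [outflow, if_pos hi]
        have : 0 ≤ (if j = (N : ℤ) + 1 then dY h v i (j - 1) ^ 2 else 0) := by positivity
        linarith
      simp only [Coeffs.symPart, Coeffs.multiplier, Coeffs.flux, Coeffs.advect, Coeffs.jump, coeffs,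
        z1, z2, z3, hv0, hv1, hv2, mul_zero, sub_zero, add_zero, zero_div,
        zero_sub, zero_add] at hout hR ⊢
      calc _ = 2 * P.cosC (τ * h) h t (((i - 1 : ℤ) : ℝ) * h) (↑j * h)
            * (P.sinC (τ * h) h t (((i - 1 : ℤ) : ℝ) * h) (↑j * h) + P.Z * h)
            * (τ / h * dX h v (i - 1) j ^ 2) := by ring
        _ ≤ B * (τ / h * dX h v (i - 1) j ^ 2) := by gcongr
        _ = B * τ / h * dX h v (i - 1) j ^ 2 := by ring
        _ ≤ B * τ / h * outflow N h v i j := by gcongr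
        _ ≤ _ := by linarith
    · subst hj
      have z1 : dY h v i (-1) = 0 := by simp [dY, hv.eq_zero_bot]
      have z2 : dX h v i 0 = 0 := by simp [dX, hv.eq_zero_bot]
      have z3 : dX h v (i - 1) 0 = 0 := by simp [dX, hv.eq_zero_bot]
      have hs := (hP t 0 (i * h) ⟨ht, ⟨le_rfl, zero_le_one⟩, hx⟩).2.1
      have hcp := hc (τ * h) h t 0 (i * h)
      simp only [Coeffs.symPart, Coeffs.multiplier, Coeffs.flux, Coeffs.advect, Coeffs.jump, coeffs,
        z1, z2, z3, hv0, hv1, hv2, Int.cast_zero, zero_mul, mul_zero, sub_zero, add_zero, zero_div,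
        zero_sub, zero_add] at hout hR ⊢
      have e : 2 * -(P.cosC (τ * h) h t 0 (↑i * h) * dY h v i 0 / h)
          * (τ * P.sinC (τ * h) h t 0 (↑i * h) * dY h v i 0 - P.Z * (τ * h) * dY h v i 0)
          = -(2 * P.cosC (τ * h) h t 0 (↑i * h) * τ / h
            * (P.sinC (τ * h) h t 0 (↑i * h) - P.Z * h) * dY h v i 0 ^ 2) := by ring
      rw [e]
      have : 0 ≤ P.sinC (τ * h) h t 0 (↑i * h) - P.Z * h := by linarith
      have : 0 ≤ 2 * P.cosC (τ * h) h t 0 (↑i * h) * τ / h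
            * (P.sinC (τ * h) h t 0 (↑i * h) - P.Z * h) * dY h v i 0 ^ 2 := by positivity
      linarith
    · have z1 : dY h v i j = 0 := by
        simp [dY, hv0, hv.eq_zero_top i (show (N : ℤ) + 1 ≤ j + 1 by omega)]
      have z2 : dX h v i j = 0 := by simp [dX, hv.eq_zero_top _ hj.ge]
      have z3 : dX h v (i - 1) j = 0 := by simp [dX, hv.eq_zero_top _ hj.ge]
      have hy' := mul_mesh_mem (N := N) (i := j - 1) (by omega) (by omega)
      have hs := (hP t _ (i * h) ⟨ht, hy', hx⟩).2.2.1
      rw [← hh'] at hs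
      have ho : dY h v i (j - 1) ^ 2 ≤ outflow N h v i j := by
        rw [outflow, if_pos hj]
        have : 0 ≤ (if i = (N : ℤ) + 1 then dX h v (i - 1) j ^ 2 else 0) := by positivity
        linarith
      simp only [Coeffs.symPart, Coeffs.multiplier, Coeffs.flux, Coeffs.advect, Coeffs.jump, coeffs,
        z1, z2, z3, hv0, hv1, hv2, mul_zero, sub_zero, add_zero, zero_div,
        zero_sub, zero_add] at hout hR ⊢
      calc _ = 2 * P.cosC (τ * h) h t (((j - 1 : ℤ) : ℝ) * h) (↑i * h)
            * (P.sinC (τ * h) h t (((j - 1 : ℤ) : ℝ) * h) (↑i * h) + P.Z * h)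
            * (τ / h * dY h v i (j - 1) ^ 2) := by ring
        _ ≤ B * (τ / h * dY h v i (j - 1) ^ 2) := by gcongr
        _ = B * τ / h * dY h v i (j - 1) ^ 2 := by ring
        _ ≤ B * τ / h * outflow N h v i j := by gcongr
        _ ≤ _ := by linarith

/-- **The differential inequality.** At a fixed time, the time derivative of the energy plus the
controlled quantities are bounded by the conjugated equation, the outward differences and the
high-frequency term. -/
lemma boxSum_energyDeriv_add_le (P : Params) {T κ B τ t : ℝ} {N : ℕ} (hZ : 0 ≤ P.Z) (hτ : 0 < τ)
    (hP : P.Coercive T κ B τ⁻¹ (τ * mesh N) (mesh N)) (ht : t ∈ Icc (-T) T) (hB : 0 < B)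
    {v v₁ v₂ L z z' : ℤ → ℤ → ℝ} (hv : InteriorSupported N v) (hv₁ : InteriorSupported N v₁)
    (hv₂ : InteriorSupported N v₂)
    (hL : ∀ i j, L i j = (P.coeffs τ (mesh N) t).symPart v v₂ i j
      + (P.coeffs τ (mesh N) t).multiplier v v₁ i j
      + P.remForm (τ * mesh N) (mesh N) t (i * mesh N) (j * mesh N) (τ * v i j)
          (dX (mesh N) v i j) (dX (mesh N) v (i - 1) j) (dY (mesh N) v i j)
          (dY (mesh N) v i (j - 1)))
    (hz : ∀ i j : ℤ, v₁ (i + 1) j - v₁ i j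
      = mesh N * (Real.exp (τ * mesh N * P.ph₁ (mesh N) t (i * mesh N) (j * mesh N)) * z i j)
        + P.tailForm (τ * mesh N) (mesh N) t (i * mesh N) (j * mesh N) (τ * v i j) (v₁ i j)
            (dX (mesh N) v i j))
    (hz' : ∀ i j : ℤ, v₁ i (j + 1) - v₁ i j
      = mesh N * (Real.exp (τ * mesh N * P.ph₁ (mesh N) t (j * mesh N) (i * mesh N)) * z' i j)
        + P.tailForm (τ * mesh N) (mesh N) t (j * mesh N) (i * mesh N) (τ * v i j) (v₁ i j)
            (dY (mesh N) v i j)) :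
    boxSum N ((P.coeffs τ (mesh N) t).energyDeriv v v₁ v₂)
      + κ * τ * boxSum N (fun i j => P.coreTarget (τ * mesh N) (mesh N) t (i * mesh N) (j * mesh N)
          (τ * v i j) (v₁ i j) (dX (mesh N) v i j) (dY (mesh N) v i j))
      + boxSum N (interior N fun i j => (P.coeffs τ (mesh N) t).symPart v v₂ i j ^ 2)
    ≤ 2 * boxSum N (interior N fun i j => L i j ^ 2)
      + B * τ / mesh N * boxSum N (outflow N (mesh N) v)
      + 4 * P.Z * B * τ * mesh N ^ 2 * boxSum N (fun i j => z i j ^ 2 + z' i j ^ 2) := by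
  have hh := mesh_pos N
  set h := mesh N with hh'
  set K := P.coeffs τ h t with hK
  have hKh : K.h = h := rfl
  have hKY : K.Y = P.Z * (τ * h) := rfl
  let R : ℤ → ℤ → ℝ := fun i j => P.remForm (τ * h) h t (i * h) (j * h) (τ * v i j)
          (dX h v i j) (dX h v (i - 1) j) (dY h v i j) (dY h v i (j - 1))
  let C : ℤ → ℤ → ℝ := fun i j => P.coreTarget (τ * h) h t (i * h) (j * h)
          (τ * v i j) (v₁ i j) (dX h v i j) (dY h v i j)
  let W : ℤ → ℤ → ℝ := fun i j =>
    P.tailForm (τ * h) h t (i * h) (j * h) (τ * v i j) (v₁ i j) (dX h v i j) ^ 2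
    + P.tailForm (τ * h) h t (j * h) (i * h) (τ * v i j) (v₁ i j) (dY h v i j) ^ 2
  have s1 := K.boxSum_symPart_mul_multiplier (v₂ := v₂) (by rw [hKh]; exact hh)
    (by rw [hKY]; positivity) hv hv₁
  rw [hKh, hKY] at s1
  have s2 : boxSum N (fun i j => 2 * K.symPart v v₂ i j * K.multiplier v v₁ i j)
      ≤ boxSum N (fun i j => interior N (fun i j => 2 * L i j ^ 2 - K.symPart v v₂ i j ^ 2) i j
        + 2 * R i j ^ 2 + B * τ / h * outflow N h v i j) :=
    boxSum_le_boxSum fun i j h1 h2 h3 h4 =>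
      P.symPart_mul_multiplier_le hτ hP ht hB hv hv₁ hv₂ hL h1 h2 h3 h4
  have s3 : boxSum N (fun i j => 2 * R i j ^ 2 + (4 * P.Z * τ * W i j + (κ * τ * C i j
        + κ * τ * ((dX h v i j ^ 2 + dY h v i j ^ 2)
          - (dX h v i (j + 1) ^ 2 + dY h v (i + 1) j ^ 2)))))
      ≤ boxSum N (K.density v v₁) := by
    refine boxSum_le_boxSum fun i j h1 h2 h3 h4 => ?_
    rw [hK, P.density_eq hτ.ne' hh.ne']
    have hc := (hP t (i * h) (j * h) ⟨ht, mul_mesh_mem h1 h2, mul_mesh_mem h3 h4⟩).1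
      (τ * v i j) (v₁ i j) (dX h v i j) (dX h v (i - 1) j) (dY h v i j)
      (dY h v i (j - 1)) (dX h v i (j + 1)) (dY h v (i + 1) j)
    rw [netForm, inv_mul_cancel_left₀ hτ.ne'] at hc
    have hc' := mul_nonneg hτ.le hc
    have e : ∀ A : ℝ, τ * (2 * τ⁻¹ * A) = 2 * A := fun A => by field_simp
    rw [mul_add, mul_sub, mul_sub, mul_sub, e] at hc'
    simp only [target] at hc'
    simp only [R, C, W, coreTarget]
    linarith
  have s4 : boxSum N (fun i j => (v₁ (i + 1) j - v₁ i j) * dX h v₁ i j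
          + (v₁ i (j + 1) - v₁ i j) * dY h v₁ i j)
      ≤ boxSum N (fun i j => 2 * h * B * (z i j ^ 2 + z' i j ^ 2) + 2 / h * W i j) := by
    refine boxSum_le_boxSum fun i j h1 h2 h3 h4 => ?_
    have key : ∀ E Y ζ : ℝ, E ^ 2 ≤ B → (h * (E * ζ) + Y) * ((h * (E * ζ) + Y) / h)
        ≤ 2 * h * B * ζ ^ 2 + 2 / h * Y ^ 2 := by
      intro E Y ζ hE
      rw [← mul_div_assoc, div_le_iff₀ hh]
      have e1 : (2 * h * B * ζ ^ 2 + 2 / h * Y ^ 2) * h = 2 * h ^ 2 * (B * ζ ^ 2) + 2 * Y ^ 2 := by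
        field_simp
      rw [e1]
      have e2 : E ^ 2 * ζ ^ 2 ≤ B * ζ ^ 2 := by gcongr
      nlinarith [sq_nonneg (h * (E * ζ) - Y), sq_nonneg h, mul_le_mul_of_nonneg_left e2 (sq_nonneg h)]
    have b1 := key _ (P.tailForm (τ * h) h t (i * h) (j * h) (τ * v i j) (v₁ i j) (dX h v i j))
      (z i j) (hP t (i * h) (j * h) ⟨ht, mul_mesh_mem h1 h2, mul_mesh_mem h3 h4⟩).2.2.2
    have b2 := key _ (P.tailForm (τ * h) h t (j * h) (i * h) (τ * v i j) (v₁ i j) (dY h v i j))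
      (z' i j) (hP t (j * h) (i * h) ⟨ht, mul_mesh_mem h3 h4, mul_mesh_mem h1 h2⟩).2.2.2
    rw [← hz] at b1
    rw [← hz'] at b2
    simp only [W, dX, dY] at b1 b2 ⊢
    linarith
  have s5 := boxSum_dX_shift_sq h hv
  have s6 := boxSum_dY_shift_sq h hv
  have s7 : boxSum N (interior N (fun i j => 2 * L i j ^ 2 - K.symPart v v₂ i j ^ 2))
      = 2 * boxSum N (interior N fun i j => L i j ^ 2)
        - boxSum N (interior N fun i j => K.symPart v v₂ i j ^ 2) := by
    rw [← boxSum_mul, ← boxSum_sub]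
    congr 1
    funext i j
    simp only [interior]
    split_ifs <;> ring
  simp only [boxSum_add, boxSum_sub, boxSum_mul] at s1 s2 s3 s4 ⊢
  have s4' := mul_le_mul_of_nonneg_left s4 (show 0 ≤ 2 * (P.Z * (τ * h)) by positivity)
  have e3 : 2 * (P.Z * (τ * h)) * (2 * h * B * (boxSum N (fun i j => z i j ^ 2)
      + boxSum N (fun i j => z' i j ^ 2)) + 2 / h * boxSum N W)
      = 4 * P.Z * B * τ * h ^ 2 * (boxSum N (fun i j => z i j ^ 2)
      + boxSum N (fun i j => z' i j ^ 2)) + 4 * P.Z * τ * boxSum N W := by field_simp; ring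
  have hC : boxSum N (fun i j => P.coreTarget (τ * h) h t (i * h) (j * h)
          (τ * v i j) (v₁ i j) (dX h v i j) (dY h v i j)) = boxSum N C := rfl
  have hO : boxSum N (fun i j => outflow N h v i j) = boxSum N (outflow N h v) := rfl
  have hW : boxSum N (fun i j => W i j) = boxSum N W := rfl
  have hC' : boxSum N (fun i j => C i j) = boxSum N C := rfl
  rw [hC]
  rw [hC', hW] at s3
  rw [hW, e3] at s4'
  rw [hO, s7] at s2
  rw [s5, s6] at s3
  linarith

/-! ### Conjugation with the weight -/

/-- The factor `exp (τ φ)` at the node `(i h, j h)`. -/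
def expW (P : Params) (τ h t : ℝ) : ℤ → ℤ → ℝ := fun i j =>
  Real.exp (τ * P.ph t (i * h) (j * h))

/-- `v = exp (τ φ) w`. -/
def conj₀ (P : Params) (τ h t : ℝ) (W : ℤ → ℤ → ℝ) : ℤ → ℤ → ℝ := fun i j =>
  P.expW τ h t i j * W i j

/-- `∂ₜ v`, in terms of `w` and `∂ₜ w`. -/
def conj₁ (P : Params) (τ h t : ℝ) (W W₁ : ℤ → ℤ → ℝ) : ℤ → ℤ → ℝ := fun i j =>
  P.expW τ h t i j * (W₁ i j + τ * P.phT t (i * h) (j * h) * W i j)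

/-- `∂ₜₜ v`, in terms of `w`, `∂ₜ w` and `∂ₜₜ w`. -/
def conj₂ (P : Params) (τ h t : ℝ) (W W₁ W₂ : ℤ → ℤ → ℝ) : ℤ → ℤ → ℝ := fun i j =>
  P.expW τ h t i j * (W₂ i j + 2 * τ * P.phT t (i * h) (j * h) * W₁ i j
    + (τ * P.phTT t (i * h) (j * h) + τ ^ 2 * P.phT t (i * h) (j * h) ^ 2) * W i j)

/-- The five-point Laplacian. -/
def lap (h : ℝ) (W : ℤ → ℤ → ℝ) : ℤ → ℤ → ℝ := fun i j =>
  (W (i + 1) j - 2 * W i j + W (i - 1) j) / h ^ 2 + (W i (j + 1) - 2 * W i j + W i (j - 1)) / h ^ 2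

variable (P : Params) {τ h : ℝ} (t : ℝ)

lemma expW_pos (i j : ℤ) : 0 < P.expW τ h t i j := Real.exp_pos _

lemma expW_comm (i j : ℤ) : P.expW τ h t i j = P.expW τ h t j i := by
  unfold expW; rw [ph_comm]

lemma expW_succ (i j : ℤ) : P.expW τ h t (i + 1) j
    = P.expW τ h t i j * Real.exp (τ * h * P.ph₁ h t (i * h) (j * h)) := by
  have := P.ph_sub (h := h) t (i * h) (j * h)
  rw [expW, expW, ← Real.exp_add]
  congr 1
  push_cast
  rw [add_mul, one_mul]
  linear_combination τ * this

lemma expW_succ' (i j : ℤ) : P.expW τ h t i (j + 1)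
    = P.expW τ h t i j * Real.exp (τ * h * P.ph₁ h t (j * h) (i * h)) := by
  rw [expW_comm, expW_succ, expW_comm]

lemma exp_neg_eq (ρ h t x y : ℝ) :
    Real.exp (-(ρ * P.ph₁ h t x y)) = P.cosC ρ h t x y - ρ * P.sinC ρ h t x y := by
  rw [sinC, mul_sinhQuot, cosC, Real.cosh_sub_sinh]

lemma exp_pos_eq (ρ h t x y : ℝ) :
    Real.exp (ρ * P.ph₁ h t x y) = P.cosC ρ h t x y + ρ * P.sinC ρ h t x y := by
  rw [sinC, mul_sinhQuot, cosC, Real.cosh_add_sinh]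

/-- Conjugation of the second difference in one direction. `V, E, W` are the values of `v`, of the
exponential and of `w` at a node and at its right (`₁`) and left (`₂`) neighbours. -/
lemma lap_line (hτ : τ ≠ 0) (hh : h ≠ 0) {x y V₀ V₁ V₂ p p' E E₁ E₂ W₀ W₁ W₂ : ℝ}
    (hE₁ : E₁ = E * Real.exp (τ * h * P.ph₁ h t x y))
    (hE₂ : E = E₂ * Real.exp (τ * h * P.ph₁ h t (x - h) y))
    (h₀ : V₀ = E * W₀) (h₁ : V₁ = E₁ * W₁) (h₂ : V₂ = E₂ * W₂)
    (hp : p = (V₁ - V₀) / h) (hp' : p' = (V₀ - V₂) / h) :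
    E * ((W₁ - 2 * W₀ + W₂) / h ^ 2)
      = τ ^ 2 * (P.pot (τ * h) h t x y + P.pot (τ * h) h t (x - h) y) * V₀
        + (P.cosC (τ * h) h t x y * p - P.cosC (τ * h) h t (x - h) y * p') / h
        - τ * P.sinL (τ * h) h t x y * V₀
        - τ * (P.sinC (τ * h) h t x y * p + P.sinC (τ * h) h t (x - h) y * p') := by
  have hρ : τ * h ≠ 0 := mul_ne_zero hτ hh
  have a1 : E * W₁ = (P.cosC (τ * h) h t x y - τ * h * P.sinC (τ * h) h t x y) * (V₀ + h * p) := by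
    have e1 : V₀ + h * p = V₁ := by rw [hp]; field_simp; ring
    rw [e1, h₁, hE₁, ← exp_neg_eq, Real.exp_neg]
    field_simp
  have a2 : E * W₂ = (P.cosC (τ * h) h t (x - h) y + τ * h * P.sinC (τ * h) h t (x - h) y)
      * (V₀ - h * p') := by
    have e1 : V₀ - h * p' = V₂ := by rw [hp']; field_simp; ring
    rw [e1, h₂, hE₂, ← exp_pos_eq]
    ring
  have c1 := P.cosC_eq (ρ := τ * h) (h := h) t x y
  have c2 := P.cosC_eq (ρ := τ * h) (h := h) t (x - h) y
  have c3 := P.sinC_sub t x y hρ hh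
  have key : E * (W₁ - 2 * W₀ + W₂)
      = h ^ 2 * (τ ^ 2 * (P.pot (τ * h) h t x y + P.pot (τ * h) h t (x - h) y) * V₀)
        + h * (P.cosC (τ * h) h t x y * p - P.cosC (τ * h) h t (x - h) y * p')
        - h ^ 2 * (τ * P.sinL (τ * h) h t x y * V₀)
        - h ^ 2 * (τ * (P.sinC (τ * h) h t x y * p + P.sinC (τ * h) h t (x - h) y * p')) := by
    linear_combination a1 + a2 + 2 * h₀ + V₀ * c1 + V₀ * c2 - τ * h * V₀ * c3
  rw [← mul_div_assoc, key]
  field_simp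

/-- The conjugated equation: `exp (τ φ) □ w = L₁ v + L₂ v + remainder`. -/
lemma expW_mul_box (hτ : τ ≠ 0) (hh : h ≠ 0) (W W₁ W₂ : ℤ → ℤ → ℝ) (i j : ℤ) :
    P.expW τ h t i j * (W₂ i j - lap h W i j)
      = (P.coeffs τ h t).symPart (P.conj₀ τ h t W) (P.conj₂ τ h t W W₁ W₂) i j
        + (P.coeffs τ h t).multiplier (P.conj₀ τ h t W) (P.conj₁ τ h t W W₁) i j
        + P.remForm (τ * h) h t (i * h) (j * h) (τ * P.conj₀ τ h t W i j)
          (dX h (P.conj₀ τ h t W) i j) (dX h (P.conj₀ τ h t W) (i - 1) j)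
          (dY h (P.conj₀ τ h t W) i j) (dY h (P.conj₀ τ h t W) i (j - 1)) := by
  have cm : ∀ k : ℤ, ((k - 1 : ℤ) : ℝ) * h = k * h - h := fun k => by push_cast; ring
  have l1 := P.lap_line t hτ hh (x := i * h) (y := j * h) (W₀ := W i j) (W₁ := W (i + 1) j)
    (W₂ := W (i - 1) j) (P.expW_succ (τ := τ) t i j)
    (by have := P.expW_succ (τ := τ) (h := h) t (i - 1) j; rwa [sub_add_cancel, cm] at this)
    rfl rfl rfl (rfl : dX h (P.conj₀ τ h t W) i j = _)
    (by simp only [dX, sub_add_cancel]; rfl : dX h (P.conj₀ τ h t W) (i - 1) j = _)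
  have l2 := P.lap_line t hτ hh (x := j * h) (y := i * h) (W₀ := W i j) (W₁ := W i (j + 1))
    (W₂ := W i (j - 1)) (P.expW_succ' (τ := τ) t i j)
    (by have := P.expW_succ' (τ := τ) (h := h) t i (j - 1); rwa [sub_add_cancel, cm] at this)
    rfl rfl rfl (rfl : dY h (P.conj₀ τ h t W) i j = _)
    (by simp only [dY, sub_add_cancel]; rfl : dY h (P.conj₀ τ h t W) i (j - 1) = _)
  rw [lap, mul_sub, mul_add, l1, l2]
  simp only [Coeffs.symPart, Coeffs.multiplier, Coeffs.flux, Coeffs.advect, Coeffs.jump, coeffs,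
    remForm, cm, qu]
  generalize dX h (P.conj₀ τ h t W) i j = p
  generalize dX h (P.conj₀ τ h t W) (i - 1) j = p'
  generalize dY h (P.conj₀ τ h t W) i j = r
  generalize dY h (P.conj₀ τ h t W) i (j - 1) = r'
  simp only [conj₀, conj₁, conj₂]
  ring

/-- Differences of `∂ₜ v` are differences of `∂ₜ w` times the exponential, up to terms that the commutator
form controls. -/
lemma conj₁_sub (hh : h ≠ 0) (W W₁ : ℤ → ℤ → ℝ) (i j : ℤ) :
    P.conj₁ τ h t W W₁ (i + 1) j - P.conj₁ τ h t W W₁ i j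
      = h * (Real.exp (τ * h * P.ph₁ h t (i * h) (j * h)) * (P.expW τ h t i j * dX h W₁ i j))
        + P.tailForm (τ * h) h t (i * h) (j * h) (τ * P.conj₀ τ h t W i j)
            (P.conj₁ τ h t W W₁ i j) (dX h (P.conj₀ τ h t W) i j) := by
  have cp : ∀ k : ℤ, ((k + 1 : ℤ) : ℝ) * h = k * h + h := fun k => by push_cast; ring
  have h1 : h * dX h W₁ i j = W₁ (i + 1) j - W₁ i j := by simp only [dX]; field_simp
  have h2 : h * dX h (P.conj₀ τ h t W) i j = P.conj₀ τ h t W (i + 1) j - P.conj₀ τ h t W i j := by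
    simp only [dX]; field_simp
  have h3 := P.phT_sub (h := h) t (i * h) (j * h)
  rw [show h * (Real.exp (τ * h * P.ph₁ h t (i * h) (j * h)) * (P.expW τ h t i j * dX h W₁ i j))
    = Real.exp (τ * h * P.ph₁ h t (i * h) (j * h)) * P.expW τ h t i j * (h * dX h W₁ i j) by ring,
    h1, tailForm]
  rw [show τ * h * P.phT t (↑i * h + h) (↑j * h) * dX h (P.conj₀ τ h t W) i j
    = τ * P.phT t (↑i * h + h) (↑j * h) * (h * dX h (P.conj₀ τ h t W) i j) by ring, h2]
  simp only [conj₁, conj₀, cp, expW_succ]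
  linear_combination (τ * P.expW τ h t i j * W i j) * h3

lemma conj₁_sub' (hh : h ≠ 0) (W W₁ : ℤ → ℤ → ℝ) (i j : ℤ) :
    P.conj₁ τ h t W W₁ i (j + 1) - P.conj₁ τ h t W W₁ i j
      = h * (Real.exp (τ * h * P.ph₁ h t (j * h) (i * h)) * (P.expW τ h t i j * dY h W₁ i j))
        + P.tailForm (τ * h) h t (j * h) (i * h) (τ * P.conj₀ τ h t W i j)
            (P.conj₁ τ h t W W₁ i j) (dY h (P.conj₀ τ h t W) i j) := by
  have s0 : P.conj₀ τ h t (swap W) = swap (P.conj₀ τ h t W) := by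
    funext i j; simp only [conj₀, swap]; rw [expW_comm]
  have s1 : P.conj₁ τ h t (swap W) (swap W₁) = swap (P.conj₁ τ h t W W₁) := by
    funext i j; simp only [conj₁, swap]; rw [expW_comm, phT_comm]
  have := P.conj₁_sub (τ := τ) t hh (swap W) (swap W₁) j i
  rw [s0, s1, expW_comm] at this
  exact this

/-- `gradForm` recovers the weighted difference quotient of `w` from `v`. -/
lemma expW_mul_dX (hh : h ≠ 0) (W : ℤ → ℤ → ℝ) (i j : ℤ) :
    P.expW τ h t i j * dX h W i j = P.gradForm (τ * h) h t (i * h) (j * h)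
      (τ * P.conj₀ τ h t W i j) (dX h (P.conj₀ τ h t W) i j) := by
  have h1 := mul_exp_shc (-(τ * h * P.ph₁ h t (i * h) (j * h)))
  have h2 : Real.exp (-(τ * h * P.ph₁ h t (i * h) (j * h)))
      * Real.exp (τ * h * P.ph₁ h t (i * h) (j * h)) = 1 := by
    rw [← Real.exp_add]; simp
  apply mul_left_cancel₀ hh
  have h3 : h * dX h W i j = W (i + 1) j - W i j := by simp only [dX]; field_simp
  have h4 : h * dX h (P.conj₀ τ h t W) i j = P.conj₀ τ h t W (i + 1) j - P.conj₀ τ h t W i j := by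
    simp only [dX]; field_simp
  rw [mul_left_comm, h3, gradForm]
  simp only [conj₀, expW_succ] at h4 ⊢
  linear_combination (-(Real.exp (-(τ * h * P.ph₁ h t (i * h) (j * h))))) * h4
    - P.expW τ h t i j * W (i + 1) j * h2 - (P.expW τ h t i j * W i j) * h1

lemma expW_mul_dY (hh : h ≠ 0) (W : ℤ → ℤ → ℝ) (i j : ℤ) :
    P.expW τ h t i j * dY h W i j = P.gradForm (τ * h) h t (j * h) (i * h)
      (τ * P.conj₀ τ h t W i j) (dY h (P.conj₀ τ h t W) i j) := by
  have s0 : P.conj₀ τ h t (swap W) = swap (P.conj₀ τ h t W) := by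
    funext i j; simp only [conj₀, swap]; rw [expW_comm]
  have := P.expW_mul_dX (τ := τ) t hh (swap W) j i
  rw [s0, expW_comm] at this
  exact this

end Params

/-! ### From grid functions to arrays on `ℤ²` -/

/-- The extension by zero of the interior values of a grid function. -/
def ext (N : ℕ) (u : GridFn) : ℤ → ℤ → ℝ := interior N fun i j => u i.toNat j.toNat

/-- The grid function vanishes on the sides of the square. -/
def BoundaryZero (N : ℕ) (u : GridFn) : Prop :=
  ∀ l ∈ Finset.Icc 0 (N + 1), u 0 l = 0 ∧ u (N + 1) l = 0 ∧ u l 0 = 0 ∧ u l (N + 1) = 0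

lemma interiorSupported_ext (N : ℕ) (u : GridFn) : InteriorSupported N (ext N u) := by
  intro i j hij
  rw [ext, interior, if_neg (by omega)]

lemma ext_apply {N : ℕ} {u : GridFn} {i j : ℕ} (hi : 1 ≤ i ∧ i ≤ N) (hj : 1 ≤ j ∧ j ≤ N) :
    ext N u i j = u i j := by
  rw [ext, interior, if_pos (by omega)]
  simp

lemma ext_apply_of_boundaryZero {N : ℕ} {u : GridFn} (hu : BoundaryZero N u) {i j : ℕ}
    (hi : i ≤ N + 1) (hj : j ≤ N + 1) : ext N u i j = u i j := by
  by_cases h : (1 ≤ i ∧ i ≤ N) ∧ (1 ≤ j ∧ j ≤ N)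
  · exact ext_apply h.1 h.2
  · rw [interiorSupported_ext N u i j (by omega)]
    have h1 := hu i (by simp; omega)
    have h2 := hu j (by simp; omega)
    have : i = 0 ∨ i = N + 1 ∨ j = 0 ∨ j = N + 1 := by omega
    rcases this with h | h | h | h
    · rw [h]; exact h2.1.symm
    · rw [h]; exact h2.2.1.symm
    · rw [h]; exact h1.2.2.1.symm
    · rw [h]; exact h1.2.2.2.symm

/-- A box sum reduces to the sum over a smaller rectangle off which the summand vanishes. -/
lemma boxSum_eq_sum {N : ℕ} {F : ℤ → ℤ → ℝ} {f : ℕ → ℕ → ℝ} {A B : Finset ℕ}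
    (hA : A ⊆ Finset.range (N + 2)) (hB : B ⊆ Finset.range (N + 2))
    (hf : ∀ i ∈ A, ∀ j ∈ B, F i j = f i j)
    (h0 : ∀ i j : ℕ, i < N + 2 → j < N + 2 → (i ∉ A ∨ j ∉ B) → F i j = 0) :
    boxSum N F = ∑ i ∈ A, ∑ j ∈ B, f i j := by
  unfold boxSum
  rw [← Finset.sum_subset hA]
  · refine Finset.sum_congr rfl fun i hi => ?_
    rw [← Finset.sum_subset hB]
    · exact Finset.sum_congr rfl fun j hj => hf i hi j hj
    · intro j hj hj'
      exact h0 i j (Finset.mem_range.1 (hA hi)) (Finset.mem_range.1 hj) (Or.inr hj')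
  · intro i hi hi'
    exact Finset.sum_eq_zero fun j hj =>
      h0 i j (Finset.mem_range.1 hi) (Finset.mem_range.1 hj) (Or.inl hi')

lemma intOmega_eq {N : ℕ} {F : ℤ → ℤ → ℝ} {f : GridFn}
    (hf : ∀ i j : ℕ, 1 ≤ i ∧ i ≤ N → 1 ≤ j ∧ j ≤ N → F i j = f i j)
    (h0 : InteriorSupported N F) : intOmega N f = mesh N ^ 2 * boxSum N F := by
  rw [intOmega, boxSum_eq_sum (A := Finset.Icc 1 N) (B := Finset.Icc 1 N) (f := f)]
  · intro i hi; simp at hi ⊢; omega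
  · intro i hi; simp at hi ⊢; omega
  · intro i hi j hj
    exact hf i j (by simpa using hi) (by simpa using hj)
  · intro i j hi hj h
    simp only [Finset.mem_Icc] at h
    exact h0 i j (by omega)

lemma intOmegaMinus_zero_eq {N : ℕ} {F : ℤ → ℤ → ℝ} {f : GridFn}
    (hf : ∀ i j : ℕ, i ≤ N → 1 ≤ j ∧ j ≤ N → F i j = f i j)
    (h0 : ∀ i j : ℕ, (i = N + 1 ∨ j = 0 ∨ j = N + 1) → F i j = 0) :
    intOmegaMinus N 0 f = mesh N ^ 2 * boxSum N F := by
  simp only [intOmegaMinus]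
  rw [boxSum_eq_sum (A := Finset.Icc 0 N) (B := Finset.Icc 1 N) (f := f)]
  · intro i hi; simp at hi ⊢; omega
  · intro i hi; simp at hi ⊢; omega
  · intro i hi j hj
    exact hf i j (by simpa using hi) (by simpa using hj)
  · intro i j hi hj h
    simp only [Finset.mem_Icc] at h
    exact h0 i j (by omega)

lemma intOmegaMinus_one_eq {N : ℕ} {F : ℤ → ℤ → ℝ} {f : GridFn}
    (hf : ∀ i j : ℕ, 1 ≤ i ∧ i ≤ N → j ≤ N → F i j = f i j)
    (h0 : ∀ i j : ℕ, (i = 0 ∨ i = N + 1 ∨ j = N + 1) → F i j = 0) :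
    intOmegaMinus N 1 f = mesh N ^ 2 * boxSum N F := by
  simp only [intOmegaMinus]
  rw [boxSum_eq_sum (A := Finset.Icc 1 N) (B := Finset.Icc 0 N) (f := f)]
  · intro i hi; simp at hi ⊢; omega
  · intro i hi; simp at hi ⊢; omega
  · intro i hi j hj
    exact hf i j (by simpa using hi) (by simpa using hj)
  · intro i j hi hj h
    simp only [Finset.mem_Icc] at h
    exact h0 i j (by omega)

lemma dX_ext {N : ℕ} {u : GridFn} (hu : BoundaryZero N u) {i j : ℕ} (hi : i ≤ N)
    (hj : j ≤ N + 1) : dX (mesh N) (ext N u) i j = dPlus N 0 u i j := by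
  have h1 := ext_apply_of_boundaryZero hu (i := i + 1) (j := j) (by omega) hj
  push_cast at h1
  simp only [dX, dPlus, h1, ext_apply_of_boundaryZero hu (i := i) (j := j) (by omega) hj]

lemma dY_ext {N : ℕ} {u : GridFn} (hu : BoundaryZero N u) {i j : ℕ} (hi : i ≤ N + 1)
    (hj : j ≤ N) : dY (mesh N) (ext N u) i j = dPlus N 1 u i j := by
  have h1 := ext_apply_of_boundaryZero hu (i := i) (j := j + 1) hi (by omega)
  push_cast at h1
  simp only [dY, dPlus, h1, ext_apply_of_boundaryZero hu (i := i) (j := j) hi (by omega)]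

lemma dX_eq_zero {N : ℕ} {h : ℝ} {v : ℤ → ℤ → ℝ} (hv : InteriorSupported N v) {i j : ℕ}
    (hij : i = N + 1 ∨ j = 0 ∨ j = N + 1) : dX h v i j = 0 := by
  rw [dX, hv _ _ (by omega), hv _ _ (by omega), sub_zero, zero_div]

lemma dY_eq_zero {N : ℕ} {h : ℝ} {v : ℤ → ℤ → ℝ} (hv : InteriorSupported N v) {i j : ℕ}
    (hij : i = 0 ∨ i = N + 1 ∨ j = N + 1) : dY h v i j = 0 := by
  rw [dY, hv _ _ (by omega), hv _ _ (by omega), sub_zero, zero_div]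

lemma lap_ext {N : ℕ} {u : GridFn} (hu : BoundaryZero N u) {i j : ℕ} (hi : 1 ≤ i ∧ i ≤ N)
    (hj : 1 ≤ j ∧ j ≤ N) :
    Params.lap (mesh N) (ext N u) i j = ∑ k : Fin 2, secondDiff N k u i j := by
  have h1 := ext_apply_of_boundaryZero hu (i := i + 1) (j := j) (by omega) (by omega)
  have h2 := ext_apply_of_boundaryZero hu (i := i - 1) (j := j) (by omega) (by omega)
  have h3 := ext_apply_of_boundaryZero hu (i := i) (j := j + 1) (by omega) (by omega)
  have h4 := ext_apply_of_boundaryZero hu (i := i) (j := j - 1) (by omega) (by omega)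
  have h5 := ext_apply_of_boundaryZero hu (i := i) (j := j) (by omega) (by omega)
  push_cast [Nat.cast_sub hi.1, Nat.cast_sub hj.1] at h1 h2 h3 h4
  simp only [Params.lap, Fin.sum_univ_two, secondDiff, h1, h2, h3, h4, h5]

lemma weight_eq (P : Params) (τ t : ℝ) (N : ℕ) (i j : ℕ) :
    weight P.a P.β P.c₀ P.μ τ N t i j = P.expW τ (mesh N) t i j ^ 2 := by
  rw [weight, phiH, phi, Params.expW, ← Real.exp_nat_mul, Params.ph, Params.amp, Params.e, Params.e,
    ← Real.exp_add, ← Real.exp_add, psi]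
  push_cast
  congr 1
  rw [← mul_assoc]
  congr 2
  ring

/-- The integrand of the left-hand side of the Carleman estimate at a fixed time, for the values
`u` of the function and `u₁` of its time derivative. -/
def lhsDensity (N : ℕ) (τ : ℝ) (ρ u u₁ : GridFn) : ℝ :=
  τ * intOmega N (fun i j => ρ i j * |u₁ i j| ^ 2)
  + τ * ∑ k : Fin 2, intOmegaMinus N k (fun i j => ρ i j * |dPlus N k u i j| ^ 2)
  + τ ^ 3 * intOmega N (fun i j => ρ i j * |u i j| ^ 2)

/-- The integrand of the right-hand side of the Carleman estimate at a fixed time, with `f` the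
value of `□ w`. -/
def rhsDensity (N : ℕ) (τ : ℝ) (ρ u u₁ f : GridFn) : ℝ :=
  intOmega N (fun i j => ρ i j * |f i j| ^ 2)
  + τ * ∑ k : Fin 2, intGammaPlus N k (fun i j => ρ i j * |dMinus N k u i j| ^ 2)
  + τ * mesh N ^ 2 * ∑ k : Fin 2, intOmegaMinus N k (fun i j => ρ i j * |dPlus N k u₁ i j| ^ 2)

namespace Params

lemma interiorSupported_conj₀ (P : Params) (τ h t : ℝ) {N : ℕ} {W : ℤ → ℤ → ℝ}
    (hW : InteriorSupported N W) : InteriorSupported N (P.conj₀ τ h t W) := fun i j hij => by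
  simp only [conj₀, hW i j hij, mul_zero]

lemma interiorSupported_conj₁ (P : Params) (τ h t : ℝ) {N : ℕ} {W W₁ : ℤ → ℤ → ℝ}
    (hW : InteriorSupported N W) (hW₁ : InteriorSupported N W₁) :
    InteriorSupported N (P.conj₁ τ h t W W₁) := fun i j hij => by
  simp only [conj₁, hW i j hij, hW₁ i j hij, mul_zero, add_zero]

lemma interiorSupported_conj₂ (P : Params) (τ h t : ℝ) {N : ℕ} {W W₁ W₂ : ℤ → ℤ → ℝ}
    (hW : InteriorSupported N W) (hW₁ : InteriorSupported N W₁)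
    (hW₂ : InteriorSupported N W₂) :
    InteriorSupported N (P.conj₂ τ h t W W₁ W₂) := fun i j hij => by
  simp only [conj₂, hW i j hij, hW₁ i j hij, hW₂ i j hij, mul_zero, add_zero]

lemma ph_mono (P : Params) (ha : 0 < P.a) (hμ : 0 ≤ P.μ) (t : ℝ) {x x' : ℝ} (y : ℝ) (hx : 0 ≤ x)
    (hxx : x ≤ x') : P.ph t x y ≤ P.ph t x' y := by
  have h1 : P.e x ≤ P.e x' := by
    unfold e
    gcongr
  have h2 := P.e_pos y
  have h3 : 0 < P.amp t := Real.exp_pos _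
  unfold ph
  gcongr

/-- The outward differences of `v = exp (τ φ) w` are controlled by the boundary term: `w` vanishes
on the boundary, and `φ` is larger there than at the neighbouring interior node. -/
lemma boxSum_outflow_le (P : Params) (ha : 0 < P.a) (hμ : 0 ≤ P.μ) {τ : ℝ} (hτ : 0 ≤ τ) (t : ℝ)
    {N : ℕ} {u : GridFn} (hu : BoundaryZero N u) :
    mesh N * boxSum N (outflow N (mesh N) (P.conj₀ τ (mesh N) t (ext N u)))
      ≤ ∑ k : Fin 2, intGammaPlus N k
          (fun i j => weight P.a P.β P.c₀ P.μ τ N t i j * |dMinus N k u i j| ^ 2) := by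
  have hh := mesh_pos N
  set v := P.conj₀ τ (mesh N) t (ext N u) with hv'
  have hv : InteriorSupported N v := P.interiorSupported_conj₀ τ _ t (interiorSupported_ext N u)
  have hexp : ∀ j : ℤ, P.expW τ (mesh N) t N j ≤ P.expW τ (mesh N) t ((N : ℤ) + 1) j := by
    intro j
    unfold expW
    have := P.ph_mono ha hμ t (x := ((N : ℤ) : ℝ) * mesh N) (x' := (((N : ℤ) + 1 : ℤ) : ℝ) * mesh N)
      (j * mesh N) (by positivity) (by push_cast; nlinarith)
    gcongr
  have hexp' : ∀ j : ℤ, P.expW τ (mesh N) t j N ≤ P.expW τ (mesh N) t j ((N : ℤ) + 1) := by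
    intro j
    rw [expW_comm, P.expW_comm t j]
    exact hexp j
  have b1 : ∀ j : ℕ, 1 ≤ j ∧ j ≤ N → dX (mesh N) v N j ^ 2
      ≤ weight P.a P.β P.c₀ P.μ τ N t (N + 1) j * |dMinus N 0 u (N + 1) j| ^ 2 := by
    intro j hj
    have e1 : v ((N : ℤ) + 1) j = 0 := hv _ _ (by omega)
    have e2 : u (N + 1) j = 0 := (hu j (by simp; omega)).2.1
    have e3 : v N j = P.expW τ (mesh N) t N j * u N j := by
      rw [hv', conj₀, ext_apply_of_boundaryZero hu (by omega) (by omega)]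
    rw [weight_eq, sq_abs]
    simp only [dX, dMinus, e1, e2, e3, add_tsub_cancel_right, zero_sub]
    push_cast
    rw [neg_div, neg_div, neg_sq, neg_sq, mul_div_assoc, mul_pow]
    have := hexp j
    have := P.expW_pos (τ := τ) (h := mesh N) t N j
    gcongr
  have b2 : ∀ j : ℕ, 1 ≤ j ∧ j ≤ N → dY (mesh N) v j N ^ 2
      ≤ weight P.a P.β P.c₀ P.μ τ N t j (N + 1) * |dMinus N 1 u j (N + 1)| ^ 2 := by
    intro j hj
    have e1 : v j ((N : ℤ) + 1) = 0 := hv _ _ (by omega)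
    have e2 : u j (N + 1) = 0 := (hu j (by simp; omega)).2.2.2
    have e3 : v j N = P.expW τ (mesh N) t j N * u j N := by
      rw [hv', conj₀, ext_apply_of_boundaryZero hu (by omega) (by omega)]
    rw [weight_eq, sq_abs]
    simp only [dY, dMinus, e1, e2, e3, add_tsub_cancel_right, zero_sub]
    push_cast
    rw [neg_div, neg_div, neg_sq, neg_sq, mul_div_assoc, mul_pow]
    have := hexp' j
    have := P.expW_pos (τ := τ) (h := mesh N) t j N
    gcongr
  have s1 : boxSum N (fun i j => if i = (N : ℤ) + 1 then dX (mesh N) v (i - 1) j ^ 2 else 0)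
      = ∑ i ∈ {N + 1}, ∑ j ∈ Finset.Icc 1 N, dX (mesh N) v N j ^ 2 := by
    refine boxSum_eq_sum (f := fun _ j => dX (mesh N) v N j ^ 2) ?_ ?_ ?_ ?_
    · intro i hi; simp at hi ⊢; omega
    · intro i hi; simp at hi ⊢; omega
    · intro i hi j hj
      rw [Finset.mem_singleton.1 hi]
      simp
    · intro i j hi hj h
      split_ifs with h1
      · have h2 : (i : ℤ) - 1 = (N : ℕ) := by omega
        rw [h2, dX_eq_zero hv, zero_pow two_ne_zero]
        simp only [Finset.mem_singleton, Finset.mem_Icc] at h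
        omega
      · rfl
  have s2 : boxSum N (fun i j => if j = (N : ℤ) + 1 then dY (mesh N) v i (j - 1) ^ 2 else 0)
      = ∑ i ∈ Finset.Icc 1 N, ∑ j ∈ {N + 1}, dY (mesh N) v i N ^ 2 := by
    refine boxSum_eq_sum (f := fun i _ => dY (mesh N) v i N ^ 2) ?_ ?_ ?_ ?_
    · intro i hi; simp at hi ⊢; omega
    · intro i hi; simp at hi ⊢; omega
    · intro i hi j hj
      rw [Finset.mem_singleton.1 hj]
      simp
    · intro i j hi hj h
      split_ifs with h1
      · have h2 : (j : ℤ) - 1 = (N : ℕ) := by omega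
        rw [h2, dY_eq_zero hv, zero_pow two_ne_zero]
        simp only [Finset.mem_singleton, Finset.mem_Icc] at h
        omega
      · rfl
  unfold outflow
  rw [boxSum_add, s1, s2, Finset.sum_singleton, Fin.sum_univ_two, mul_add]
  simp only [Finset.sum_singleton, intGammaPlus]
  refine add_le_add ?_ ?_
  · refine mul_le_mul_of_nonneg_left (Finset.sum_le_sum fun j hj => b1 j (by simpa using hj)) hh.le
  · refine mul_le_mul_of_nonneg_left (Finset.sum_le_sum fun j hj => b2 j (by simpa using hj)) hh.le

/-- The differential inequality in terms of `w`: the sides of the Carleman estimate at a fixed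
time, together with the terms needed for the estimate at time zero. -/
lemma energyDeriv_add_lhsDensity_le (P : Params) {T κ B τ t : ℝ} {N : ℕ} (ha : 0 < P.a)
    (hμ : 0 ≤ P.μ) (hZ : 0 ≤ P.Z) (hτ : 0 < τ)
    (hP : P.Coercive T κ B τ⁻¹ (τ * mesh N) (mesh N)) (ht : t ∈ Icc (-T) T) (hB : 0 < B)
    {u u₁ u₂ f : GridFn} (hu : BoundaryZero N u) (hu₁ : BoundaryZero N u₁)
    (hf : ∀ i j, f i j = u₂ i j - ∑ k : Fin 2, secondDiff N k u i j)
    {v v₁ v₂ : ℤ → ℤ → ℝ} (hv : v = P.conj₀ τ (mesh N) t (ext N u))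
    (hv₁ : v₁ = P.conj₁ τ (mesh N) t (ext N u) (ext N u₁))
    (hv₂ : v₂ = P.conj₂ τ (mesh N) t (ext N u) (ext N u₁) (ext N u₂)) :
    mesh N ^ 2 * boxSum N ((P.coeffs τ (mesh N) t).energyDeriv v v₁ v₂)
      + κ * lhsDensity N τ (weight P.a P.β P.c₀ P.μ τ N t) u u₁
      + mesh N ^ 2 * (κ * τ * boxSum N (fun i j => v₁ i j ^ 2
          + |P.cosT (τ * mesh N) (mesh N) t (i * mesh N) (j * mesh N)| * dX (mesh N) v i j ^ 2
          + |P.cosT (τ * mesh N) (mesh N) t (j * mesh N) (i * mesh N)| * dY (mesh N) v i j ^ 2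
          + |P.quT (τ * mesh N) (mesh N) t (i * mesh N) (j * mesh N)| * (τ * v i j) ^ 2)
        + boxSum N (interior N fun i j => (P.coeffs τ (mesh N) t).symPart v v₂ i j ^ 2))
    ≤ (2 + B + 4 * P.Z * B) * rhsDensity N τ (weight P.a P.β P.c₀ P.μ τ N t) u u₁ f := by
  have hh := mesh_pos N
  have i0 := interiorSupported_ext N u
  have i1 := interiorSupported_ext N u₁
  have i2 := interiorSupported_ext N u₂
  have key := P.boxSum_energyDeriv_add_le hZ hτ hP ht hB
    (P.interiorSupported_conj₀ τ (mesh N) t i0) (P.interiorSupported_conj₁ τ (mesh N) t i0 i1)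
    (P.interiorSupported_conj₂ τ (mesh N) t i0 i1 i2)
    (P.expW_mul_box t hτ.ne' hh.ne' (ext N u) (ext N u₁) (ext N u₂))
    (P.conj₁_sub t hh.ne' (ext N u) (ext N u₁)) (P.conj₁_sub' t hh.ne' (ext N u) (ext N u₁))
  rw [← hv, ← hv₁, ← hv₂] at key
  have r1 : intOmega N (fun i j => weight P.a P.β P.c₀ P.μ τ N t i j * |f i j| ^ 2)
      = mesh N ^ 2 * boxSum N (interior N fun i j => (P.expW τ (mesh N) t i j
        * (ext N u₂ i j - lap (mesh N) (ext N u) i j)) ^ 2) := by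
    refine intOmega_eq (fun i j hi hj => ?_) (fun i j hij => ?_)
    · rw [interior, if_pos (by omega), weight_eq, sq_abs, mul_pow, hf, lap_ext hu hi hj,
        ext_apply hi hj]
    · rw [interior, if_neg (by omega)]
  have r2 := P.boxSum_outflow_le ha hμ hτ.le t hu
  rw [← hv] at r2
  have dPl : ∀ g : GridFn, BoundaryZero N g → ∑ k : Fin 2, intOmegaMinus N k
        (fun i j => weight P.a P.β P.c₀ P.μ τ N t i j * |dPlus N k g i j| ^ 2)
      = mesh N ^ 2 * boxSum N (fun i j => (P.expW τ (mesh N) t i j * dX (mesh N) (ext N g) i j) ^ 2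
        + (P.expW τ (mesh N) t i j * dY (mesh N) (ext N g) i j) ^ 2) := by
    intro g hg
    have ig := interiorSupported_ext N g
    rw [boxSum_add, mul_add, Fin.sum_univ_two]
    congr 1
    · refine intOmegaMinus_zero_eq (fun i j hi hj => ?_) (fun i j hij => ?_)
      · rw [weight_eq, sq_abs, mul_pow, dX_ext hg hi (by omega)]
      · rw [dX_eq_zero ig hij]; ring
    · refine intOmegaMinus_one_eq (fun i j hi hj => ?_) (fun i j hij => ?_)
      · rw [weight_eq, sq_abs, mul_pow, dY_ext hg (by omega) hj]
      · rw [dY_eq_zero ig hij]; ring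
  have om : ∀ g : GridFn, intOmega N (fun i j => weight P.a P.β P.c₀ P.μ τ N t i j * |g i j| ^ 2)
      = mesh N ^ 2 * boxSum N (fun i j => (P.expW τ (mesh N) t i j * ext N g i j) ^ 2) := by
    intro g
    refine intOmega_eq (fun i j hi hj => ?_) (fun i j hij => ?_)
    · rw [weight_eq, sq_abs, mul_pow, ext_apply hi hj]
    · rw [interiorSupported_ext N g i j hij]; ring
  have hcore : (fun i j : ℤ => P.coreTarget (τ * mesh N) (mesh N) t (i * mesh N) (j * mesh N)
        (τ * v i j) (v₁ i j) (dX (mesh N) v i j) (dY (mesh N) v i j))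
      = fun i j => ((P.expW τ (mesh N) t i j * ext N u₁ i j) ^ 2
          + ((P.expW τ (mesh N) t i j * dX (mesh N) (ext N u) i j) ^ 2
            + (P.expW τ (mesh N) t i j * dY (mesh N) (ext N u) i j) ^ 2)
          + τ ^ 2 * (P.expW τ (mesh N) t i j * ext N u i j) ^ 2)
        + (v₁ i j ^ 2
          + |P.cosT (τ * mesh N) (mesh N) t (i * mesh N) (j * mesh N)| * dX (mesh N) v i j ^ 2
          + |P.cosT (τ * mesh N) (mesh N) t (j * mesh N) (i * mesh N)| * dY (mesh N) v i j ^ 2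
          + |P.quT (τ * mesh N) (mesh N) t (i * mesh N) (j * mesh N)| * (τ * v i j) ^ 2) := by
    funext i j
    rw [P.expW_mul_dX t hh.ne', P.expW_mul_dY t hh.ne', ← hv, coreTarget]
    have e1 : v₁ i j - P.phT t (i * mesh N) (j * mesh N) * (τ * v i j)
        = P.expW τ (mesh N) t i j * ext N u₁ i j := by
      rw [hv, hv₁, conj₀, conj₁]; ring
    have e2 : v i j = P.expW τ (mesh N) t i j * ext N u i j := by rw [hv]; rfl
    rw [e1, ← e2]
    ring
  rw [hcore, boxSum_add, boxSum_add, boxSum_add, boxSum_mul] at key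
  have key' := mul_le_mul_of_nonneg_left key (sq_nonneg (mesh N))
  rw [lhsDensity, rhsDensity, om, om, dPl u hu, dPl u₁ hu₁, r1]
  set G := ∑ k : Fin 2, intGammaPlus N k
          (fun i j => weight P.a P.β P.c₀ P.μ τ N t i j * |dMinus N k u i j| ^ 2) with hG
  set S₁ := boxSum N (interior N fun i j => (P.expW τ (mesh N) t i j
        * (ext N u₂ i j - lap (mesh N) (ext N u) i j)) ^ 2)
  set S₂ := boxSum N (fun i j => (P.expW τ (mesh N) t i j * dX (mesh N) (ext N u₁) i j) ^ 2
        + (P.expW τ (mesh N) t i j * dY (mesh N) (ext N u₁) i j) ^ 2)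
  have p1 : 0 ≤ S₁ := boxSum_nonneg N fun i j => by unfold interior; positivity
  have p2 : 0 ≤ S₂ := boxSum_nonneg N fun i j => by positivity
  have p3 : 0 ≤ boxSum N (outflow N (mesh N) v) :=
    boxSum_nonneg N fun i j => by unfold outflow; positivity
  have p4 : 0 ≤ G := le_trans (by positivity) r2
  have q1 : mesh N ^ 2 * (B * τ / mesh N * boxSum N (outflow N (mesh N) v)) ≤ B * (τ * G) := by
    have e : mesh N ^ 2 * (B * τ / mesh N * boxSum N (outflow N (mesh N) v))
        = B * τ * (mesh N * boxSum N (outflow N (mesh N) v)) := by field_simp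
    rw [e, ← mul_assoc B]
    exact mul_le_mul_of_nonneg_left r2 (by positivity)
  have q2 : 0 ≤ (B + 4 * P.Z * B) * (mesh N ^ 2 * S₁) := by positivity
  have q3 : 0 ≤ (2 + 4 * P.Z * B) * (τ * G) := by positivity
  have q4 : 0 ≤ (2 + B) * (τ * mesh N ^ 2 * (mesh N ^ 2 * S₂)) := by positivity
  nlinarith [key', q1, q2, q3, q4]

end Params

/-! ### Absolutely continuous primitives -/

/-- `f` is absolutely continuous on `[a, b]` and `f'` is its derivative almost everywhere. -/
def IsPrimitive (a b : ℝ) (f f' : ℝ → ℝ) : Prop :=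
  AbsolutelyContinuousOnInterval f a b ∧ ∀ᵐ t, t ∈ Ioo a b → HasDerivAt f (f' t) t

namespace IsPrimitive

variable {a b : ℝ} {f f' g g' : ℝ → ℝ}

lemma congr (hf : IsPrimitive a b f f') (h : ∀ t, f t = g t) (h' : ∀ t, f' t = g' t) :
    IsPrimitive a b g g' := by
  rwa [funext h, funext h'] at hf

lemma of_hasDerivAt (h : ∀ t, HasDerivAt f (f' t) t) (hc : Continuous f') :
    IsPrimitive a b f f' := by
  refine ⟨ContDiffOn.absolutelyContinuousOnInterval (ContDiff.contDiffOn ?_),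
    .of_forall fun t _ => h t⟩
  rw [contDiff_one_iff_deriv]
  refine ⟨fun t => (h t).differentiableAt, ?_⟩
  rwa [show deriv f = f' from funext fun t => (h t).deriv]

lemma const (c : ℝ) : IsPrimitive a b (fun _ => c) (fun _ => 0) :=
  of_hasDerivAt (fun t => hasDerivAt_const t c) continuous_const

lemma add (hf : IsPrimitive a b f f') (hg : IsPrimitive a b g g') :
    IsPrimitive a b (fun t => f t + g t) (fun t => f' t + g' t) := by
  refine ⟨hf.1.fun_add hg.1, ?_⟩
  filter_upwards [hf.2, hg.2] with t h₁ h₂ ht using (h₁ ht).fun_add (h₂ ht)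

lemma sub (hf : IsPrimitive a b f f') (hg : IsPrimitive a b g g') :
    IsPrimitive a b (fun t => f t - g t) (fun t => f' t - g' t) := by
  refine ⟨hf.1.fun_sub hg.1, ?_⟩
  filter_upwards [hf.2, hg.2] with t h₁ h₂ ht using (h₁ ht).fun_sub (h₂ ht)

lemma mul (hf : IsPrimitive a b f f') (hg : IsPrimitive a b g g') :
    IsPrimitive a b (fun t => f t * g t) (fun t => f' t * g t + f t * g' t) := by
  refine ⟨hf.1.fun_mul hg.1, ?_⟩
  filter_upwards [hf.2, hg.2] with t h₁ h₂ ht using (h₁ ht).fun_mul (h₂ ht)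

lemma const_mul (c : ℝ) (hf : IsPrimitive a b f f') :
    IsPrimitive a b (fun t => c * f t) (fun t => c * f' t) := by
  refine ⟨hf.1.const_mul c, ?_⟩
  filter_upwards [hf.2] with t h ht using (h ht).const_mul c

lemma sum {ι : Type*} (s : Finset ι) {F F' : ι → ℝ → ℝ} (h : ∀ i, IsPrimitive a b (F i) (F' i)) :
    IsPrimitive a b (fun t => ∑ i ∈ s, F i t) (fun t => ∑ i ∈ s, F' i t) := by
  classical
  induction s using Finset.induction_on with
  | empty => simpa using const 0
  | insert i s hi ih => simpa [Finset.sum_insert hi] using (h i).add ih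

lemma mono (hf : IsPrimitive a b f f') {c d : ℝ} (hac : a ≤ c) (hcd : c ≤ d) (hdb : d ≤ b) :
    IsPrimitive c d f f' := by
  refine ⟨hf.1.mono ?_, ?_⟩
  · rw [uIcc_of_le hcd, uIcc_of_le (by linarith)]
    exact Icc_subset_Icc hac hdb
  · filter_upwards [hf.2] with t h ht using h (Ioo_subset_Ioo hac hdb ht)

lemma ae_deriv_eq (hf : IsPrimitive a b f f') (hab : a ≤ b) :
    ∀ᵐ t, t ∈ uIoc a b → deriv f t = f' t := by
  have hb : ∀ᵐ t : ℝ, t ≠ b := Measure.ae_ne volume b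
  filter_upwards [hf.2, hb] with t h hne ht
  rw [uIoc_of_le hab] at ht
  exact (h ⟨ht.1, lt_of_le_of_ne ht.2 hne⟩).deriv

lemma intervalIntegrable (hf : IsPrimitive a b f f') (hab : a ≤ b) :
    IntervalIntegrable f' volume a b :=
  hf.1.intervalIntegrable_deriv.congr_ae
    ((ae_restrict_iff' measurableSet_uIoc).2 (hf.ae_deriv_eq hab))

lemma integral_eq_sub (hf : IsPrimitive a b f f') (hab : a ≤ b) :
    ∫ t in a..b, f' t = f b - f a := by
  rw [← hf.1.integral_deriv_eq_sub]
  refine intervalIntegral.integral_congr_ae ?_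
  filter_upwards [hf.ae_deriv_eq hab] with t h ht using (h ht).symm

end IsPrimitive

namespace Params

/-! ### Time derivatives of the coefficients and of the energies -/

section TimeDerivatives

variable (P : Params) (ρ h t x y : ℝ)

lemma hasDerivAt_rate : HasDerivAt P.rate (-2 * P.μ * P.β) t := by
  refine ((hasDerivAt_id t).const_mul (-2 * P.μ * P.β)).congr_deriv ?_
  ring

lemma hasDerivAt_amp : HasDerivAt P.amp (P.rate t * P.amp t) t := by
  have h1 : HasDerivAt (fun t => P.μ * (P.c₀ - P.β * t ^ 2)) (P.rate t) t := by
    refine HasDerivAt.congr_deriv (((((hasDerivAt_id t).pow 2).const_mul P.β).const_sub P.c₀).const_mul P.μ) ?_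
    simp [rate]; ring
  rw [mul_comm]
  exact h1.exp

lemma hasDerivAt_ph : HasDerivAt (fun t => P.ph t x y) (P.phT t x y) t := by
  refine HasDerivAt.congr_deriv (((P.hasDerivAt_amp t).mul_const (P.e x)).mul_const (P.e y)) ?_
  simp only [phT, ph]; ring

lemma hasDerivAt_phT : HasDerivAt (fun t => P.phT t x y) (P.phTT t x y) t := by
  refine HasDerivAt.congr_deriv ((P.hasDerivAt_rate t).fun_mul (P.hasDerivAt_ph t x y)) ?_
  simp only [phTT, phT]; ring

lemma hasDerivAt_ph₁ : HasDerivAt (fun t => P.ph₁ h t x y) (P.rate t * P.ph₁ h t x y) t := by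
  refine HasDerivAt.congr_deriv (((P.hasDerivAt_amp t).mul_const (P.e₁ h x)).mul_const (P.e y)) ?_
  simp only [ph₁]; ring

lemma hasDerivAt_gee : HasDerivAt (fun t => P.gee t x y) (P.geeT t x y) t := by
  have h1 : HasDerivAt (fun t => P.qf t x y) (-8 * P.β ^ 2 * t) t := by
    refine HasDerivAt.congr_deriv ((((hasDerivAt_id t).pow 2).const_mul (4 * P.β ^ 2)).const_sub
      (4 * (x + P.a) ^ 2 + 4 * (y + P.a) ^ 2)) ?_
    simp; ring
  exact ((P.hasDerivAt_ph t x y).const_mul P.μ).fun_mul ((h1.const_mul P.μ).const_add 2)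

lemma hasDerivAt_cosC : HasDerivAt (fun t => P.cosC ρ h t x y) (P.cosT ρ h t x y) t :=
  ((P.hasDerivAt_ph₁ h t x y).const_mul ρ).cosh

variable {ρ}

lemma hasDerivAt_sinC (hρ : ρ ≠ 0) :
    HasDerivAt (fun t => P.sinC ρ h t x y) (P.sinT ρ h t x y) t := by
  have e : (fun t => P.sinC ρ h t x y) = fun t => Real.sinh (ρ * P.ph₁ h t x y) / ρ := by
    funext t; rw [← mul_sinhQuot, mul_div_cancel_left₀ _ hρ, sinC]
  rw [e]
  refine HasDerivAt.congr_deriv ((((P.hasDerivAt_ph₁ h t x y).const_mul ρ).sinh).div_const ρ) ?_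
  rw [sinT]; field_simp

lemma hasDerivAt_pot (hρ : ρ ≠ 0) :
    HasDerivAt (fun t => P.pot ρ h t x y) (P.potT ρ h t x y) t := by
  have e : (fun t => P.pot ρ h t x y) = fun t => (P.cosC ρ h t x y - 1) / ρ ^ 2 := by
    funext t; rw [cosC_eq]; field_simp; ring
  rw [e]
  refine HasDerivAt.congr_deriv (((P.hasDerivAt_cosC ρ h t x y).sub_const 1).div_const (ρ ^ 2)) ?_
  rw [cosT, ← mul_sinhQuot, potT, sinC]
  field_simp

lemma hasDerivAt_qu (hρ : ρ ≠ 0) : HasDerivAt (fun t => P.qu ρ h t x y) (P.quT ρ h t x y) t := by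
  refine HasDerivAt.congr_deriv ((((P.hasDerivAt_phT t x y).fun_pow 2).fun_sub
    ((P.hasDerivAt_pot h t x y hρ).fun_add (P.hasDerivAt_pot h t (x - h) y hρ))).fun_sub
    ((P.hasDerivAt_pot h t y x hρ).fun_add (P.hasDerivAt_pot h t (y - h) x hρ))) ?_
  simp only [quT]; push_cast; ring

lemma hasDerivAt_expW (τ : ℝ) (i j : ℤ) : HasDerivAt (fun t => P.expW τ h t i j)
    (P.expW τ h t i j * (τ * P.phT t (i * h) (j * h))) t :=
  ((P.hasDerivAt_ph t (i * h) (j * h)).const_mul τ).exp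

end TimeDerivatives

section EnergyPrimitives

variable (P : Params) {τ h a b : ℝ}

@[fun_prop]
lemma continuous_expW (τ h : ℝ) (i j : ℤ) : Continuous fun t => P.expW τ h t i j := by
  unfold expW; fun_prop

lemma isPrimitive_conj₀ {W W₁ : ℝ → ℤ → ℤ → ℝ} {i j : ℤ}
    (hW : IsPrimitive a b (fun t => W t i j) (fun t => W₁ t i j)) :
    IsPrimitive a b (fun t => P.conj₀ τ h t (W t) i j)
      (fun t => P.conj₁ τ h t (W t) (W₁ t) i j) := by
  have hE : IsPrimitive a b (fun t => P.expW τ h t i j) _ :=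
    .of_hasDerivAt (fun t => P.hasDerivAt_expW h t τ i j) (by fun_prop)
  exact (hE.mul hW).congr (fun t => rfl) (fun t => by simp only [conj₁]; ring)

lemma isPrimitive_conj₁ {W W₁ W₂ : ℝ → ℤ → ℤ → ℝ} {i j : ℤ}
    (hW : IsPrimitive a b (fun t => W t i j) (fun t => W₁ t i j))
    (hW₁ : IsPrimitive a b (fun t => W₁ t i j) (fun t => W₂ t i j)) :
    IsPrimitive a b (fun t => P.conj₁ τ h t (W t) (W₁ t) i j)
      (fun t => P.conj₂ τ h t (W t) (W₁ t) (W₂ t) i j) := by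
  have hE : IsPrimitive a b (fun t => P.expW τ h t i j) _ :=
    .of_hasDerivAt (fun t => P.hasDerivAt_expW h t τ i j) (by fun_prop)
  have hφ : IsPrimitive a b (fun t => P.phT t (i * h) (j * h)) _ :=
    .of_hasDerivAt (fun t => P.hasDerivAt_phT t (i * h) (j * h)) (by fun_prop)
  exact (hE.mul (hW₁.add ((hφ.const_mul τ).mul hW))).congr (fun t => rfl)
    (fun t => by simp only [conj₂]; ring)

variable (hρ : τ * h ≠ 0) {v v₁ v₂ : ℝ → ℤ → ℤ → ℝ}
  (hv : ∀ i j, IsPrimitive a b (fun t => v t i j) (fun t => v₁ t i j))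
  (hv₁ : ∀ i j, IsPrimitive a b (fun t => v₁ t i j) (fun t => v₂ t i j))

lemma isPrimitive_dX {v v₁ : ℝ → ℤ → ℤ → ℝ}
    (hv : ∀ i j, IsPrimitive a b (fun t => v t i j) (fun t => v₁ t i j)) (i j : ℤ) :
    IsPrimitive a b (fun t => dX h (v t) i j) (fun t => dX h (v₁ t) i j) :=
  (((hv (i + 1) j).sub (hv i j)).const_mul h⁻¹).congr (fun t => by simp only [dX]; ring)
    (fun t => by simp only [dX]; ring)

lemma isPrimitive_dY {v v₁ : ℝ → ℤ → ℤ → ℝ}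
    (hv : ∀ i j, IsPrimitive a b (fun t => v t i j) (fun t => v₁ t i j)) (i j : ℤ) :
    IsPrimitive a b (fun t => dY h (v t) i j) (fun t => dY h (v₁ t) i j) :=
  (((hv i (j + 1)).sub (hv i j)).const_mul h⁻¹).congr (fun t => by simp only [dY]; ring)
    (fun t => by simp only [dY]; ring)

include hρ hv hv₁

lemma isPrimitive_energy (i j : ℤ) :
    IsPrimitive a b (fun t => (P.coeffs τ h t).energy (v t) (v₁ t) i j)
      (fun t => (P.coeffs τ h t).energyDeriv (v t) (v₁ t) (v₂ t) i j) := by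
  have hb : ∀ i j : ℤ, IsPrimitive a b (fun t => (P.coeffs τ h t).b i j)
      (fun t => (P.coeffs τ h t).bt i j) := fun i j =>
    .of_hasDerivAt (fun t => (P.hasDerivAt_phT t (i * h) (j * h)).const_mul τ)
      (by simp only [coeffs]; fun_prop)
  have hg : IsPrimitive a b (fun t => (P.coeffs τ h t).g i j)
      (fun t => (P.coeffs τ h t).gt i j) :=
    .of_hasDerivAt (fun t => (P.hasDerivAt_gee t (i * h) (j * h)).const_mul τ)
      (by simp only [coeffs]; fun_prop)
  have hq : IsPrimitive a b (fun t => (P.coeffs τ h t).q i j)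
      (fun t => (P.coeffs τ h t).qt i j) :=
    .of_hasDerivAt (fun t => (P.hasDerivAt_qu h t (i * h) (j * h) hρ).const_mul (τ ^ 2))
      (by simp only [coeffs]; fun_prop)
  have hc₁ : IsPrimitive a b (fun t => (P.coeffs τ h t).c₁ i j)
      (fun t => (P.coeffs τ h t).c₁t i j) :=
    .of_hasDerivAt (fun t => P.hasDerivAt_cosC (τ * h) h t (i * h) (j * h))
      (by simp only [coeffs]; fun_prop)
  have hc₂ : IsPrimitive a b (fun t => (P.coeffs τ h t).c₂ i j)
      (fun t => (P.coeffs τ h t).c₂t i j) :=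
    .of_hasDerivAt (fun t => P.hasDerivAt_cosC (τ * h) h t (j * h) (i * h))
      (by simp only [coeffs]; fun_prop)
  have hs₁ : ∀ i j : ℤ, IsPrimitive a b (fun t => (P.coeffs τ h t).s₁ i j)
      (fun t => (P.coeffs τ h t).s₁t i j) := fun i j =>
    .of_hasDerivAt (fun t => (P.hasDerivAt_sinC h t (i * h) (j * h) hρ).const_mul τ)
      (by simp only [coeffs]; fun_prop)
  have hs₂ : ∀ i j : ℤ, IsPrimitive a b (fun t => (P.coeffs τ h t).s₂ i j)
      (fun t => (P.coeffs τ h t).s₂t i j) := fun i j =>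
    .of_hasDerivAt (fun t => (P.hasDerivAt_sinC h t (j * h) (i * h) hρ).const_mul τ)
      (by simp only [coeffs]; fun_prop)
  have hX := isPrimitive_dX (h := h) hv
  have hY := isPrimitive_dY (h := h) hv
  have hA : IsPrimitive a b (fun t => (P.coeffs τ h t).advect (v t) i j)
      (fun t => (P.coeffs τ h t).advectT (v t) i j + (P.coeffs τ h t).advect (v₁ t) i j) :=
    ((((hs₁ i j).mul (hX i j)).add ((hs₁ (i - 1) j).mul (hX (i - 1) j))).add
      (((hs₂ i j).mul (hY i j)).add ((hs₂ i (j - 1)).mul (hY i (j - 1))))).congr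
      (fun t => rfl) (fun t => by
        simp only [Coeffs.advect, Coeffs.advectT, show (P.coeffs τ h t).h = h from rfl]; ring)
  have hJ : IsPrimitive a b (fun t => (P.coeffs τ h t).jump (v t) i j)
      (fun t => (P.coeffs τ h t).jump (v₁ t) i j) :=
    ((hX i j).sub (hX (i - 1) j)).add ((hY i j).sub (hY i (j - 1)))
  have hV := hv i j
  have hV₁ := hv₁ i j
  refine ((((((((((hb i j).mul (hV₁.mul hV₁)).const_mul (-2)).add
    ((hV₁.mul hA).const_mul 2)).add ((hg.mul (hV.mul hV₁)).const_mul 2)).sub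
    ((hV₁.mul hJ).const_mul (2 * (P.Z * (τ * h))))).sub
    ((hc₁.mul ((hb i j).add (hb (i + 1) j))).mul ((hX i j).mul (hX i j)))).sub
    ((hc₂.mul ((hb i j).add (hb i (j + 1)))).mul ((hY i j).mul (hY i j)))).sub
    (((hq.mul (hb i j)).mul (hV.mul hV)).const_mul 2))).congr (fun t => ?_) (fun t => ?_)
  · simp only [Coeffs.energy, show (P.coeffs τ h t).h = h from rfl,
      show (P.coeffs τ h t).Y = P.Z * (τ * h) from rfl]
    ring
  · simp only [Coeffs.energyDeriv, show (P.coeffs τ h t).h = h from rfl,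
      show (P.coeffs τ h t).Y = P.Z * (τ * h) from rfl]
    ring

lemma isPrimitive_natEnergy (i j : ℤ) :
    IsPrimitive a b (fun t => (P.coeffs τ h t).natEnergy (v t) (v₁ t) i j)
      (fun t => (P.coeffs τ h t).natEnergyDeriv (v t) (v₁ t) (v₂ t) i j) := by
  have hq : IsPrimitive a b (fun t => (P.coeffs τ h t).q i j)
      (fun t => (P.coeffs τ h t).qt i j) :=
    .of_hasDerivAt (fun t => (P.hasDerivAt_qu h t (i * h) (j * h) hρ).const_mul (τ ^ 2))
      (by simp only [coeffs]; fun_prop)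
  have hc₁ : IsPrimitive a b (fun t => (P.coeffs τ h t).c₁ i j)
      (fun t => (P.coeffs τ h t).c₁t i j) :=
    .of_hasDerivAt (fun t => P.hasDerivAt_cosC (τ * h) h t (i * h) (j * h))
      (by simp only [coeffs]; fun_prop)
  have hc₂ : IsPrimitive a b (fun t => (P.coeffs τ h t).c₂ i j)
      (fun t => (P.coeffs τ h t).c₂t i j) :=
    .of_hasDerivAt (fun t => P.hasDerivAt_cosC (τ * h) h t (j * h) (i * h))
      (by simp only [coeffs]; fun_prop)
  have hX := isPrimitive_dX (h := h) hv i j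
  have hY := isPrimitive_dY (h := h) hv i j
  have hV := hv i j
  have hV₁ := hv₁ i j
  refine ((((hV₁.mul hV₁).add (hc₁.mul (hX.mul hX))).add (hc₂.mul (hY.mul hY))).add
    (hq.mul (hV.mul hV))).congr (fun t => ?_) (fun t => ?_)
  · simp only [Coeffs.natEnergy, show (P.coeffs τ h t).h = h from rfl]
    ring
  · simp only [Coeffs.natEnergyDeriv, show (P.coeffs τ h t).h = h from rfl]
    ring

end EnergyPrimitives
end Params

lemma isPrimitive_boxSum {a b : ℝ} (N : ℕ) {F F' : ℝ → ℤ → ℤ → ℝ}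
    (h : ∀ i j, IsPrimitive a b (fun t => F t i j) (fun t => F' t i j)) :
    IsPrimitive a b (fun t => boxSum N (F t)) (fun t => boxSum N (F' t)) :=
  .sum _ fun i => .sum _ fun j => h i j

/-! ### Regularity of admissible functions and integrability of the densities -/

namespace Admissible

variable {N : ℕ} {T : ℝ} {w : ℝ → GridFn}

/-- At `t = ± T` this is part of the terminal conditions. -/
lemma boundaryZero (hw : Admissible N T w) {t : ℝ} (ht : t ∈ Icc (-T) T) :
    BoundaryZero N (w t) := by
  intro l hl
  rcases eq_or_lt_of_le ht.1 with h | h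
  · subst h
    refine ⟨(hw.final_zero 0 (by simp) l hl).1, (hw.final_zero (N + 1) (by simp) l hl).1,
      (hw.final_zero l hl 0 (by simp)).1, (hw.final_zero l hl (N + 1) (by simp)).1⟩
  · rcases eq_or_lt_of_le ht.2 with h' | h'
    · subst h'
      refine ⟨(hw.final_zero 0 (by simp) l hl).2.1, (hw.final_zero (N + 1) (by simp) l hl).2.1,
        (hw.final_zero l hl 0 (by simp)).2.1, (hw.final_zero l hl (N + 1) (by simp)).2.1⟩
    · exact hw.boundary_zero t ⟨h, h'⟩ l hl

lemma boundaryZero_dt (hw : Admissible N T w) {t : ℝ} (ht : t ∈ Icc (-T) T) :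
    BoundaryZero N (dt T w t) := by
  have key : ∀ i j, (∀ s ∈ Icc (-T) T, w s i j = 0) → dt T w t i j = 0 := fun i j h => by
    rw [dt, derivWithin_congr (f := fun _ => (0 : ℝ)) h (h t ht)]
    simp
  intro l hl
  exact ⟨key _ _ fun s hs => (hw.boundaryZero hs l hl).1,
    key _ _ fun s hs => (hw.boundaryZero hs l hl).2.1,
    key _ _ fun s hs => (hw.boundaryZero hs l hl).2.2.1,
    key _ _ fun s hs => (hw.boundaryZero hs l hl).2.2.2⟩

/-- The derivative of `w` is absolutely continuous, hence bounded, so that `w` is Lipschitz. -/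
lemma isPrimitive (hw : Admissible N T w) (hT : 0 < T) {i j : ℕ} (hi : i ∈ Finset.Icc 1 N)
    (hj : j ∈ Finset.Icc 1 N) :
    IsPrimitive (-T) T (fun t => w t i j) (fun t => dt T w t i j) := by
  have hd := hw.differentiable i hi j hj
  refine ⟨?_, .of_forall fun t ht => ?_⟩
  · obtain ⟨C, hC⟩ := (hw.absolutelyContinuous i hi j hj).exists_bound
    rw [uIcc_of_le (by linarith)] at hC
    refine LipschitzOnWith.absolutelyContinuousOnInterval (K := C.toNNReal) ?_
    rw [uIcc_of_le (by linarith)]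
    exact Convex.lipschitzOnWith_of_nnnorm_derivWithin_le (convex_Icc _ _) hd
      fun t ht => NNReal.coe_le_coe.1 ((hC t ht).trans (Real.le_coe_toNNReal C))
  · exact (hd t (Ioo_subset_Icc_self ht)).hasDerivWithinAt.hasDerivAt (Icc_mem_nhds ht.1 ht.2)

/-- Absolutely continuous functions are differentiable almost everywhere. -/
lemma isPrimitive_dt (hw : Admissible N T w) (hT : 0 < T) {i j : ℕ} (hi : i ∈ Finset.Icc 1 N)
    (hj : j ∈ Finset.Icc 1 N) :
    IsPrimitive (-T) T (fun t => dt T w t i j) (fun t => dt T (dt T w) t i j) := by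
  have hac := hw.absolutelyContinuous i hi j hj
  refine ⟨hac, ?_⟩
  filter_upwards [hac.ae_differentiableAt] with t h ht
  have hd := h (by rw [uIcc_of_le (by linarith)]; exact Ioo_subset_Icc_self ht)
  rw [dt, derivWithin_of_mem_nhds (Icc_mem_nhds ht.1 ht.2)]
  exact hd.hasDerivAt

lemma isPrimitive_ext (hw : Admissible N T w) (hT : 0 < T) (i j : ℤ) :
    IsPrimitive (-T) T (fun t => ext N (w t) i j) (fun t => ext N (dt T w t) i j) := by
  unfold ext interior
  by_cases h : 1 ≤ i ∧ i ≤ N ∧ 1 ≤ j ∧ j ≤ N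
  · simp only [if_pos h]
    exact hw.isPrimitive hT (by simp; omega) (by simp; omega)
  · simp only [if_neg h]
    exact .const 0

lemma isPrimitive_ext_dt (hw : Admissible N T w) (hT : 0 < T) (i j : ℤ) :
    IsPrimitive (-T) T (fun t => ext N (dt T w t) i j)
      (fun t => ext N (dt T (dt T w) t) i j) := by
  unfold ext interior
  by_cases h : 1 ≤ i ∧ i ≤ N ∧ 1 ≤ j ∧ j ≤ N
  · simp only [if_pos h]
    exact hw.isPrimitive_dt hT (by simp; omega) (by simp; omega)
  · simp only [if_neg h]
    exact .const 0

lemma continuousOn (hw : Admissible N T w) (hT : 0 < T) {i j : ℕ} (hi : i ≤ N + 1)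
    (hj : j ≤ N + 1) : ContinuousOn (fun t => w t i j) (Icc (-T) T) := by
  have h := (hw.isPrimitive_ext hT i j).1.continuousOn
  rw [uIcc_of_le (by linarith)] at h
  exact h.congr fun t ht => (ext_apply_of_boundaryZero (hw.boundaryZero ht) hi hj).symm

lemma continuousOn_dt (hw : Admissible N T w) (hT : 0 < T) {i j : ℕ} (hi : i ≤ N + 1)
    (hj : j ≤ N + 1) : ContinuousOn (fun t => dt T w t i j) (Icc (-T) T) := by
  have h := (hw.isPrimitive_ext_dt hT i j).1.continuousOn
  rw [uIcc_of_le (by linarith)] at h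
  exact h.congr fun t ht => (ext_apply_of_boundaryZero (hw.boundaryZero_dt ht) hi hj).symm

end Admissible

section Densities

lemma intOmega_nonneg {N : ℕ} {f : GridFn} (h : ∀ i j, 0 ≤ f i j) : 0 ≤ intOmega N f :=
  mul_nonneg (sq_nonneg _) (Finset.sum_nonneg fun _ _ => Finset.sum_nonneg fun _ _ => h _ _)

lemma intOmegaMinus_nonneg {N : ℕ} {f : GridFn} (h : ∀ i j, 0 ≤ f i j) (k : Fin 2) :
    0 ≤ intOmegaMinus N k f := by
  fin_cases k
  all_goals
    exact mul_nonneg (sq_nonneg (mesh N))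
      (Finset.sum_nonneg fun _ _ => Finset.sum_nonneg fun _ _ => h _ _)

lemma intGammaPlus_nonneg {N : ℕ} {f : GridFn} (h : ∀ i j, 0 ≤ f i j) (k : Fin 2) :
    0 ≤ intGammaPlus N k f := by
  fin_cases k
  all_goals exact mul_nonneg (mesh_pos N).le (Finset.sum_nonneg fun _ _ => h _ _)

lemma lhsDensity_nonneg {N : ℕ} {τ : ℝ} (hτ : 0 ≤ τ) {ρ : GridFn} (hρ : ∀ i j, 0 ≤ ρ i j)
    (u u₁ : GridFn) : 0 ≤ lhsDensity N τ ρ u u₁ := by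
  have h : ∀ g : GridFn, ∀ i j, 0 ≤ ρ i j * |g i j| ^ 2 := fun g i j =>
    mul_nonneg (hρ i j) (by positivity)
  unfold lhsDensity
  have h1 := intOmega_nonneg (N := N) (h u₁)
  have h2 := intOmega_nonneg (N := N) (h u)
  have h3 : 0 ≤ ∑ k : Fin 2, intOmegaMinus N k (fun i j => ρ i j * |dPlus N k u i j| ^ 2) :=
    Finset.sum_nonneg fun k _ => intOmegaMinus_nonneg (h _) k
  positivity

lemma rhsDensity_nonneg {N : ℕ} {τ : ℝ} (hτ : 0 ≤ τ) {ρ : GridFn} (hρ : ∀ i j, 0 ≤ ρ i j)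
    (u u₁ f : GridFn) : 0 ≤ rhsDensity N τ ρ u u₁ f := by
  have h : ∀ g : GridFn, ∀ i j, 0 ≤ ρ i j * |g i j| ^ 2 := fun g i j =>
    mul_nonneg (hρ i j) (by positivity)
  unfold rhsDensity
  have h1 := intOmega_nonneg (N := N) (h f)
  have h2 : 0 ≤ ∑ k : Fin 2, intGammaPlus N k (fun i j => ρ i j * |dMinus N k u i j| ^ 2) :=
    Finset.sum_nonneg fun k _ => intGammaPlus_nonneg (h _) k
  have h3 : 0 ≤ ∑ k : Fin 2, intOmegaMinus N k (fun i j => ρ i j * |dPlus N k u₁ i j| ^ 2) :=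
    Finset.sum_nonneg fun k _ => intOmegaMinus_nonneg (h _) k
  positivity

variable {N : ℕ} {T : ℝ} {ρ w : ℝ → GridFn}

lemma intervalIntegrable_intOmega {F : ℝ → GridFn}
    (h : ∀ i ∈ Finset.Icc 1 N, ∀ j ∈ Finset.Icc 1 N,
      IntervalIntegrable (fun t => F t i j) volume (-T) T) :
    IntervalIntegrable (fun t => intOmega N (F t)) volume (-T) T := by
  refine IntervalIntegrable.const_mul ?_ _
  have := IntervalIntegrable.sum (μ := volume) (a := -T) (b := T) (Finset.Icc 1 N)
    (f := fun i t => ∑ j ∈ Finset.Icc 1 N, F t i j) fun i hi => by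
      have := IntervalIntegrable.sum (Finset.Icc 1 N) (f := fun j t => F t i j) (h i hi)
      simpa only [Finset.sum_fn] using this
  simpa only [Finset.sum_fn] using this

variable (hT : 0 < T) (hρ : ∀ i j, Continuous fun t => ρ t i j) (hw : Admissible N T w)
include hT hρ hw

lemma intervalIntegrable_intOmega_dt :
    IntervalIntegrable (fun t => intOmega N (fun i j => ρ t i j * |dt T w t i j| ^ 2))
      volume (-T) T := by
  refine intervalIntegrable_intOmega fun i hi j hj => ContinuousOn.intervalIntegrable ?_
  rw [uIcc_of_le (by linarith)]
  rw [Finset.mem_Icc] at hi hj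
  exact (hρ i j).continuousOn.mul ((hw.continuousOn_dt hT (by omega) (by omega)).abs.pow 2)

lemma intervalIntegrable_intOmega_self :
    IntervalIntegrable (fun t => intOmega N (fun i j => ρ t i j * |w t i j| ^ 2))
      volume (-T) T := by
  refine intervalIntegrable_intOmega fun i hi j hj => ContinuousOn.intervalIntegrable ?_
  rw [uIcc_of_le (by linarith)]
  rw [Finset.mem_Icc] at hi hj
  exact (hρ i j).continuousOn.mul ((hw.continuousOn hT (by omega) (by omega)).abs.pow 2)

/-- The only integrand that is not continuous in time; it is integrable because `□ w` is square
integrable. -/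
lemma intervalIntegrable_intOmega_box :
    IntervalIntegrable (fun t => intOmega N (fun i j => ρ t i j * |box N T w t i j| ^ 2))
      volume (-T) T := by
  refine intervalIntegrable_intOmega fun i hi j hj => ?_
  refine IntervalIntegrable.continuousOn_mul ?_ (hρ i j).continuousOn
  rw [intervalIntegrable_iff_integrableOn_Ioo_of_le (by linarith)]
  simp only [sq_abs]
  exact (hw.box_memLp i hi j hj).integrable_sq

omit hw in
/-- Integrability of the edge sums, for any function that is continuous on the closed grid. -/
lemma intervalIntegrable_intOmegaMinus {u : ℝ → GridFn}
    (hu : ∀ i j : ℕ, i ≤ N + 1 → j ≤ N + 1 → ContinuousOn (fun t => u t i j) (Icc (-T) T))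
    (k : Fin 2) :
    IntervalIntegrable (fun t => intOmegaMinus N k (fun i j => ρ t i j * |dPlus N k (u t) i j| ^ 2))
      volume (-T) T := by
  refine ContinuousOn.intervalIntegrable ?_
  rw [uIcc_of_le (by linarith)]
  fin_cases k
  all_goals
    refine continuousOn_const.mul (continuousOn_finsetSum _ fun i hi =>
      continuousOn_finsetSum _ fun j hj => (hρ i j).continuousOn.mul (ContinuousOn.pow ?_ 2))
    rw [Finset.mem_Icc] at hi hj
    exact (((hu _ _ (by omega) (by omega)).sub (hu _ _ (by omega) (by omega))).div_const _).abs

lemma intervalIntegrable_intGammaPlus (k : Fin 2) :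
    IntervalIntegrable (fun t => intGammaPlus N k (fun i j => ρ t i j * |dMinus N k (w t) i j| ^ 2))
      volume (-T) T := by
  refine ContinuousOn.intervalIntegrable ?_
  rw [uIcc_of_le (by linarith)]
  fin_cases k
  all_goals
    refine continuousOn_const.mul (continuousOn_finsetSum _ fun i hi =>
      (hρ _ _).continuousOn.mul (ContinuousOn.pow ?_ 2))
    rw [Finset.mem_Icc] at hi
    exact (((hw.continuousOn hT (by omega) (by omega)).sub
      (hw.continuousOn hT (by omega) (by omega))).div_const _).abs

/-- The left-hand side of the Carleman estimate is the time integral of its density. -/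
lemma integral_lhsDensity (τ : ℝ) :
    IntervalIntegrable (fun t => lhsDensity N τ (ρ t) (w t) (dt T w t)) volume (-T) T ∧
      ∫ t in (-T)..T, lhsDensity N τ (ρ t) (w t) (dt T w t) = carlemanLHS N T τ ρ w := by
  have h1 := (intervalIntegrable_intOmega_dt hT hρ hw).const_mul τ
  have h2 := intervalIntegrable_intOmegaMinus hT hρ (fun i j => hw.continuousOn hT (i := i) (j := j))
  have h3 := (intervalIntegrable_intOmega_self hT hρ hw).const_mul (τ ^ 3)
  have h4 := ((h2 0).add (h2 1)).const_mul τ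
  unfold lhsDensity carlemanLHS
  simp only [Fin.sum_univ_two]
  refine ⟨(h1.add h4).add h3, ?_⟩
  rw [intervalIntegral.integral_add (h1.add h4) h3, intervalIntegral.integral_add h1 h4,
    intervalIntegral.integral_const_mul, intervalIntegral.integral_const_mul,
    intervalIntegral.integral_const_mul, intervalIntegral.integral_add (h2 0) (h2 1)]

/-- The right-hand side of the Carleman estimate is the time integral of its density. -/
lemma integral_rhsDensity (τ C : ℝ) :
    IntervalIntegrable (fun t => rhsDensity N τ (ρ t) (w t) (dt T w t) (box N T w t))
        volume (-T) T ∧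
      C * ∫ t in (-T)..T, rhsDensity N τ (ρ t) (w t) (dt T w t) (box N T w t)
        = carlemanRHS N T τ C ρ w := by
  have h1 := intervalIntegrable_intOmega_box hT hρ hw
  have h2 := intervalIntegrable_intGammaPlus hT hρ hw
  have h3 := intervalIntegrable_intOmegaMinus hT hρ
    (fun i j => hw.continuousOn_dt hT (i := i) (j := j))
  have h4 := ((h2 0).add (h2 1)).const_mul τ
  have h5 := ((h3 0).add (h3 1)).const_mul (τ * mesh N ^ 2)
  unfold rhsDensity carlemanRHS
  simp only [Fin.sum_univ_two]
  refine ⟨(h1.add h4).add h5, ?_⟩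
  rw [intervalIntegral.integral_add (h1.add h4) h5, intervalIntegral.integral_add h1 h4,
    intervalIntegral.integral_const_mul, intervalIntegral.integral_const_mul,
    intervalIntegral.integral_add (h2 0) (h2 1), intervalIntegral.integral_add (h3 0) (h3 1)]
  ring

end Densities

/-! ### Integration in time -/

namespace Params

/-- The derivative of the natural energy, weighted by `√τ`, is absorbed by the controlled terms of
the differential inequality. -/
lemma sqrt_mul_boxSum_natEnergyDeriv_le (P : Params) {κ κ' τ h t : ℝ} {N : ℕ} (hκ' : 0 ≤ κ')
    (h1 : κ' ≤ 1) (hκ : κ' ≤ κ) (hτ : 1 ≤ τ) {v v₁ v₂ : ℤ → ℤ → ℝ}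
    (hv₁ : InteriorSupported N v₁) :
    κ' * √τ * boxSum N ((P.coeffs τ h t).natEnergyDeriv v v₁ v₂)
      ≤ κ * τ * boxSum N (fun i j => v₁ i j ^ 2
          + |P.cosT (τ * h) h t (i * h) (j * h)| * dX h v i j ^ 2
          + |P.cosT (τ * h) h t (j * h) (i * h)| * dY h v i j ^ 2
          + |P.quT (τ * h) h t (i * h) (j * h)| * (τ * v i j) ^ 2)
        + boxSum N (interior N fun i j => (P.coeffs τ h t).symPart v v₂ i j ^ 2) := by
  have hs : √τ ^ 2 = τ := Real.sq_sqrt (by linarith)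
  have hs0 : 0 ≤ √τ := Real.sqrt_nonneg τ
  have hs1 : √τ ≤ τ := by
    rw [Real.sqrt_le_iff]
    exact ⟨by linarith, by nlinarith⟩
  have hκτ : κ' * √τ ≤ κ * τ := mul_le_mul hκ hs1 hs0 (hκ'.trans hκ)
  rw [Coeffs.boxSum_natEnergyDeriv _ hv₁, ← boxSum_mul, ← boxSum_mul, ← boxSum_add]
  refine boxSum_le_boxSum fun i j _ _ _ _ => ?_
  have term : ∀ c s : ℝ, 0 ≤ s → κ' * √τ * (c * s) ≤ κ * τ * (|c| * s) := fun c s hs' => by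
    have a1 : c * s ≤ |c| * s := mul_le_mul_of_nonneg_right (le_abs_self c) hs'
    have a2 : 0 ≤ |c| * s := by positivity
    have a3 : 0 ≤ κ' * √τ := by positivity
    calc _ ≤ κ' * √τ * (|c| * s) := mul_le_mul_of_nonneg_left a1 a3
      _ ≤ _ := mul_le_mul_of_nonneg_right hκτ a2
  have b1 := term (P.cosT (τ * h) h t (i * h) (j * h)) (dX h v i j ^ 2) (sq_nonneg _)
  have b2 := term (P.cosT (τ * h) h t (j * h) (i * h)) (dY h v i j ^ 2) (sq_nonneg _)
  have b3 := term (P.quT (τ * h) h t (i * h) (j * h)) ((τ * v i j) ^ 2) (sq_nonneg _)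
  have b4 : κ' * √τ * (2 * (P.coeffs τ h t).symPart v v₂ i j * v₁ i j)
      ≤ κ * τ * v₁ i j ^ 2 + interior N (fun i j => (P.coeffs τ h t).symPart v v₂ i j ^ 2) i j := by
    by_cases hint : 1 ≤ i ∧ i ≤ N ∧ 1 ≤ j ∧ j ≤ N
    · rw [interior, if_pos hint]
      set L := (P.coeffs τ h t).symPart v v₂ i j
      have c1 : κ' * (2 * L * (√τ * v₁ i j)) ≤ κ' * (L ^ 2 + (√τ * v₁ i j) ^ 2) :=
        mul_le_mul_of_nonneg_left (by nlinarith [sq_nonneg (L - √τ * v₁ i j)]) hκ'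
      have c2 : κ' * L ^ 2 ≤ 1 * L ^ 2 := mul_le_mul_of_nonneg_right h1 (sq_nonneg _)
      have c3 : κ' * (τ * v₁ i j ^ 2) ≤ κ * (τ * v₁ i j ^ 2) :=
        mul_le_mul_of_nonneg_right hκ (by positivity)
      rw [mul_pow, hs] at c1
      linarith
    · rw [interior, if_neg hint, hv₁ i j (by omega)]
      simp
  simp only [coeffs] at b4 ⊢
  linarith

/-- The energy vanishes where `v` and its time derivative vanish. -/
lemma _root_.SemiDiscreteWave.Coeffs.energy_zero (K : Coeffs) (i j : ℤ) :
    K.energy (fun _ _ => 0) (fun _ _ => 0) i j = 0 := by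
  simp [Coeffs.energy, dX, dY]

/-- At time zero the time derivative of the weight vanishes, so that the energy vanishes as soon as
`v` does. -/
lemma energy_time_zero (P : Params) (τ h : ℝ) (v₁ : ℤ → ℤ → ℝ) (i j : ℤ) :
    (P.coeffs τ h 0).energy (fun _ _ => 0) v₁ i j = 0 := by
  simp [Coeffs.energy, Coeffs.advect, Coeffs.jump, coeffs, dX, dY, phT, rate]

end Params

lemma ext_eq_zero {N : ℕ} {u : GridFn}
    (h : ∀ i ∈ Finset.Icc 1 N, ∀ j ∈ Finset.Icc 1 N, u i j = 0) :
    ext N u = fun _ _ => 0 := by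
  funext i j
  unfold ext interior
  split_ifs with hij
  · exact h _ (by simp; omega) _ (by simp; omega)
  · rfl

/-- The Carleman estimate and the estimate at time zero, for parameters for which the coercivity
conditions hold. -/
theorem carleman_of_coercive (P : Params) {T κ B τ : ℝ} {N : ℕ} (ha : 0 < P.a) (hμ : 0 ≤ P.μ)
    (hZ : 0 ≤ P.Z) (hT : 0 < T) (hκ : 0 < κ) (hB : 0 < B) (hτ : 1 ≤ τ)
    (hP : P.Coercive T κ B τ⁻¹ (τ * mesh N) (mesh N)) {w : ℝ → GridFn} (hw : Admissible N T w) :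
    carlemanLHS N T τ (weight P.a P.β P.c₀ P.μ τ N) w
        ≤ carlemanRHS N T τ ((2 + B + 4 * P.Z * B) / min κ 1) (weight P.a P.β P.c₀ P.μ τ N) w ∧
      ((∀ i ∈ Finset.Icc 1 N, ∀ j ∈ Finset.Icc 1 N, w 0 i j = 0) →
        √τ * intOmega N (fun i j => weight P.a P.β P.c₀ P.μ τ N 0 i j * |dt T w 0 i j| ^ 2)
          ≤ carlemanRHS N T τ ((2 + B + 4 * P.Z * B) / min κ 1)
              (weight P.a P.β P.c₀ P.μ τ N) w) := by
  have hτ0 : 0 < τ := by linarith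
  have hh := mesh_pos N
  set κ' := min κ 1 with hκ'
  have hκ0 : 0 < κ' := lt_min hκ one_pos
  set C := 2 + B + 4 * P.Z * B with hC
  have hC0 : 0 < C := by positivity
  set ρ := weight P.a P.β P.c₀ P.μ τ N with hρ'
  have hρ : ∀ i j, Continuous fun t => ρ t i j := fun i j => by
    simp only [hρ', weight_eq]
    fun_prop
  have hρ0 : ∀ t i j, 0 ≤ ρ t i j := fun t i j => (Real.exp_pos _).le
  obtain ⟨il, hl⟩ := integral_lhsDensity hT hρ hw τ
  obtain ⟨ir, hr⟩ := integral_rhsDensity hT hρ hw τ (C / κ')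
  set lhs := fun t => lhsDensity N τ (ρ t) (w t) (dt T w t) with hlhs
  set rhs := fun t => rhsDensity N τ (ρ t) (w t) (dt T w t) (box N T w t) with hrhs
  have hl0 : ∀ t, 0 ≤ lhs t := fun t => lhsDensity_nonneg hτ0.le (hρ0 t) _ _
  have hr0 : ∀ t, 0 ≤ rhs t := fun t => rhsDensity_nonneg hτ0.le (hρ0 t) _ _ _
  let v : ℝ → ℤ → ℤ → ℝ := fun t => P.conj₀ τ (mesh N) t (ext N (w t))
  let v₁ : ℝ → ℤ → ℤ → ℝ := fun t => P.conj₁ τ (mesh N) t (ext N (w t)) (ext N (dt T w t))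
  let v₂ : ℝ → ℤ → ℤ → ℝ := fun t =>
    P.conj₂ τ (mesh N) t (ext N (w t)) (ext N (dt T w t)) (ext N (dt T (dt T w) t))
  have hv : ∀ i j, IsPrimitive (-T) T (fun t => v t i j) (fun t => v₁ t i j) := fun i j =>
    P.isPrimitive_conj₀ (hw.isPrimitive_ext hT i j)
  have hv₁ : ∀ i j, IsPrimitive (-T) T (fun t => v₁ t i j) (fun t => v₂ t i j) := fun i j =>
    P.isPrimitive_conj₁ (hw.isPrimitive_ext hT i j) (hw.isPrimitive_ext_dt hT i j)
  have hv₁s : ∀ t, InteriorSupported N (v₁ t) := fun t => P.interiorSupported_conj₁ τ _ t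
    (interiorSupported_ext N _) (interiorSupported_ext N _)
  have hρτ : τ * mesh N ≠ 0 := by positivity
  have hE := (isPrimitive_boxSum N (P.isPrimitive_energy hρτ hv hv₁)).const_mul (mesh N ^ 2)
  have hM := (isPrimitive_boxSum N (P.isPrimitive_natEnergy hρτ hv hv₁)).const_mul (mesh N ^ 2)
  set E := fun t => mesh N ^ 2 * boxSum N ((P.coeffs τ (mesh N) t).energy (v t) (v₁ t)) with hEd
  set E' := fun t =>
    mesh N ^ 2 * boxSum N ((P.coeffs τ (mesh N) t).energyDeriv (v t) (v₁ t) (v₂ t)) with hE'd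
  set M := fun t => mesh N ^ 2 * boxSum N ((P.coeffs τ (mesh N) t).natEnergy (v t) (v₁ t)) with hMd
  set M' := fun t =>
    mesh N ^ 2 * boxSum N ((P.coeffs τ (mesh N) t).natEnergyDeriv (v t) (v₁ t) (v₂ t)) with hM'd
  have ineq := fun (t : ℝ) (ht : t ∈ Icc (-T) T) =>
    P.energyDeriv_add_lhsDensity_le ha hμ hZ hτ0 hP ht hB
    (hw.boundaryZero ht) (hw.boundaryZero_dt ht) (u₂ := dt T (dt T w) t) (f := box N T w t)
    (fun i j => rfl) (rfl : v t = _) (rfl : v₁ t = _) (rfl : v₂ t = _)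
  have ineqM := fun (t : ℝ) => mul_le_mul_of_nonneg_left
    (P.sqrt_mul_boxSum_natEnergyDeriv_le (h := mesh N) (t := t) (v := v t) (v₂ := v₂ t) hκ0.le
      (min_le_right _ _) (min_le_left _ _) hτ (hv₁s t)) (sq_nonneg (mesh N))
  have ineqA : ∀ t ∈ Icc (-T) T, E' t + κ * lhs t ≤ C * rhs t := fun t ht => by
    refine le_trans (le_add_of_nonneg_right ?_) (ineq t ht)
    have p1 : 0 ≤ boxSum N (fun i j => v₁ t i j ^ 2
          + |P.cosT (τ * mesh N) (mesh N) t (i * mesh N) (j * mesh N)| * dX (mesh N) (v t) i j ^ 2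
          + |P.cosT (τ * mesh N) (mesh N) t (j * mesh N) (i * mesh N)| * dY (mesh N) (v t) i j ^ 2
          + |P.quT (τ * mesh N) (mesh N) t (i * mesh N) (j * mesh N)| * (τ * v t i j) ^ 2) :=
      boxSum_nonneg N fun i j => by positivity
    have p2 : 0 ≤ boxSum N (interior N fun i j =>
        (P.coeffs τ (mesh N) t).symPart (v t) (v₂ t) i j ^ 2) :=
      boxSum_nonneg N fun i j => by unfold interior; positivity
    positivity
  -- the terms dropped in `ineqA` absorb the derivative of `√τ` times the natural energy
  have ineqB : ∀ t ∈ Icc (-T) T, E' t + κ' * √τ * M' t ≤ C * rhs t := fun t ht => by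
    have h1 := ineq t ht
    have h2 := ineqM t
    have h3 := mul_nonneg hκ.le (hl0 t)
    simp only [hE'd, hM'd, hlhs, hrhs] at h3 ⊢
    linarith
  -- at `t = ± T` both `v` and `∂ₜ v` vanish, hence so do the energies
  have hends : ∀ t, (∀ i ∈ Finset.Icc 0 (N + 1), ∀ j ∈ Finset.Icc 0 (N + 1),
      w t i j = 0 ∧ dt T w t i j = 0) → v t = (fun _ _ => 0) ∧ v₁ t = (fun _ _ => 0) := by
    intro t h
    have e0 : ext N (w t) = fun _ _ => 0 := ext_eq_zero fun i hi j hj =>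
      (h i (by simp at hi ⊢; omega) j (by simp at hj ⊢; omega)).1
    have e1 : ext N (dt T w t) = fun _ _ => 0 := ext_eq_zero fun i hi j hj =>
      (h i (by simp at hi ⊢; omega) j (by simp at hj ⊢; omega)).2
    refine ⟨?_, ?_⟩
    · funext i j; simp only [v, e0, Params.conj₀, mul_zero]
    · funext i j; simp only [v₁, e0, e1, Params.conj₁, mul_zero, add_zero]
  obtain ⟨a0, a1⟩ := hends (-T) fun i hi j hj =>
    ⟨(hw.final_zero i hi j hj).1, (hw.final_zero i hi j hj).2.2.1⟩
  obtain ⟨b0, b1⟩ := hends T fun i hi j hj =>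
    ⟨(hw.final_zero i hi j hj).2.1, (hw.final_zero i hi j hj).2.2.2⟩
  have boxz : boxSum N (fun _ _ => 0) = 0 := by simp [boxSum]
  have hEa : E (-T) = 0 := by
    have : (P.coeffs τ (mesh N) (-T)).energy (v (-T)) (v₁ (-T)) = fun _ _ => 0 := by
      funext i j; rw [a0, a1, Coeffs.energy_zero]
    simp only [hEd, this, boxz, mul_zero]
  have hEb : E T = 0 := by
    have : (P.coeffs τ (mesh N) T).energy (v T) (v₁ T) = fun _ _ => 0 := by
      funext i j; rw [b0, b1, Coeffs.energy_zero]
    simp only [hEd, this, boxz, mul_zero]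
  have hMa : M (-T) = 0 := by
    have : (P.coeffs τ (mesh N) (-T)).natEnergy (v (-T)) (v₁ (-T)) = fun _ _ => 0 := by
      funext i j; rw [a0, a1]; simp [Coeffs.natEnergy, dX, dY]
    simp only [hMd, this, boxz, mul_zero]
  have hTT : -T ≤ T := by linarith
  refine ⟨?_, fun h0 => ?_⟩
  · have hint := intervalIntegral.integral_mono_on hTT
      ((hE.intervalIntegrable hTT).add (il.const_mul κ)) (ir.const_mul C) ineqA
    rw [intervalIntegral.integral_add (hE.intervalIntegrable hTT) (il.const_mul κ),
      hE.integral_eq_sub hTT, intervalIntegral.integral_const_mul,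
      intervalIntegral.integral_const_mul, hEa, hEb, hl, sub_zero, zero_add] at hint
    have hL : 0 ≤ carlemanLHS N T τ ρ w := by
      rw [← hl]; exact intervalIntegral.integral_nonneg hTT fun t _ => hl0 t
    rw [← hr, div_mul_eq_mul_div, le_div_iff₀ hκ0, mul_comm]
    exact (mul_le_mul_of_nonneg_right (min_le_left κ 1) hL).trans hint
  · have hT0 : -T ≤ 0 := by linarith
    have hE0 := hE.mono le_rfl hT0 hT.le
    have hM0 := hM.mono le_rfl hT0 hT.le
    have ir0 : IntervalIntegrable rhs volume (-T) 0 := ir.mono_set (by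
      rw [uIcc_of_le hT0, uIcc_of_le hTT]; exact Icc_subset_Icc le_rfl hT.le)
    have ir1 : IntervalIntegrable rhs volume 0 T := ir.mono_set (by
      rw [uIcc_of_le hT.le, uIcc_of_le hTT]; exact Icc_subset_Icc hT0 le_rfl)
    -- integrate over `[-T, 0]`: `E` vanishes at both ends, and `M 0` is the quantity to be bounded
    have hint := intervalIntegral.integral_mono_on hT0
      ((hE0.intervalIntegrable hT0).add ((hM0.intervalIntegrable hT0).const_mul (κ' * √τ)))
      (ir0.const_mul C) fun t ht => ineqB t ⟨ht.1, ht.2.trans hT.le⟩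
    have e0 : ext N (w 0) = fun _ _ => 0 := ext_eq_zero h0
    have v0 : v 0 = fun _ _ => 0 := by
      funext i j; simp only [v, e0, Params.conj₀, mul_zero]
    have hE00 : E 0 = 0 := by
      have : (P.coeffs τ (mesh N) 0).energy (v 0) (v₁ 0) = fun _ _ => 0 := by
        funext i j; rw [v0, Params.energy_time_zero]
      simp only [hEd, this, boxz, mul_zero]
    have hM00 : M 0 = intOmega N (fun i j => ρ 0 i j * |dt T w 0 i j| ^ 2) := by
      refine (intOmega_eq (fun i j hi hj => ?_) (fun i j hij => ?_)).symm
      · rw [v0, hρ', weight_eq, sq_abs]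
        have hz : w 0 i j = 0 := h0 i (by simpa using hi) j (by simpa using hj)
        simp [Coeffs.natEnergy, dX, dY, v₁, Params.conj₁, ext_apply hi hj, hz, mul_pow]
      · rw [v0]
        simp [Coeffs.natEnergy, dX, dY, hv₁s 0 i j hij]
    rw [intervalIntegral.integral_add (hE0.intervalIntegrable hT0)
        ((hM0.intervalIntegrable hT0).const_mul (κ' * √τ)),
      hE0.integral_eq_sub hT0, intervalIntegral.integral_const_mul, hM0.integral_eq_sub hT0,
      intervalIntegral.integral_const_mul, hEa, hMa, hE00, hM00, sub_zero, sub_zero,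
      zero_add] at hint
    have hsplit := intervalIntegral.integral_add_adjacent_intervals ir0 ir1
    have hpos : 0 ≤ ∫ t in (0 : ℝ)..T, rhs t :=
      intervalIntegral.integral_nonneg hT.le fun t _ => hr0 t
    have hle : C * ∫ t in (-T)..0, rhs t ≤ C * ∫ t in (-T)..T, rhs t :=
      mul_le_mul_of_nonneg_left (by linarith) hC0.le
    rw [← hr, div_mul_eq_mul_div, le_div_iff₀ hκ0]
    linarith

end SemiDiscreteWave

end

theorem theorem2p1 (a β T c₀ : ℝ) (ha : 0 < a) (hβ₀ : 0 < β) (hβ₁ : β < 1) (hT : 0 < T)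
    (hc₀ : 0 < c₀)
    (hψ : ∀ t ∈ Set.Icc (-T) T, ∀ x₁ ∈ Set.Icc (0 : ℝ) 1, ∀ x₂ ∈ Set.Icc (0 : ℝ) 1,
      1 ≤ SemiDiscreteWave.psi a β c₀ t x₁ x₂) :
    ∃ τ₀ μ ε h₀ C : ℝ, 1 ≤ τ₀ ∧ 1 ≤ μ ∧ 0 < ε ∧ 0 < h₀ ∧ 0 < C ∧
      ∀ N : ℕ, SemiDiscreteWave.mesh N < h₀ →
      ∀ τ : ℝ, τ₀ < τ → τ < ε / SemiDiscreteWave.mesh N →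
      ∀ w : ℝ → SemiDiscreteWave.GridFn, SemiDiscreteWave.Admissible N T w →
        SemiDiscreteWave.carlemanLHS N T τ (SemiDiscreteWave.weight a β c₀ μ τ N) w
            ≤ SemiDiscreteWave.carlemanRHS N T τ C (SemiDiscreteWave.weight a β c₀ μ τ N) w ∧
        ((∀ i ∈ Finset.Icc 1 N, ∀ j ∈ Finset.Icc 1 N, w 0 i j = 0) →
          τ ^ (1 / 2 : ℝ) * SemiDiscreteWave.intOmega N (fun i j =>
              SemiDiscreteWave.weight a β c₀ μ τ N 0 i j * |SemiDiscreteWave.dt T w 0 i j| ^ 2)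
            ≤ SemiDiscreteWave.carlemanRHS N T τ C
                (SemiDiscreteWave.weight a β c₀ μ τ N) w) := by
  obtain ⟨P, rfl, rfl, rfl, hμ, hZ, κ, hκ, B, hB, ε, hε, H⟩ :=
    SemiDiscreteWave.Params.exists_coercive c₀ T ha hβ₀ hβ₁
  have hκ' : 0 < min κ 1 := lt_min hκ one_pos
  refine ⟨max 1 ε⁻¹, P.μ, ε, ε, (2 + B + 4 * P.Z * B) / min κ 1, le_max_left _ _, hμ, hε, hε,
    by positivity, fun N hN τ hτ₀ hτ w hw => ?_⟩
  have hh := SemiDiscreteWave.mesh_pos N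
  have h1 : 1 < τ := (le_max_left _ _).trans_lt hτ₀
  have h2 : ε⁻¹ < τ := (le_max_right _ _).trans_lt hτ₀
  have hτ0 : 0 < τ := by linarith
  rw [lt_div_iff₀ hh] at hτ
  have hP := H τ⁻¹ (τ * SemiDiscreteWave.mesh N) (SemiDiscreteWave.mesh N)
    (by rw [abs_of_pos (by positivity)]; exact inv_lt_of_inv_lt₀ hε h2)
    (by rwa [abs_of_pos (by positivity)]) (by rwa [abs_of_pos hh])
  rw [← Real.sqrt_eq_rpow]
  exact SemiDiscreteWave.carleman_of_coercive P ha (by linarith) hZ hT hκ hB h1.le hP hw
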